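/- Let $\mathcal H$ be a separable Hilbert space, regarded as a real Hilbert space with scalar product $\langle\cdot,\cdot\rangle$ (that is, $\mathrm{Re}\langle\cdot,\cdot\rangle_{\mathcal H}$ if $\mathcal H$ is complex), and let $v:\mathbb R\times\mathcal H\to\mathcal H$ be continuous and bounded on bounded sets. For an open interval $I\ni 0$, a strong solution on $I$ of the initial value problem $$u'(t)=v(t,u(t)),\qquad u(0)=u_0\in\mathcal H, \tag{ivp}$$ is a curve $u\in\mathscr C^1(I,\mathcal H)$ satisfying (ivp) for all $t\in I$; it is global if $I=\mathbb R$. Fix an orthonormal basis $(e_n)_{n\ge 1}$ (finite if $\dim\mathcal H<\infty$) and set $\|u\|_w^2=\sum_n n^{-2}|\langle u,e_n\rangle|^2$. A curve $(\mu_t)_{t\in\mathbb R}$ of Borel probability measures on $\mathcal H$ is weakly narrowly continuous if $t\mapsto\int_{\mathcal H}\psi\,d\mu_t$ is continuous for every bounded continuous $\psi:(\mathcal H,\|\cdot\|_w)\to\mathbb R$. Suppose: (i) There is a weakly narrowly continuous curve $(\mu_t)_{t\in\mathbb R}$ of Borel probability measures on $\mathcal H$ such that for every bounded open interval $I$ containing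 $0$, $$\int_I\int_{\mathcal H}\|v(t,u)\|\,d\mu_t(u)\,dt<\infty$$ and the Liouville equation $$\int_I\int_{\mathcal H}\big\{\partial_t\phi(t,u)+\langle v(t,u),\nabla\phi(t,u)\rangle\big\}\,d\mu_t(u)\,dt=0$$ holds for all smooth cylindrical functions $\phi(t,u)=\psi(t,\langle u,f_1\rangle,\dots,\langle u,f_m\rangle)$ on $I\times\mathcal H$, where $m\in\mathbb N$, $(f_1,\dots,f_m)$ is an orthonormal family of $\mathcal H$, $\psi\in\mathscr C_0^\infty(I\times\mathbb R^m)$ is smooth with compact support in $I\times\mathbb R^m$, and $\nabla$ is the gradient in $u$. (ii) For every bounded open interval $I$ containing $0$ and every $u_0\in\mathcal H$, (ivp) has at most one strong solution on $I$. Then for $\mu_0$-almost every $u_0\in\mathcal H$ there exists a unique global strong solution of (ivp). Moreover, the set $$\mathcal G=\{u_0\in\mathcal H:\ \text{(ivp) has a global strong solution } u \text{ with } u(0)=u_0\}$$ is a Borel subset of $\mathcal H$ with $\mu_0(\mathcal G)=1$; for each $u_0\in\mathcal G$ the global strong solution $u$ is unique; and for every $t\in\mathbb R$ the map $\Phi_t:\mathcal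 G\to\mathcal H$, $u_0\mapsto u(t)$, is Borel measurable. -/

import Mathlib

open scoped ContDiff

namespace GenFlow

section

variable {H : Type*} [NormedAddCommGroup H] [InnerProductSpace ℝ H]

/-- `u` is a strong solution on the open time set `I` (containing `0`) of the initial value problem
`u'(t) = v (t, u t)`, `u 0 = u₀`.  Only the values of `u` on `I` matter. -/
def IsStrongSolution (v : ℝ × H → H) (I : Set ℝ) (u₀ : H) (u : ℝ → H) : Prop :=
  ContDiffOn ℝ 1 u I ∧ (∀ t ∈ I, HasDerivAt u (v (t, u t)) t) ∧ u 0 = u₀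

/-- The vector field maps bounded sets to bounded sets. -/
def BoundedOnBounded (v : ℝ × H → H) : Prop :=
  ∀ B : Set (ℝ × H), Bornology.IsBounded B → Bornology.IsBounded (v '' B)

/-- The initial value problem has at most one strong solution on every bounded open interval
containing the origin, for every initial datum. -/
def UniqueSolutions (v : ℝ × H → H) : Prop :=
  ∀ a b : ℝ, a < 0 → 0 < b → ∀ (u₀ : H) (u w : ℝ → H),
    IsStrongSolution v (Set.Ioo a b) u₀ u → IsStrongSolution v (Set.Ioo a b) u₀ w →
      Set.EqOn u w (Set.Ioo a b)

/-- The weak norm `(∑ₙ (n + 1)⁻² ⟪eₙ, u⟫²)^(1/2)` attached to an orthonormal basis `(eₙ)`.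
The index set is a set `S` of natural numbers, so that finite-dimensional spaces are included;
for infinite-dimensional spaces one can take `S = ℕ`. -/
noncomputable def weakNorm {S : Set ℕ} (e : HilbertBasis S ℝ H) (u : H) : ℝ :=
  Real.sqrt (∑' n : S, (1 / ((n : ℕ) + 1 : ℝ) ^ 2) * (inner ℝ (e n) u) ^ 2)

/-- Continuity of a real function on `H` equipped with the weak norm. -/
def WeakNormContinuous {S : Set ℕ} (e : HilbertBasis S ℝ H) (ψ : H → ℝ) : Prop :=
  ∀ x : H, ∀ ε > 0, ∃ δ > 0, ∀ y : H, weakNorm e (y - x) < δ → |ψ y - ψ x| < ε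

/-- Weak narrow continuity of a curve of Borel probability measures: `t ↦ ∫ ψ dμ_t` is continuous
for all bounded functions `ψ` that are continuous for the weak norm. -/
def WeaklyNarrowlyContinuous [MeasurableSpace H] {S : Set ℕ} (e : HilbertBasis S ℝ H)
    (μ : ℝ → MeasureTheory.ProbabilityMeasure H) : Prop :=
  ∀ ψ : H → ℝ, (∃ C : ℝ, ∀ u, |ψ u| ≤ C) → WeakNormContinuous e ψ →
    Continuous fun t : ℝ => ∫ u, ψ u ∂(μ t : MeasureTheory.Measure H)

/-- Smooth cylindrical test functions on `I × H`: `φ (t, u) = ψ (t, ⟪e₁, u⟫, …, ⟪eₘ, u⟫)` with an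
orthonormal family `e₁, …, eₘ` and `ψ` smooth, compactly supported in `I × ℝᵐ`. -/
def IsCylindricalTest (I : Set ℝ) (φ : ℝ → H → ℝ) : Prop :=
  ∃ (m : ℕ) (e : Fin m → H) (ψ : ℝ × EuclideanSpace ℝ (Fin m) → ℝ),
    Orthonormal ℝ e ∧ ContDiff ℝ ∞ ψ ∧ HasCompactSupport ψ ∧ tsupport ψ ⊆ I ×ˢ Set.univ ∧
      ∀ t ∈ I, ∀ u : H, φ t u = ψ (t, WithLp.toLp 2 fun i => inner ℝ (e i) u)

/-- `(μ_t)` is a measure-valued solution on `I` of the Liouville equation of `v`. -/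
def SolvesLiouville [CompleteSpace H] [MeasurableSpace H] (v : ℝ × H → H) (I : Set ℝ)
    (μ : ℝ → MeasureTheory.ProbabilityMeasure H) : Prop :=
  ∀ φ : ℝ → H → ℝ, IsCylindricalTest I φ →
    ∫ t in I, ∫ u, (deriv (fun s => φ s u) t + inner ℝ (v (t, u)) (gradient (φ t) u))
      ∂(μ t : MeasureTheory.Measure H) = 0

/-- The bound `∫_I ∫_H ‖v (t, u)‖ dμ_t(u) dt < ∞`. -/
def FiniteSpeed [MeasurableSpace H] (v : ℝ × H → H) (I : Set ℝ)
    (μ : ℝ → MeasureTheory.ProbabilityMeasure H) : Prop :=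
  ∫⁻ t in I, ∫⁻ u, ‖v (t, u)‖ₑ ∂(μ t : MeasureTheory.Measure H) < ⊤

/-- The set of initial data of global strong solutions. -/
def globalData (v : ℝ × H → H) : Set H :=
  {u₀ | ∃ u : ℝ → H, IsStrongSolution v Set.univ u₀ u}

/-- The flow map `Φ_t` on the set of global data: the value at time `t` of a global strong solution
starting from the given datum. -/
noncomputable def flowMap (v : ℝ × H → H) (t : ℝ) (u₀ : globalData v) : H :=
  Classical.choose u₀.2 t

end

end GenFlow

/-! The core is a superposition principle, `exists_superposition`: on a compact interval `[a, b]`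
the measures `μ t` are the time marginals of one probability measure `η` on `C([a, b], H)` carried
by paths that solve the integrated equation.

Given this, uniqueness turns a statement about random paths into one about initial data. The
solution paths form a closed subset of a Polish space, and evaluation at time `0` is injective on it
(`injOn_evalAt_zero`). By the Lusin-Souslin theorem the data whose solution lives on `[a, b]` form a
Borel set (`measurableSet_dataReaching`). This set has full `μ 0` measure because `μ 0` is the
marginal of `η` at time `0`. Intersecting over the intervals `[-(n+1), n+1]` and gluing yields the
global data (`globalData_eq_iInter`). Restricting beforehand to paths that lie in a Borel set at
time `t` yields measurability of the flow map.

Superposition is proved by a stochastic Euler scheme. The projected velocity is not a function of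
the projected state, so `v` is first replaced, up to a small error in `L¹(dt ⊗ μ_t)`, by a smooth
field `W` that acts on finitely many coordinates (`exists_cylindrical_approx`). Testing the
Liouville equation on `h (y + (t - r) • w y)`, an observable composed with an Euler step, shows that
the coordinate law at time `t` differs from the Euler image of the law at time `s` by a small amount
against Lipschitz functions (`liouville_step`). Kantorovich-Rubinstein duality, proved by
Hahn-Banach and Riesz (`exists_coupling_of_lipschitz_dual`), converts this into a coupling of the
two laws. Consecutive couplings are glued into a chain with the prescribed marginals
(`exists_chain`, `exists_euler_chain`). Its piecewise linear interpolation is a random path with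
small expected defect in the integrated equation (`exists_path_measure`).

To pass to the limit, fix one approximating field. A path with small defect for it is, up to that
defect, an initial point plus a Lipschitz path in a ball of a finite-dimensional space. With tight
initial laws this gives tightness in path space (`isTightMeasureSet_paths`). A weak limit has
marginals `μ t` (`map_evalAt_eq_of_tendsto`). The expected defects for the approximating fields pass
to the limit by lower semicontinuity, and their `L¹` convergence to `v` makes the defect for `v`
vanish almost surely (`ae_residual_eq_zero`). -/

namespace GenFlow

open MeasureTheory Set Filter Topology
open scoped NNReal ENNReal BoundedContinuousFunction CompactlySupported

/-! ### Kantorovich-Rubinstein duality on proper metric spaces -/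

section Coupling

variable {E : Type*} [MetricSpace E]

/-- A bounded `K`-Lipschitz function `k` with `k (T x) ≤ f x` and `-g ≤ k` exists as soon as the pair
`(f, g)` satisfies the corresponding compatibility condition. -/
lemma exists_lipschitz_between [Nonempty E] {T : E → E} {f g : E → ℝ} {A B : ℝ} {K : ℝ≥0}
    (hA : ∀ x, |f x| ≤ A) (hB : ∀ x, |g x| ≤ B)
    (h : ∀ x y, 0 ≤ f x + g y + K * dist y (T x)) :
    ∃ k : E → ℝ, LipschitzWith K k ∧ (∃ C, ∀ x, |k x| ≤ C) ∧ (∀ x, k (T x) ≤ f x) ∧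
      ∀ y, -g y ≤ k y := by
  have hA0 : 0 ≤ A := (abs_nonneg _).trans (hA (Classical.arbitrary E))
  have hB0 : 0 ≤ B := (abs_nonneg _).trans (hB (Classical.arbitrary E))
  have hbdd : ∀ z, BddBelow (range fun x => f x + K * dist z (T x)) := by
    rintro z
    refine ⟨-A, ?_⟩
    rintro _ ⟨x, rfl⟩
    have := (abs_le.1 (hA x)).1
    have : 0 ≤ (K : ℝ) * dist z (T x) := by positivity
    simp only
    linarith
  -- The largest `K`-Lipschitz function with `k (T x) ≤ f x`; the compatibility condition says
  -- exactly that it dominates `-g`. Truncating it at `A + B` below makes it bounded without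
  -- destroying either inequality.
  set k₀ : E → ℝ := fun z => ⨅ x, (f x + K * dist z (T x)) with hk₀
  have hlip : LipschitzWith K k₀ := by
    refine LipschitzWith.of_le_add_mul K fun z z' => ?_
    rw [← sub_le_iff_le_add]
    refine le_ciInf fun x => ?_
    rw [sub_le_iff_le_add]
    refine (ciInf_le (hbdd z) x).trans ?_
    have : (K : ℝ) * dist z (T x) ≤ K * (dist z z' + dist z' (T x)) := by
      gcongr
      exact dist_triangle _ _ _
    linarith
  have hlow : ∀ z, -A ≤ k₀ z := fun z => le_ciInf fun x => by
    have := (abs_le.1 (hA x)).1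
    have : 0 ≤ (K : ℝ) * dist z (T x) := by positivity
    linarith
  refine ⟨fun z => min (k₀ z) (A + B), hlip.min_const _, ⟨A + B, fun z => ?_⟩, fun x => ?_,
    fun y => ?_⟩
  · refine abs_le.2 ⟨le_min (by linarith [hlow z]) (by linarith), min_le_right _ _⟩
  · refine (min_le_left _ _).trans ((ciInf_le (hbdd _) x).trans ?_)
    simp
  · refine le_min (le_ciInf fun x => by linarith [h x y]) ?_
    have := (abs_le.1 (hB y)).1
    linarith

/-- The Hahn-Banach step of the duality theorem: a linear functional on bounded continuous
functions that behaves like a coupling of `α` and `β` with transport cost at most `δ`. -/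
lemma exists_functional_le [MeasurableSpace E] [BorelSpace E] (α β : Measure E) [IsProbabilityMeasure α] [IsProbabilityMeasure β]
    {T : E → E} {δ : ℝ} (hT : Continuous T)
    (h : ∀ (K : ℝ≥0) (k : E → ℝ), LipschitzWith K k → (∃ C, ∀ x, |k x| ≤ C) →
      ∫ x, k x ∂β - ∫ x, k (T x) ∂α ≤ K * δ) :
    ∃ Λ : (E × E →ᵇ ℝ) →ₗ[ℝ] ℝ, ∀ (u : E × E →ᵇ ℝ) (f g : E →ᵇ ℝ) (K : ℝ≥0),
      (∀ x y, u (x, y) ≤ f x + g y + K * dist y (T x)) →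
        Λ u ≤ ∫ x, f x ∂α + ∫ x, g x ∂β + K * δ := by
  have : Nonempty E := nonempty_of_isProbabilityMeasure α
  -- With `k` between the two functions, `∫ f dα + ∫ g dβ ≥ ∫ k ∘ T dα - ∫ k dβ ≥ -K δ`.
  have key : ∀ (f g : E →ᵇ ℝ) (K : ℝ≥0), (∀ x y, 0 ≤ f x + g y + K * dist y (T x)) →
      0 ≤ ∫ x, f x ∂α + ∫ x, g x ∂β + K * δ := by
    intro f g K hfg
    obtain ⟨k, hk, ⟨C, hC⟩, hkf, hkg⟩ := exists_lipschitz_between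
      (fun x => f.norm_coe_le_norm x) (fun x => g.norm_coe_le_norm x) hfg
    have h1 := h K k hk ⟨C, hC⟩
    have i1 : Integrable (fun x => k (T x)) α := Integrable.of_bound
      (hk.continuous.comp hT).aestronglyMeasurable C (ae_of_all _ fun x => hC _)
    have i2 : Integrable k β := Integrable.of_bound hk.continuous.aestronglyMeasurable C
      (ae_of_all _ fun x => hC _)
    have h2 := integral_mono i1 (f.integrable α) hkf
    have h3 := integral_mono (g.integrable β).neg i2 hkg
    simp only [Pi.neg_apply, integral_neg] at h3
    linarith
  -- The values of all dual majorants of `u`. Their infimum is sublinear in `u` and vanishes at `0`,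
  -- so Hahn-Banach applies to the zero functional on the zero subspace.
  set A : (E × E →ᵇ ℝ) → Set ℝ := fun u => {r | ∃ (f g : E →ᵇ ℝ) (K : ℝ≥0),
    (∀ x y, u (x, y) ≤ f x + g y + K * dist y (T x)) ∧
      r = ∫ x, f x ∂α + ∫ x, g x ∂β + K * δ} with hA
  have hne : ∀ u, (A u).Nonempty := fun u =>
    ⟨_, BoundedContinuousFunction.const E ‖u‖, 0, 0, fun x y => by
      simpa using (le_abs_self _).trans (u.norm_coe_le_norm (x, y)), rfl⟩
  have hbd : ∀ u, BddBelow (A u) := by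
    refine fun u => ⟨-‖u‖, ?_⟩
    rintro r ⟨f, g, K, hu, rfl⟩
    have := key (f + BoundedContinuousFunction.const E ‖u‖) g K fun x y => by
      have h1 := hu x y
      have h2 := (abs_le.1 (u.norm_coe_le_norm (x, y))).1
      simp only [BoundedContinuousFunction.coe_add, Pi.add_apply,
        BoundedContinuousFunction.const_apply]
      linarith
    simp only [BoundedContinuousFunction.coe_add, Pi.add_apply,
      BoundedContinuousFunction.const_apply] at this
    rw [integral_add (f.integrable α) (integrable_const _)] at this
    simp at this
    linarith
  have hsmul : ∀ (c : ℝ), 0 < c → ∀ u, ∀ r ∈ A u, c * r ∈ A (c • u) := by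
    rintro c hc u r ⟨f, g, K, hu, rfl⟩
    refine ⟨c • f, c • g, c.toNNReal * K, fun x y => ?_, ?_⟩
    · have := mul_le_mul_of_nonneg_left (hu x y) hc.le
      simp only [BoundedContinuousFunction.coe_smul, smul_eq_mul, NNReal.coe_mul,
        Real.coe_toNNReal c hc.le]
      linarith
    · simp only [BoundedContinuousFunction.coe_smul, smul_eq_mul, NNReal.coe_mul,
        Real.coe_toNNReal c hc.le, integral_const_mul]
      ring
  have hle : ∀ (c : ℝ), 0 < c → ∀ u, sInf (A (c • u)) ≤ c * sInf (A u) := by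
    intro c hc u
    rw [← div_le_iff₀' hc]
    refine le_csInf (hne u) fun r hr => ?_
    rw [div_le_iff₀' hc]
    exact csInf_le (hbd _) (hsmul c hc u r hr)
  have hN0 : sInf (A 0) = 0 := by
    refine le_antisymm (csInf_le (hbd _) ⟨0, 0, 0, by simp, by simp⟩) (le_csInf (hne _) ?_)
    rintro r ⟨f, g, K, hu, rfl⟩
    exact key f g K hu
  obtain ⟨Λ, -, hΛ⟩ := exists_extension_of_le_sublinear
    (⟨⊥, 0⟩ : (E × E →ᵇ ℝ) →ₗ.[ℝ] ℝ) (fun u => sInf (A u)) (fun c hc u => by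
      refine le_antisymm (hle c hc u) ?_
      have := hle c⁻¹ (inv_pos.2 hc) (c • u)
      rw [smul_smul, inv_mul_cancel₀ hc.ne', one_smul] at this
      rwa [le_inv_mul_iff₀ hc] at this) (fun u w => by
      rw [← sub_le_iff_le_add]
      refine le_csInf (hne u) ?_
      rintro r ⟨f, g, K, hu, rfl⟩
      rw [sub_le_comm]
      refine le_csInf (hne w) ?_
      rintro r' ⟨f', g', K', hu', rfl⟩
      rw [sub_le_iff_le_add]
      refine csInf_le (hbd _) ⟨f + f', g + g', K + K', fun x y => ?_, ?_⟩
      · have h1 := hu x y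
        have h2 := hu' x y
        simp only [BoundedContinuousFunction.coe_add, Pi.add_apply, NNReal.coe_add]
        linarith
      · simp only [BoundedContinuousFunction.coe_add, Pi.add_apply, NNReal.coe_add]
        rw [integral_add (f.integrable α) (f'.integrable α),
          integral_add (g.integrable β) (g'.integrable β)]
        ring) (by
      rintro ⟨x, hx⟩
      obtain rfl := (Submodule.mem_bot ℝ).1 hx
      exact hN0.ge)
  exact ⟨Λ, fun u f g K hu => (hΛ u).trans (csInf_le (hbd u) ⟨f, g, K, hu, rfl⟩)⟩

variable [ProperSpace E]

/-- The compactly supported Lipschitz cutoff functions `max 0 (min 1 (n + 1 - dist x x₀))`. -/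
def ballCutoff (x₀ : E) (n : ℕ) : C_c(E, ℝ) where
  toFun x := max 0 (min 1 (n + 1 - dist x x₀))
  continuous_toFun := by fun_prop
  hasCompactSupport' := by
    refine HasCompactSupport.of_support_subset_isCompact (isCompact_closedBall x₀ (n + 1)) ?_
    intro x hx
    by_contra hx'
    apply hx
    simp only [Metric.mem_closedBall, not_le] at hx'
    refine max_eq_left ((min_le_right _ _).trans ?_)
    linarith

lemma ballCutoff_nonneg (x₀ : E) (n : ℕ) (x : E) : 0 ≤ ballCutoff x₀ n x := le_max_left _ _

lemma ballCutoff_le_one (x₀ : E) (n : ℕ) (x : E) : ballCutoff x₀ n x ≤ 1 :=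
  max_le zero_le_one (min_le_left _ _)

lemma ballCutoff_eventually_eq_one (x₀ x : E) : ∀ᶠ n : ℕ in atTop, ballCutoff x₀ n x = 1 := by
  filter_upwards [eventually_ge_atTop ⌈dist x x₀⌉₊] with n hn
  have : dist x x₀ ≤ n := (Nat.le_ceil _).trans (by exact_mod_cast hn)
  change max 0 (min 1 ((n : ℝ) + 1 - dist x x₀)) = 1
  rw [min_eq_left (by linarith), max_eq_right zero_le_one]

variable [MeasurableSpace E] [BorelSpace E]

lemma tendsto_integral_ballCutoff (α : Measure E) [IsProbabilityMeasure α] (x₀ : E) :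
    Tendsto (fun n : ℕ => ∫ x, ballCutoff x₀ n x ∂α) atTop (𝓝 1) := by
  have : (1 : ℝ) = ∫ _, (1 : ℝ) ∂α := by simp
  rw [this]
  refine tendsto_integral_of_dominated_convergence (fun _ => 1)
    (fun n => (ballCutoff x₀ n).continuous.aestronglyMeasurable) (integrable_const _)
    (fun n => ae_of_all _ fun x => ?_) (ae_of_all _ fun x => ?_)
  · rw [Real.norm_of_nonneg (ballCutoff_nonneg _ _ _)]
    exact ballCutoff_le_one _ _ _
  · exact tendsto_const_nhds.congr' ((ballCutoff_eventually_eq_one x₀ x).mono fun n hn => hn.symm)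

/-- Kantorovich-Rubinstein duality: if `∫ k dβ - ∫ k ∘ T dα ≤ K * δ` for all bounded `K`-Lipschitz
functions `k`, then `α` and `β` have a coupling with `∫ dist y (T x) ≤ δ`. -/
theorem exists_coupling_of_lipschitz_dual (α β : Measure E) [IsProbabilityMeasure α]
    [IsProbabilityMeasure β] {T : E → E} {δ : ℝ} (hT : Continuous T)
    (h : ∀ (K : ℝ≥0) (k : E → ℝ), LipschitzWith K k → (∃ C, ∀ x, |k x| ≤ C) →
      ∫ x, k x ∂β - ∫ x, k (T x) ∂α ≤ K * δ) :
    ∃ π : Measure (E × E), π.map Prod.fst = α ∧ π.map Prod.snd = β ∧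
      ∫⁻ p, edist p.2 (T p.1) ∂π ≤ ENNReal.ofReal δ := by
  obtain ⟨x₀⟩ : Nonempty E := nonempty_of_isProbabilityMeasure α
  obtain ⟨Λ, hΛ⟩ := exists_functional_le α β hT h
  have hpos : ∀ u : E × E →ᵇ ℝ, (∀ p, 0 ≤ u p) → 0 ≤ Λ u := fun u hu => by
    have := hΛ (-u) 0 0 0 fun x y => by simpa using hu (x, y)
    simpa using this
  let Λ₁ : C_c(E × E, ℝ) →ₗ[ℝ] ℝ :=
    { toFun := fun u => Λ u.toBoundedContinuousFunction
      map_add' := fun u w => by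
        rw [← map_add]; congr 1
      map_smul' := fun c u => by
        rw [← map_smul]; congr 1 }
  -- Riesz represents only the restriction of `Λ` to compactly supported functions. Mass could
  -- escape to infinity; the tightness of `α` and `β`, seen through the cutoffs, excludes this
  -- below.
  let Λ₂ : C_c(E × E, ℝ) →ₚ[ℝ] ℝ := PositiveLinearMap.mk₀ Λ₁ fun u hu => hpos _ fun p => hu p
  set π := RealRMK.rieszMeasure Λ₂ with hπ
  have hint : ∀ u : C_c(E × E, ℝ), ∫ p, u p ∂π = Λ u.toBoundedContinuousFunction :=
    fun u => RealRMK.integral_rieszMeasure Λ₂ u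
  let χ : ℕ → E × E → ℝ := fun n p => ballCutoff x₀ n p.1 * ballCutoff x₀ n p.2
  have hχc : ∀ n, Continuous (χ n) := fun n =>
    ((ballCutoff x₀ n).continuous.comp continuous_fst).mul
      ((ballCutoff x₀ n).continuous.comp continuous_snd)
  have hχ0 : ∀ n p, 0 ≤ χ n p := fun n p =>
    mul_nonneg (ballCutoff_nonneg _ _ _) (ballCutoff_nonneg _ _ _)
  have hχ1 : ∀ n p, χ n p ≤ 1 := fun n p =>
    mul_le_one₀ (ballCutoff_le_one _ _ _) (ballCutoff_nonneg _ _ _) (ballCutoff_le_one _ _ _)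
  have hχev : ∀ p, ∀ᶠ n in atTop, χ n p = 1 := fun p => by
    filter_upwards [ballCutoff_eventually_eq_one x₀ p.1, ballCutoff_eventually_eq_one x₀ p.2]
      with n h1 h2
    simp [χ, h1, h2]
  have hχs : ∀ n, HasCompactSupport (χ n) := fun n => by
    refine HasCompactSupport.of_support_subset_isCompact
      ((ballCutoff x₀ n).hasCompactSupport.isCompact.prod
        (ballCutoff x₀ n).hasCompactSupport.isCompact) ?_
    intro p hp
    exact ⟨subset_tsupport _ (left_ne_zero_of_mul hp), subset_tsupport _ (right_ne_zero_of_mul hp)⟩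
  let cut : ℕ → (E × E →ᵇ ℝ) → C_c(E × E, ℝ) := fun n u =>
    { toFun := fun p => χ n p * u p
      continuous_toFun := (hχc n).mul u.continuous
      hasCompactSupport' := (hχs n).mul_right }
  -- lower semicontinuous bound: `∫ u dπ` is controlled by the dual bound
  have hfatou : ∀ (F : E × E → ℝ≥0∞) (u : ℕ → E × E →ᵇ ℝ) (c : ℝ), (∀ n p, 0 ≤ u n p) →
      (∀ p, Tendsto (fun n => ENNReal.ofReal (χ n p * u n p)) atTop (𝓝 (F p))) →
      (∀ n, Λ (cut n (u n)).toBoundedContinuousFunction ≤ c) → ∫⁻ p, F p ∂π ≤ ENNReal.ofReal c := by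
    intro F u c hu hF hc
    have h1 : ∀ n, ∫⁻ p, ENNReal.ofReal (χ n p * u n p) ∂π ≤ ENNReal.ofReal c := fun n => by
      rw [← ofReal_integral_eq_lintegral_ofReal]
      · refine ENNReal.ofReal_le_ofReal ((hint (cut n (u n))).trans_le (hc n))
      · exact (cut n (u n)).continuous.integrable_of_hasCompactSupport
          (cut n (u n)).hasCompactSupport
      · exact ae_of_all _ fun p => mul_nonneg (hχ0 n p) (hu n p)
    calc ∫⁻ p, F p ∂π = ∫⁻ p, liminf (fun n => ENNReal.ofReal (χ n p * u n p)) atTop ∂π :=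
          lintegral_congr fun p => (hF p).liminf_eq.symm
      _ ≤ liminf (fun n => ∫⁻ p, ENNReal.ofReal (χ n p * u n p) ∂π) atTop :=
          lintegral_liminf_le fun n =>
            (((hχc n).mul (u n).continuous).measurable).ennreal_ofReal
      _ ≤ ENNReal.ofReal c := by
          refine liminf_le_of_frequently_le' (Eventually.of_forall h1).frequently
  have hmul : ∀ (u : E × E →ᵇ ℝ) n p, 0 ≤ u p → χ n p * u p ≤ u p := fun u n p hu =>
    mul_le_of_le_one_left hu (hχ1 n p)
  have hcst : ∀ (u : E × E →ᵇ ℝ) p,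
      Tendsto (fun n => ENNReal.ofReal (χ n p * u p)) atTop (𝓝 (ENNReal.ofReal (u p))) :=
    fun u p => tendsto_const_nhds.congr' ((hχev p).mono fun n hn => by simp [hn])
  have hmass : π univ ≤ 1 := by
    have := hfatou (fun _ => 1) (fun _ => 1) 1 (fun n p => by simp) (fun p => by
      simpa using hcst 1 p) (fun n => by
        have := hΛ (cut n 1).toBoundedContinuousFunction 1 0 0 fun x y => by
          simpa [cut] using hχ1 n (x, y)
        simpa using this)
    simpa using this
  have hfin : IsFiniteMeasure π := ⟨hmass.trans_lt ENNReal.one_lt_top⟩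
  have hmass' : π univ = 1 := by
    refine le_antisymm hmass ?_
    have h1 : ∀ n, ∫ x, ballCutoff x₀ n x ∂α + ∫ x, ballCutoff x₀ n x ∂β - 1 ≤ π.real univ := by
      intro n
      -- The majorant comes from `0 ≤ (1 - p) * (1 - q)` for cutoff values `p, q ≤ 1`, that is `-(p
      -- * q) ≤ (1 - p) - q`.
      have h2 := hΛ (-(cut n 1).toBoundedContinuousFunction)
        (1 - (ballCutoff x₀ n).toBoundedContinuousFunction)
        (-(ballCutoff x₀ n).toBoundedContinuousFunction) 0 fun x y => by
          have a1 := ballCutoff_le_one x₀ n x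
          have a2 := ballCutoff_le_one x₀ n y
          simp [cut, χ]
          nlinarith
      have h3 : ∫ p, χ n p * 1 ∂π ≤ ∫ p, 1 ∂π :=
        integral_mono ((cut n 1).continuous.integrable_of_hasCompactSupport
          (cut n 1).hasCompactSupport) (integrable_const _) fun p => by simpa using hχ1 n p
      have h4 := hint (cut n 1)
      have h5 : ∫ x, (1 - (ballCutoff x₀ n).toBoundedContinuousFunction) x ∂α
          = 1 - ∫ x, ballCutoff x₀ n x ∂α := by
        have := integral_sub (integrable_const (1 : ℝ))
          ((ballCutoff x₀ n).toBoundedContinuousFunction.integrable α)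
        simpa using this
      have h6 : ∫ x, (-(ballCutoff x₀ n).toBoundedContinuousFunction) x ∂β
          = - ∫ x, ballCutoff x₀ n x ∂β := by
        simp [integral_neg]
      rw [h5, h6, map_neg, ← h4] at h2
      have h7 : ∫ p, (cut n 1) p ∂π = ∫ p, χ n p * 1 ∂π := rfl
      simp only [integral_const, smul_eq_mul, mul_one] at h3 h7
      rw [h7] at h2
      simp at h2
      linarith
    have h2 := ((tendsto_integral_ballCutoff α x₀).add
      (tendsto_integral_ballCutoff β x₀)).sub_const 1
    have h3 := le_of_tendsto h2 (Eventually.of_forall h1)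
    norm_num at h3
    rw [Measure.real, ← ENNReal.ofReal_le_iff_le_toReal (measure_ne_top _ _)] at h3
    simpa using h3
  have hprob : IsProbabilityMeasure π := ⟨hmass'⟩
  have hmarg : ∀ (γ : Measure E) [IsProbabilityMeasure γ] (q : E × E → E) (hq : Continuous q),
      (∀ (f : E →ᵇ ℝ) (u : E × E →ᵇ ℝ), (∀ p, u p ≤ f (q p)) → Λ u ≤ ∫ x, f x ∂γ) →
      π.map q = γ := by
    intro γ _ q hq hγ
    have : IsProbabilityMeasure (π.map q) := Measure.isProbabilityMeasure_map hq.aemeasurable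
    have hle : ∀ f : E →ᵇ ℝ, (∀ x, 0 ≤ f x) → ∫ p, f (q p) ∂π ≤ ∫ x, f x ∂γ := by
      intro f hf
      have h1 := hfatou (fun p => ENNReal.ofReal (f (q p)))
        (fun _ => f.compContinuous ⟨q, hq⟩) (∫ x, f x ∂γ) (fun n p => hf _)
        (fun p => hcst (f.compContinuous ⟨q, hq⟩) p)
        (fun n => hγ f _ fun p => hmul (f.compContinuous ⟨q, hq⟩) n p (hf _))
      have i1 : Integrable (fun p => f (q p)) π := (f.compContinuous ⟨q, hq⟩).integrable π
      rw [← ofReal_integral_eq_lintegral_ofReal i1 (ae_of_all _ fun p => hf _)] at h1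
      exact (ENNReal.ofReal_le_ofReal_iff (integral_nonneg hf)).1 h1
    refine ext_of_forall_integral_eq_of_IsFiniteMeasure fun f => ?_
    rw [integral_map hq.aemeasurable f.continuous.aestronglyMeasurable]
    have hb := fun x => abs_le.1 (f.norm_coe_le_norm x)
    have i1 : Integrable (fun p => f (q p)) π := (f.compContinuous ⟨q, hq⟩).integrable π
    -- The one-sided bound for the nonnegative functions `‖f‖ ± f` becomes an equality because both
    -- measures have mass one.
    have e1 := hle (BoundedContinuousFunction.const E ‖f‖ + f) fun x => by
      simpa using by linarith [(hb x).1]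
    have e2 := hle (BoundedContinuousFunction.const E ‖f‖ - f) fun x => by
      simpa using (hb x).2
    simp only [BoundedContinuousFunction.coe_add, BoundedContinuousFunction.coe_sub, Pi.add_apply,
      Pi.sub_apply, BoundedContinuousFunction.const_apply] at e1 e2
    rw [integral_add (integrable_const _) i1, integral_add (integrable_const _) (f.integrable γ)]
      at e1
    rw [integral_sub (integrable_const _) i1, integral_sub (integrable_const _) (f.integrable γ)]
      at e2
    simp at e1 e2
    linarith
  refine ⟨π, hmarg α _ continuous_fst fun f u hu => ?_, hmarg β _ continuous_snd fun f u hu => ?_,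
    ?_⟩
  · simpa using hΛ u f 0 0 fun x y => by simpa using hu (x, y)
  · simpa using hΛ u 0 f 0 fun x y => by simpa using hu (x, y)
  · have hcont : Continuous fun p : E × E => dist p.2 (T p.1) := by fun_prop
    -- The cost is unbounded, so it is truncated at `n`. Each truncation has the majorant `f = g =
    -- 0`, `K = 1`, of value `δ`.
    refine hfatou _ (fun n => BoundedContinuousFunction.ofNormedAddCommGroup
      (fun p => min (n : ℝ) (dist p.2 (T p.1))) (by fun_prop) n fun p => ?_) δ (fun n p => ?_)
      (fun p => ?_) fun n => ?_
    · rw [Real.norm_of_nonneg (by positivity)]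
      exact min_le_left _ _
    · change 0 ≤ min (n : ℝ) (dist p.2 (T p.1))
      positivity
    · rw [edist_dist]
      refine tendsto_const_nhds.congr' ?_
      filter_upwards [hχev p, eventually_ge_atTop ⌈dist p.2 (T p.1)⌉₊] with n hn hn'
      have : dist p.2 (T p.1) ≤ n := (Nat.le_ceil _).trans (by exact_mod_cast hn')
      simp [hn, this]
    · have := hΛ (cut n (BoundedContinuousFunction.ofNormedAddCommGroup
        (fun p => min (n : ℝ) (dist p.2 (T p.1))) (by fun_prop) n fun p => by
          rw [Real.norm_of_nonneg (by positivity)]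
          exact min_le_left _ _)).toBoundedContinuousFunction 0 0 1 fun x y => by
          refine (hmul _ n (x, y) ?_).trans ?_
          · change 0 ≤ min (n : ℝ) (dist y (T x))
            positivity
          · simp
      simpa using this

end Coupling

end GenFlow

namespace GenFlow

open MeasureTheory Set Filter Topology ProbabilityTheory
open scoped NNReal ENNReal

/-! ### Gluing couplings into a process -/

section Chain

variable {E : Type*} [MeasurableSpace E] [StandardBorelSpace E]

/-- Couplings with matching consecutive marginals are the two-step laws of a process. -/
theorem exists_chain (π : ℕ → Measure (E × E)) [∀ k, IsProbabilityMeasure (π k)] (N : ℕ)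
    (h : ∀ k, k + 1 < N → (π k).map Prod.snd = (π (k + 1)).map Prod.fst) :
    ∃ P : Measure (ℕ → E), IsProbabilityMeasure P ∧
      ∀ k < N, P.map (fun y => (y k, y (k + 1))) = π k := by
  have : Nonempty E := (nonempty_of_isProbabilityMeasure (π 0)).map Prod.fst
  induction N with
  | zero =>
    exact ⟨Measure.dirac fun _ => Classical.arbitrary E, inferInstance, fun k hk => by simp at hk⟩
  | succ N ih =>
    obtain ⟨P, hP, hPk⟩ := ih fun k hk => h k (by omega)
    obtain ⟨P, hP, hPk, hPN⟩ : ∃ P : Measure (ℕ → E), IsProbabilityMeasure P ∧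
        (∀ k < N, P.map (fun y => (y k, y (k + 1))) = π k) ∧
        P.map (fun y => y N) = (π N).map Prod.fst := by
      -- For `N = 0` the inductive hypothesis says nothing about the law of `y 0`, so a fresh law on
      -- constant sequences is used instead.
      rcases N with _ | N
      · refine ⟨((π 0).map Prod.fst).map fun x _ => x, ?_, fun k hk => by simp at hk, ?_⟩
        · have : IsProbabilityMeasure ((π 0).map Prod.fst) :=
            Measure.isProbabilityMeasure_map measurable_fst.aemeasurable
          exact Measure.isProbabilityMeasure_map
            (measurable_pi_lambda _ fun _ => measurable_id).aemeasurable
        · have hc : Measurable fun (x : E) (_ : ℕ) => x :=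
            measurable_pi_lambda _ fun _ => measurable_id
          rw [Measure.map_map (measurable_pi_apply 0) hc]
          exact Measure.map_id
      · refine ⟨P, hP, hPk, ?_⟩
        rw [← h N (by omega), ← hPk N (by omega), Measure.map_map measurable_snd (by fun_prop)]
        rfl
    -- Given the past, the next point is drawn from the disintegration of `π N` over its first
    -- coordinate, evaluated at `y N`. Then `u` overwrites coordinate `N + 1` alone, so the earlier
    -- two-step laws survive.
    let κ : Kernel (ℕ → E) E := (π N).condKernel.comap (fun y => y N) (measurable_pi_apply N)
    let u : (ℕ → E) × E → ℕ → E := fun p k => if k = N + 1 then p.2 else p.1 k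
    have hu : Measurable u := measurable_pi_lambda _ fun k => by
      by_cases hk : k = N + 1
      · simpa [u, hk] using measurable_snd
      · simp only [u, hk, if_false]
        fun_prop
    refine ⟨(P ⊗ₘ κ).map u, Measure.isProbabilityMeasure_map hu.aemeasurable, fun k hk => ?_⟩
    rw [Measure.map_map (by fun_prop) hu]
    rcases Nat.lt_succ_iff_lt_or_eq.1 hk with hk | rfl
    · have e1 : (fun y : ℕ → E => (y k, y (k + 1))) ∘ u
          = (fun y : ℕ → E => (y k, y (k + 1))) ∘ Prod.fst := by
        ext p <;> simp [u, show k ≠ N + 1 by omega, show k ≠ N by omega]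
      rw [e1, ← Measure.map_map (by fun_prop) measurable_fst]
      have : (P ⊗ₘ κ).map Prod.fst = P := Measure.fst_compProd P κ
      rw [this, hPk k hk]
    · have e1 : (fun y : ℕ → E => (y k, y (k + 1))) ∘ u
          = Prod.map (fun y : ℕ → E => y k) id := by
        ext p <;> simp [u]
      rw [e1]
      have e2 : (π k).fst ⊗ₘ (π k).condKernel = π k := (π k).disintegrate _
      conv_rhs => rw [← e2]
      have e3 : (π k).fst = P.map fun y => y k := hPN.symm
      refine Measure.ext_of_lintegral _ fun f hf => ?_
      rw [lintegral_map hf (by fun_prop), Measure.lintegral_compProd (by fun_prop),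
        Measure.lintegral_compProd hf, e3, lintegral_map (by fun_prop) (by fun_prop)]
      rfl

end Chain

end GenFlow

namespace GenFlow

open MeasureTheory Set Filter Topology
open scoped NNReal ENNReal Convolution

/-! ### Smooth approximation that preserves bounds and Lipschitz constants -/

section Mollification

variable {G : Type*} [NormedAddCommGroup G]

lemma exists_bump_sequence : ∃ φ : ℕ → ContDiffBump (0 : G),
    Tendsto (fun n => (φ n).rOut) atTop (𝓝 0) := by
  refine ⟨fun n => ⟨1 / (n + 1) / 2, 1 / (n + 1), by positivity, half_lt_self (by positivity)⟩, ?_⟩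
  exact tendsto_one_div_add_atTop_nhds_zero_nat

variable [NormedSpace ℝ G] [FiniteDimensional ℝ G] [MeasurableSpace G] [BorelSpace G]
  {F : Type*} [NormedAddCommGroup F] [NormedSpace ℝ F]

/-- Convolution with a normalised bump function. -/
noncomputable def mollify (φ : ContDiffBump (0 : G)) (g : G → F) : G → F :=
  φ.normed Measure.addHaar ⋆[ContinuousLinearMap.lsmul ℝ ℝ, Measure.addHaar] g

lemma mollify_apply (φ : ContDiffBump (0 : G)) (g : G → F) (x : G) :
    mollify φ g x = ∫ y, φ.normed Measure.addHaar y • g (x - y) ∂Measure.addHaar := rfl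

lemma contDiff_mollify (φ : ContDiffBump (0 : G)) {g : G → F} (hg : Continuous g) :
    ContDiff ℝ ∞ (mollify φ g) :=
  φ.hasCompactSupport_normed.contDiff_convolution_left _ φ.contDiff_normed
    hg.locallyIntegrable

lemma hasCompactSupport_mollify (φ : ContDiffBump (0 : G)) {g : G → F} (hg : HasCompactSupport g) :
    HasCompactSupport (mollify φ g) :=
  φ.hasCompactSupport_normed.convolution _ hg

lemma integrable_mollify (φ : ContDiffBump (0 : G)) {g : G → F} (hg : Continuous g) (x : G) :
    Integrable (fun y => φ.normed Measure.addHaar y • g (x - y)) Measure.addHaar :=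
  (φ.continuous_normed.smul (hg.comp (continuous_const.sub continuous_id))
    ).integrable_of_hasCompactSupport φ.hasCompactSupport_normed.smul_right

lemma norm_integral_mollify_le (φ : ContDiffBump (0 : G)) {g : G → F} {C : ℝ}
    (hC : ∀ x, ‖g x‖ ≤ C) :
    ‖∫ y, φ.normed Measure.addHaar y • g y ∂Measure.addHaar‖ ≤ C := by
  calc _ ≤ ∫ y, φ.normed Measure.addHaar y * C ∂(Measure.addHaar : Measure G) := by
        refine norm_integral_le_of_norm_le (φ.integrable_normed.mul_const C)
          (ae_of_all _ fun y => ?_)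
        rw [norm_smul, Real.norm_of_nonneg (φ.nonneg_normed y)]
        exact mul_le_mul_of_nonneg_left (hC y) (φ.nonneg_normed y)
    _ = C := by rw [integral_mul_const, φ.integral_normed, one_mul]

lemma norm_mollify_le (φ : ContDiffBump (0 : G)) {g : G → F} {C : ℝ} (hC : ∀ x, ‖g x‖ ≤ C) (x : G) :
    ‖mollify φ g x‖ ≤ C :=
  norm_integral_mollify_le φ (g := fun y => g (x - y)) fun _ => hC _

lemma lipschitzWith_mollify (φ : ContDiffBump (0 : G)) {g : G → F} {K : ℝ≥0}
    (hg : LipschitzWith K g) : LipschitzWith K (mollify φ g) := by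
  refine LipschitzWith.of_dist_le_mul fun x x' => ?_
  rw [dist_eq_norm, mollify_apply, mollify_apply,
    ← integral_sub (integrable_mollify φ hg.continuous x) (integrable_mollify φ hg.continuous x')]
  simp_rw [← smul_sub]
  refine norm_integral_mollify_le φ (g := fun y => g (x - y) - g (x' - y)) fun y => ?_
  rw [← dist_eq_norm]
  simpa using hg.dist_le_mul (x - y) (x' - y)

/-- Bounded Lipschitz functions are pointwise limits of smooth compactly supported functions with
the same bound and the same Lipschitz constant. -/
theorem exists_smooth_lipschitz_approx {h : G → ℝ} {K : ℝ≥0} (hK : 0 < K)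
    (hh : LipschitzWith K h) {C : ℝ} (hC : ∀ x, |h x| ≤ C) :
    ∃ g : ℕ → G → ℝ, (∀ n, ContDiff ℝ ∞ (g n)) ∧ (∀ n, HasCompactSupport (g n)) ∧
      (∀ n, LipschitzWith K (g n)) ∧ (∀ n x, |g n x| ≤ C) ∧
      ∀ x, Tendsto (fun n => g n x) atTop (𝓝 (h x)) := by
  have hC0 : 0 ≤ C := (abs_nonneg _).trans (hC 0)
  -- Multiplying by a cutoff would worsen the Lipschitz constant. Clamping `h` between `-ρ n` and `ρ
  -- n`, with a tent of slope `K`, gives compact support and keeps `K`; once `ρ n x ≥ C` the clamp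
  -- is inactive at `x`.
  let ρ : ℕ → G → ℝ := fun n x => max 0 (K * n - K * ‖x‖)
  have hρ : ∀ n, LipschitzWith K (ρ n) := fun n => by
    refine LipschitzWith.const_max (LipschitzWith.of_dist_le_mul fun x y => ?_) 0
    rw [Real.dist_eq, dist_eq_norm, show (K * n - K * ‖x‖ - (K * n - K * ‖y‖) : ℝ)
      = K * (‖y‖ - ‖x‖) by ring, abs_mul, abs_of_nonneg K.coe_nonneg, norm_sub_rev]
    exact mul_le_mul_of_nonneg_left (abs_norm_sub_norm_le _ _) K.coe_nonneg
  let k : ℕ → G → ℝ := fun n x => max (min (h x) (ρ n x)) (-ρ n x)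
  have hk : ∀ n, LipschitzWith K (k n) := fun n => by
    have := (hh.min (hρ n)).max (hρ n).neg
    simpa using this
  have hkC : ∀ n x, |k n x| ≤ C := fun n x => by
    have h0 : 0 ≤ ρ n x := le_max_left _ _
    have := abs_le.1 (hC x)
    refine abs_le.2 ⟨?_, max_le ((min_le_left _ _).trans this.2) (by linarith)⟩
    rcases le_total (h x) (ρ n x) with h1 | h1
    · exact this.1.trans ((min_eq_left h1).ge.trans (le_max_left _ _))
    · exact (by linarith : -C ≤ 0).trans (h0.trans ((min_eq_right h1).ge.trans (le_max_left _ _)))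
  have hks : ∀ n, HasCompactSupport (k n) := fun n => by
    refine HasCompactSupport.of_support_subset_isCompact (isCompact_closedBall (0 : G) n) ?_
    intro x hx
    by_contra hx'
    apply hx
    simp only [Metric.mem_closedBall, dist_zero_right, not_le] at hx'
    have : ρ n x = 0 := max_eq_left (by
      have := mul_lt_mul_of_pos_left hx' (NNReal.coe_pos.2 hK)
      linarith)
    simp [k, this]
  have hkev : ∀ x, ∀ᶠ n in atTop, k n x = h x := fun x => by
    filter_upwards [eventually_ge_atTop ⌈C / K + ‖x‖⌉₊] with n hn
    have h1 : C / K + ‖x‖ ≤ n := (Nat.le_ceil _).trans (by exact_mod_cast hn)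
    have h2 : C ≤ ρ n x := by
      refine le_trans ?_ (le_max_right _ _)
      have hK' : (0 : ℝ) < K := hK
      have := mul_le_mul_of_nonneg_left h1 hK'.le
      rw [mul_add, mul_div_cancel₀ _ hK'.ne'] at this
      linarith
    have := abs_le.1 (hC x)
    simp only [k]
    rw [min_eq_left (by linarith), max_eq_left (by linarith)]
  obtain ⟨φ, hφ⟩ := exists_bump_sequence (G := G)
  refine ⟨fun n => mollify (φ n) (k n), fun n => contDiff_mollify _ (hk n).continuous,
    fun n => hasCompactSupport_mollify _ (hks n), fun n => lipschitzWith_mollify _ (hk n),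
    fun n x => by
      rw [← Real.norm_eq_abs]
      exact norm_mollify_le (φ n) (hkC n) x, fun x => ?_⟩
  have hd : ∀ n, dist (mollify (φ n) (k n) x) (k n x) ≤ K * (φ n).rOut := fun n => by
    refine (φ n).dist_normed_convolution_le (hk n).continuous.aestronglyMeasurable
      fun y hy => ((hk n).dist_le_mul y x).trans ?_
    exact mul_le_mul_of_nonneg_left hy.le K.coe_nonneg
  have h0 : Tendsto (fun n => dist (mollify (φ n) (k n) x) (k n x)) atTop (𝓝 0) :=
    squeeze_zero (fun _ => dist_nonneg) hd (by simpa using hφ.const_mul (K : ℝ))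
  have h1 : Tendsto (fun n => k n x) atTop (𝓝 (h x)) :=
    tendsto_const_nhds.congr' ((hkev x).mono fun n hn => hn.symm)
  exact (tendsto_iff_of_dist (by simpa [dist_comm] using h0)).1 h1

/-- Continuous compactly supported functions are pointwise limits of smooth compactly supported
functions with the same bound. -/
theorem exists_smooth_approx [CompleteSpace F] {g : G → F} (hg : Continuous g) (hgs : HasCompactSupport g) {C : ℝ}
    (hC : ∀ x, ‖g x‖ ≤ C) :
    ∃ k : ℕ → G → F, (∀ n, ContDiff ℝ ∞ (k n)) ∧ (∀ n, HasCompactSupport (k n)) ∧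
      (∀ n x, ‖k n x‖ ≤ C) ∧ ∀ x, Tendsto (fun n => k n x) atTop (𝓝 (g x)) := by
  obtain ⟨φ, hφ⟩ := exists_bump_sequence (G := G)
  exact ⟨fun n => mollify (φ n) g, fun n => contDiff_mollify _ hg,
    fun n => hasCompactSupport_mollify _ hgs, fun n => norm_mollify_le _ hC, fun x =>
    ContDiffBump.convolution_tendsto_right_of_continuous hφ hg x⟩

end Mollification

/-! ### From a distributional derivative to the fundamental theorem of calculus -/

section WeakDerivative

open Real (smoothTransition)

lemma contDiff_smoothTransition : ContDiff ℝ ∞ smoothTransition :=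
  Real.smoothTransition.contDiff

lemma deriv_smoothTransition_eq_zero {x : ℝ} (hx : x ∉ Icc (0 : ℝ) 1) :
    deriv smoothTransition x = 0 := by
  rcases lt_or_ge x 0 with h | h
  · have : smoothTransition =ᶠ[𝓝 x] fun _ => 0 := by
      filter_upwards [Iio_mem_nhds h] with y hy using Real.smoothTransition.zero_of_nonpos hy.le
    rw [this.deriv_eq, deriv_const]
  · have h1 : 1 < x := by
      by_contra h'
      exact hx ⟨h, not_lt.1 h'⟩
    have : smoothTransition =ᶠ[𝓝 x] fun _ => 1 := by
      filter_upwards [Ioi_mem_nhds h1] with y hy using Real.smoothTransition.one_of_one_le hy.le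
    rw [this.deriv_eq, deriv_const]

lemma continuous_deriv_smoothTransition : Continuous (deriv smoothTransition) :=
  contDiff_smoothTransition.continuous_deriv (by simp)

lemma hasCompactSupport_deriv_smoothTransition : HasCompactSupport (deriv smoothTransition) :=
  HasCompactSupport.intro isCompact_Icc fun _ hx => deriv_smoothTransition_eq_zero hx

lemma integrable_deriv_smoothTransition : Integrable (deriv smoothTransition) :=
  continuous_deriv_smoothTransition.integrable_of_hasCompactSupport
    hasCompactSupport_deriv_smoothTransition

lemma integral_deriv_smoothTransition : ∫ y, deriv smoothTransition y = 1 := by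
  have := integral_of_hasDerivAt_of_tendsto (f := smoothTransition) (m := 0) (n := 1)
    (fun x => (contDiff_smoothTransition.differentiable (by simp) x).hasDerivAt)
    integrable_deriv_smoothTransition
    (tendsto_const_nhds.congr' ((eventually_le_atBot 0).mono fun x hx =>
      (Real.smoothTransition.zero_of_nonpos hx).symm))
    (tendsto_const_nhds.congr' ((eventually_ge_atTop 1).mono fun x hx =>
      (Real.smoothTransition.one_of_one_le hx).symm))
  simpa using this

/-- The rescaled derivative has integral one and is supported in `[s, s + 1 / (n + 1)]`, so it is an
approximate identity at `s`; the substitution `y = (n + 1) * (r - s)` reduces the claim to dominated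
convergence. -/
lemma tendsto_integral_deriv_smoothTransition {m : ℝ → ℝ} (hm : Continuous m) {C : ℝ}
    (hC : ∀ r, |m r| ≤ C) (s : ℝ) :
    Tendsto (fun n : ℕ => ∫ r, ((n + 1) * deriv smoothTransition ((n + 1) * (r - s))) * m r)
      atTop (𝓝 (m s)) := by
  have h1 : ∀ n : ℕ, ∫ r, ((n + 1) * deriv smoothTransition ((n + 1) * (r - s))) * m r
      = ∫ y, deriv smoothTransition y * m (s + y / (n + 1)) := fun n => by
    have hn : (0 : ℝ) < n + 1 := by positivity
    rw [← integral_add_right_eq_self _ s]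
    have := Measure.integral_comp_mul_left
      (fun y => deriv smoothTransition y * m (s + y / (n + 1))) ((n : ℝ) + 1)
    rw [abs_of_pos (inv_pos.2 hn), smul_eq_mul, eq_inv_mul_iff_mul_eq₀ hn.ne'] at this
    rw [← this, ← integral_const_mul]
    refine integral_congr_ae (ae_of_all _ fun r => ?_)
    have : (n + 1 : ℝ) * r / (n + 1) = r := by field_simp
    simp only [add_sub_cancel_right, this, add_comm s r]
    ring
  simp_rw [h1]
  have h2 : m s = ∫ y, deriv smoothTransition y * m s := by
    rw [integral_mul_const, integral_deriv_smoothTransition, one_mul]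
  rw [h2]
  refine tendsto_integral_of_dominated_convergence (fun y => |deriv smoothTransition y| * C)
    (fun n => ?_) (integrable_deriv_smoothTransition.abs.mul_const C)
    (fun n => ae_of_all _ fun y => ?_) (ae_of_all _ fun y => ?_)
  · have := continuous_deriv_smoothTransition
    exact Continuous.aestronglyMeasurable (by fun_prop)
  · rw [Real.norm_eq_abs, abs_mul]
    exact mul_le_mul_of_nonneg_left (hC _) (abs_nonneg _)
  · refine Tendsto.const_mul _ ((hm.tendsto s).comp ?_)
    have h3 : Tendsto (fun n : ℕ => y * (1 / ((n : ℝ) + 1))) atTop (𝓝 (y * 0)) :=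
      tendsto_one_div_add_atTop_nhds_zero_nat.const_mul y
    have h4 := h3.const_add s
    simp only [mul_zero, add_zero, mul_one_div] at h4
    exact h4

/-- A continuous function whose distributional derivative is integrable satisfies the fundamental
theorem of calculus. -/
theorem sub_eq_integral_of_weak_deriv {a b s t : ℝ} {m k : ℝ → ℝ} (hm : Continuous m) {C : ℝ}
    (hC : ∀ r, |m r| ≤ C) (hk : IntegrableOn k (Ioo a b)) (has : a < s) (hst : s ≤ t) (htb : t < b)
    (h : ∀ χ : ℝ → ℝ, ContDiff ℝ ∞ χ → HasCompactSupport χ → tsupport χ ⊆ Ioo a b →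
      ∫ r in Ioo a b, (deriv χ r * m r + χ r * k r) = 0) :
    m t - m s = ∫ r in Ioc s t, k r := by
  -- A smooth step from `0` to `1` just to the right of `s`. The difference `S s n - S t n` is the
  -- test function; it tends to the indicator of `(s, t]`, and its support fits into `(a, b)` once
  -- `t + 1 / (n + 1) < b`.
  let S : ℝ → ℕ → ℝ → ℝ := fun s n r => smoothTransition ((n + 1) * (r - s))
  have hS : ∀ s n, ContDiff ℝ ∞ (S s n) := fun s n =>
    contDiff_smoothTransition.comp (by fun_prop)
  have hS' : ∀ s n r, deriv (S s n) r = (n + 1) * deriv smoothTransition ((n + 1) * (r - s)) := by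
    intro s n r
    have h1 := (contDiff_smoothTransition.differentiable (by simp)
      ((n + 1) * (r - s))).hasDerivAt
    have h2 : HasDerivAt (fun r : ℝ => ((n : ℝ) + 1) * (r - s)) ((n + 1) * 1) r :=
      ((hasDerivAt_id r).sub_const s).const_mul _
    have := (h1.comp r h2).deriv
    simp only [mul_one] at this
    rw [mul_comm]
    exact this
  have hS0 : ∀ s n r, r ≤ s → S s n r = 0 := fun s n r hr =>
    Real.smoothTransition.zero_of_nonpos
      (mul_nonpos_of_nonneg_of_nonpos (by positivity) (by linarith))
  have hS1 : ∀ (s : ℝ) (n : ℕ) (r : ℝ), s + 1 / (n + 1) ≤ r → S s n r = 1 := fun s n r hr => by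
    refine Real.smoothTransition.one_of_one_le ?_
    have hn : (0 : ℝ) < n + 1 := by positivity
    rw [← div_le_iff₀' hn]
    linarith
  have hb : ∀ᶠ n : ℕ in atTop, t + 1 / ((n : ℝ) + 1) < b := by
    have := (tendsto_one_div_add_atTop_nhds_zero_nat (𝕜 := ℝ)).const_add t
    rw [add_zero] at this
    exact this.eventually_lt_const htb
  have hev : ∀ᶠ n in atTop, (∫ r, deriv (S s n) r * m r) - (∫ r, deriv (S t n) r * m r)
      + ∫ r in Ioo a b, (S s n r - S t n r) * k r = 0 := by
    filter_upwards [hb] with n hn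
    have hn1 : (0 : ℝ) < 1 / (n + 1) := by positivity
    have hz : ∀ r, r ∉ Icc s (t + 1 / (n + 1)) → S s n r - S t n r = 0 := by
      intro r hr
      rcases lt_or_ge r s with h1 | h1
      · rw [hS0 s n r h1.le, hS0 t n r (h1.le.trans hst), sub_zero]
      · have h2 : t + 1 / (n + 1) < r := by
          by_contra h'
          exact hr ⟨h1, not_lt.1 h'⟩
        rw [hS1 s n r (by linarith), hS1 t n r h2.le, sub_self]
    have hts : tsupport (fun r => S s n r - S t n r) ⊆ Icc s (t + 1 / (n + 1)) :=
      closure_minimal (fun r hr => by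
        by_contra h'
        exact hr (hz r h')) isClosed_Icc
    have h1 := h (fun r => S s n r - S t n r) ((hS s n).sub (hS t n))
      (HasCompactSupport.intro isCompact_Icc hz)
      (hts.trans fun r hr => ⟨has.trans_le hr.1, hr.2.trans_lt hn⟩)
    have hder : ∀ r, deriv (fun r => S s n r - S t n r) r = deriv (S s n) r - deriv (S t n) r :=
      fun r => deriv_fun_sub ((hS s n).differentiable (by simp) r)
        ((hS t n).differentiable (by simp) r)
    have hint : ∀ s, Integrable fun r => deriv (S s n) r * m r := fun s => by
      refine Continuous.integrable_of_hasCompactSupport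
        (((hS s n).continuous_deriv (by simp)).mul hm) ?_
      refine HasCompactSupport.intro (isCompact_Icc (a := s) (b := s + 1 / (n + 1)))
        fun r hr => ?_
      rw [hS', deriv_smoothTransition_eq_zero, mul_zero, zero_mul]
      rintro ⟨h2, h3⟩
      have hn0 : (0 : ℝ) < n + 1 := by positivity
      refine hr ⟨by linarith [(mul_nonneg_iff_of_pos_left hn0).1 h2], ?_⟩
      rw [← le_div_iff₀' hn0] at h3
      linarith
    have hint2 : IntegrableOn (fun r => (S s n r - S t n r) * k r) (Ioo a b) := by
      refine hk.bdd_mul (c := 1)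
        ((hS s n).continuous.sub (hS t n).continuous).aestronglyMeasurable
        (ae_of_all _ fun r => ?_)
      rw [Real.norm_eq_abs, abs_le]
      constructor <;>
      linarith [Real.smoothTransition.nonneg ((n + 1) * (r - s)),
        Real.smoothTransition.le_one ((n + 1) * (r - s)),
        Real.smoothTransition.nonneg ((n + 1) * (r - t)),
        Real.smoothTransition.le_one ((n + 1) * (r - t))]
    have h0 : ∀ r, r ∉ Ioo a b → deriv (fun r => S s n r - S t n r) r * m r = 0 := fun r hr => by
      have : deriv (fun r => S s n r - S t n r) r = 0 := by
        by_contra h'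
        have := hts (support_deriv_subset h')
        exact hr ⟨has.trans_le this.1, this.2.trans_lt hn⟩
      rw [this, zero_mul]
    have hint1 : Integrable fun r => deriv (fun r => S s n r - S t n r) r * m r := by
      simp_rw [hder, sub_mul]
      exact (hint s).sub (hint t)
    rw [integral_add hint1.integrableOn hint2, setIntegral_eq_integral_of_forall_compl_eq_zero h0]
      at h1
    simp_rw [hder, sub_mul] at h1
    rw [integral_sub (hint s) (hint t)] at h1
    simp_rw [sub_mul]
    exact h1
  have hlim : Tendsto (fun n => ∫ r in Ioo a b, (S s n r - S t n r) * k r) atTop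
      (𝓝 (∫ r in Ioo a b, (Ioc s t).indicator k r)) := by
    refine tendsto_integral_of_dominated_convergence (fun r => |k r|) (fun n => ?_) hk.abs
      (fun n => ae_of_all _ fun r => ?_) (ae_of_all _ fun r => ?_)
    · exact ((hS s n).continuous.sub (hS t n).continuous).aestronglyMeasurable.mul
        hk.aestronglyMeasurable
    · rw [Real.norm_eq_abs, abs_mul]
      refine mul_le_of_le_one_left (abs_nonneg _) (abs_le.2 ?_)
      constructor <;>
      linarith [Real.smoothTransition.nonneg ((n + 1) * (r - s)),
        Real.smoothTransition.le_one ((n + 1) * (r - s)),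
        Real.smoothTransition.nonneg ((n + 1) * (r - t)),
        Real.smoothTransition.le_one ((n + 1) * (r - t))]
    · have hgt : ∀ s, s < r → ∀ᶠ n in atTop, S s n r = 1 := fun s hr => by
        have := (tendsto_one_div_add_atTop_nhds_zero_nat (𝕜 := ℝ)).const_add s
        rw [add_zero] at this
        filter_upwards [this.eventually_le_const hr] with n hn using hS1 s n r hn
      by_cases hr : r ∈ Ioc s t
      · rw [indicator_of_mem hr]
        refine tendsto_const_nhds.congr' ?_
        filter_upwards [hgt s hr.1] with n hn
        simp [hn, hS0 t n r hr.2]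
      · rw [indicator_of_notMem hr]
        refine tendsto_const_nhds.congr' ?_
        rcases le_or_gt r s with h1 | h1
        · refine Eventually.of_forall fun n => ?_
          simp [hS0 s n r h1, hS0 t n r (h1.trans hst)]
        · have h2 : t < r := by
            by_contra h'
            exact hr ⟨h1, not_lt.1 h'⟩
          filter_upwards [hgt s h1, hgt t h2] with n hn hn'
          simp [hn, hn']
  have hsub : Ioc s t ⊆ Ioo a b := fun r hr => ⟨has.trans hr.1, hr.2.trans_lt htb⟩
  rw [setIntegral_indicator measurableSet_Ioc, inter_eq_right.2 hsub] at hlim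
  have e : ∀ s n, (∫ r, deriv (S s n) r * m r)
      = ∫ r, ((n + 1) * deriv smoothTransition ((n + 1) * (r - s))) * m r := fun s n => by
    simp_rw [hS']
  simp_rw [e] at hev
  have h3 := ((tendsto_integral_deriv_smoothTransition hm hC s).sub
    (tendsto_integral_deriv_smoothTransition hm hC t)).add hlim
  have h4 := tendsto_nhds_unique (h3.congr' hev) tendsto_const_nhds
  linarith

end WeakDerivative

end GenFlow

namespace GenFlow

open MeasureTheory Set Filter Topology ProbabilityTheory
open scoped NNReal ENNReal

/-! ### Finite orthonormal coordinates -/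

section Coordinates

variable {H : Type*} [NormedAddCommGroup H] [InnerProductSpace ℝ H] {m : ℕ}

/-- The coordinates of a vector along a finite family. -/
noncomputable def coords (f : Fin m → H) : H →L[ℝ] EuclideanSpace ℝ (Fin m) :=
  (PiLp.continuousLinearEquiv 2 ℝ (fun _ : Fin m => ℝ)).symm.toContinuousLinearMap ∘L
    ContinuousLinearMap.pi fun i => innerSL ℝ (f i)

@[simp] lemma coords_apply_apply (f : Fin m → H) (x : H) (i : Fin m) :
    coords f x i = inner ℝ (f i) x := rfl

/-- The vector with given coordinates along a finite family. -/
noncomputable def combine (f : Fin m → H) : EuclideanSpace ℝ (Fin m) →L[ℝ] H :=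
  ∑ i, (EuclideanSpace.proj i : EuclideanSpace ℝ (Fin m) →L[ℝ] ℝ).smulRight (f i)

lemma combine_apply (f : Fin m → H) (y : EuclideanSpace ℝ (Fin m)) :
    combine f y = ∑ i, y i • f i := by
  simp [combine]

variable {f : Fin m → H}

lemma coords_combine (hf : Orthonormal ℝ f) (y : EuclideanSpace ℝ (Fin m)) :
    coords f (combine f y) = y := by
  ext i
  rw [coords_apply_apply, combine_apply, hf.inner_right_fintype]

lemma norm_combine (hf : Orthonormal ℝ f) (y : EuclideanSpace ℝ (Fin m)) :
    ‖combine f y‖ = ‖y‖ := by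
  rw [← sq_eq_sq₀ (norm_nonneg _) (norm_nonneg _), EuclideanSpace.norm_sq_eq,
    ← real_inner_self_eq_norm_sq, combine_apply, hf.inner_sum]
  simp [sq]

lemma norm_coords_le (hf : Orthonormal ℝ f) (x : H) : ‖coords f x‖ ≤ ‖x‖ := by
  rw [← sq_le_sq₀ (norm_nonneg _) (norm_nonneg _), EuclideanSpace.norm_sq_eq]
  simpa using hf.sum_inner_products_le (x := x) (s := Finset.univ)

end Coordinates

/-! ### The space-time measure of a curve of laws -/

section SpaceTime

variable {X : Type*} [MeasurableSpace X] {μ : ℝ → ProbabilityMeasure X} {a b : ℝ}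

/-- A measurable curve of probability measures as a Markov kernel. -/
def curveKernel (μ : ℝ → ProbabilityMeasure X) (hμ : Measurable fun t => (μ t : Measure X)) :
    Kernel ℝ X := ⟨fun t => μ t, hμ⟩

instance (hμ : Measurable fun t => (μ t : Measure X)) : IsMarkovKernel (curveKernel μ hμ) :=
  ⟨fun t => inferInstanceAs (IsProbabilityMeasure (μ t : Measure X))⟩

/-- The space-time measure `dt ⊗ μ_t` on `(a, b) × H`. -/
noncomputable def spaceTime (μ : ℝ → ProbabilityMeasure X)
    (hμ : Measurable fun t => (μ t : Measure X)) (a b : ℝ) : Measure (ℝ × X) :=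
  volume.restrict (Ioo a b) ⊗ₘ curveKernel μ hμ

instance (hμ : Measurable fun t => (μ t : Measure X)) : IsFiniteMeasure (spaceTime μ hμ a b) := by
  unfold spaceTime
  infer_instance

lemma lintegral_spaceTime (hμ : Measurable fun t => (μ t : Measure X)) {F : ℝ × X → ℝ≥0∞}
    (hF : Measurable F) :
    ∫⁻ p, F p ∂spaceTime μ hμ a b = ∫⁻ r in Ioo a b, ∫⁻ u, F (r, u) ∂(μ r : Measure X) :=
  Measure.lintegral_compProd hF

lemma ae_spaceTime_mem (hμ : Measurable fun t => (μ t : Measure X)) :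
    ∀ᵐ p ∂spaceTime μ hμ a b, p.1 ∈ Ioo a b := by
  have hm : MeasurableSet {p : ℝ × X | p.1 ∈ Ioo a b} := measurable_fst measurableSet_Ioo
  refine (Measure.ae_compProd_iff hm).2 ?_
  filter_upwards [ae_restrict_mem measurableSet_Ioo] with r hr
  exact ae_of_all _ fun u => hr

lemma integrable_integral_spaceTime (hμ : Measurable fun t => (μ t : Measure X)) {F : ℝ × X → ℝ}
    (hF : Integrable F (spaceTime μ hμ a b)) :
    IntegrableOn (fun r => ∫ u, F (r, u) ∂(μ r : Measure X)) (Ioo a b) := by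
  rw [spaceTime, Measure.compProd] at hF
  exact hF.integral_compProd

end SpaceTime

section FiniteSpeed

variable {H : Type*} [NormedAddCommGroup H] [TopologicalSpace.SeparableSpace H]
  [MeasurableSpace H] [BorelSpace H] {v : ℝ × H → H} {μ : ℝ → ProbabilityMeasure H} {a b : ℝ}

lemma integrable_spaceTime (hμ : Measurable fun t => (μ t : Measure H)) (hv : Measurable v)
    (hfin : FiniteSpeed v (Ioo a b) μ) : Integrable v (spaceTime μ hμ a b) := by
  refine ⟨hv.aestronglyMeasurable, ?_⟩
  rw [hasFiniteIntegral_iff_enorm, lintegral_spaceTime hμ hv.enorm]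
  exact hfin

end FiniteSpeed

/-! ### Time-dependent observables -/

section TimeContinuity

variable {H : Type*} [NormedAddCommGroup H] [InnerProductSpace ℝ H] [MeasurableSpace H]
  [BorelSpace H] {μ : ℝ → ProbabilityMeasure H} {m : ℕ}

/-- Continuity in time of integrals of time-dependent functions of finitely many coordinates. -/
lemma continuous_integral_of_lipschitz_time {f : Fin m → H}
    (hc : ∀ ψ : EuclideanSpace ℝ (Fin m) → ℝ, Continuous ψ → (∃ C, ∀ x, |ψ x| ≤ C) →
      Continuous fun t => ∫ u, ψ (coords f u) ∂(μ t : Measure H))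
    {G : ℝ → EuclideanSpace ℝ (Fin m) → ℝ} (hG : ∀ r, Continuous (G r)) {C : ℝ}
    (hC : ∀ r y, |G r y| ≤ C) {K : ℝ} (hK : ∀ r r' y, |G r y - G r' y| ≤ K * |r - r'|) :
    Continuous fun r => ∫ u, G r (coords f u) ∂(μ r : Measure H) := by
  have hgi : ∀ r r', Integrable (fun u => G r (coords f u)) (μ r' : Measure H) := fun r r' =>
    Integrable.of_bound ((hG r).comp (coords f).continuous).aestronglyMeasurable C
      (ae_of_all _ fun u => hC _ _)
  refine continuous_iff_continuousAt.2 fun r₀ => ?_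
  -- Both the measure and the integrand move. The integrand is frozen at `r₀`, and the error is at
  -- most `K * |r - r₀|` uniformly in the space variable.
  have h1 := (hc (G r₀) (hG r₀) ⟨C, fun y => hC _ _⟩).tendsto r₀
  have h2 : Tendsto (fun r => K * |r - r₀|) (𝓝 r₀) (𝓝 0) := by
    have : Continuous fun r => K * |r - r₀| := by fun_prop
    simpa using this.tendsto r₀
  refine (tendsto_iff_of_dist (squeeze_zero (fun _ => dist_nonneg) (fun r => ?_) h2)).1 h1
  rw [dist_comm, dist_eq_norm, ← integral_sub (hgi _ _) (hgi _ _)]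
  exact (norm_integral_le_of_norm_le_const (C := K * |r - r₀|)
    (ae_of_all _ fun u => hK r r₀ _)).trans_eq (by simp)

end TimeContinuity

/-! ### The Liouville equation compared with an Euler step -/

section Liouville

variable {H : Type*} [NormedAddCommGroup H] [InnerProductSpace ℝ H] [CompleteSpace H]
  {m : ℕ}

/-- For a test function of product form the integrand of the Liouville equation is a directional
derivative. -/
lemma deriv_add_inner_gradient {f : Fin m → H}
    {ψ : ℝ × EuclideanSpace ℝ (Fin m) → ℝ} (hψ : Differentiable ℝ ψ) (r : ℝ)
    (u q : H) :
    deriv (fun s => ψ (s, coords f u)) r + inner ℝ q (gradient (fun u => ψ (r, coords f u)) u)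
      = fderiv ℝ ψ (r, coords f u) (1, coords f q) := by
  have h1 : HasDerivAt (fun s => ψ (s, coords f u)) (fderiv ℝ ψ (r, coords f u) (1, 0)) r :=
    (hψ (r, coords f u)).hasFDerivAt.comp_hasDerivAt r
      ((hasDerivAt_id r).prodMk (hasDerivAt_const r (coords f u)))
  have h2 : HasFDerivAt (fun u => ψ (r, coords f u)) ((fderiv ℝ ψ (r, coords f u)).comp
      ((ContinuousLinearMap.inr ℝ ℝ _).comp (coords f))) u := by
    refine (hψ (r, coords f u)).hasFDerivAt.comp u ?_
    exact (hasFDerivAt_prodMk_right r (coords f u)).comp u (coords f).hasFDerivAt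
  rw [h1.deriv, gradient, h2.fderiv, real_inner_comm, InnerProductSpace.toDual_symm_apply]
  simp only [ContinuousLinearMap.comp_apply, ContinuousLinearMap.inr_apply]
  rw [← map_add]
  simp

variable [TopologicalSpace.SeparableSpace H] [MeasurableSpace H] [BorelSpace H]
  {v : ℝ × H → H} {μ : ℝ → ProbabilityMeasure H} {a b : ℝ}

/-- The Liouville equation for smooth functions of finitely many coordinates, compactly supported
in space locally uniformly in time. -/
lemma liouville_weak (hμ : Measurable fun t => (μ t : Measure H)) (hv : Measurable v)
    (hfin : FiniteSpeed v (Ioo a b) μ) (hL : SolvesLiouville v (Ioo a b) μ)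
    {f : Fin m → H} (hf : Orthonormal ℝ f) {g : ℝ × EuclideanSpace ℝ (Fin m) → ℝ}
    (hg : ContDiff ℝ ∞ g) {R : ℝ} (hgs : ∀ r ∈ Ioo a b, ∀ y, R < ‖y‖ → g (r, y) = 0)
    {C : ℝ} (hgC : ∀ p, |g p| ≤ C)
    {C' : ℝ} (hC' : 0 ≤ C') (hgC' : ∀ r ∈ Ioo a b, ∀ y q, |fderiv ℝ g (r, y) (1, q)| ≤ C' * (1 + ‖q‖)) :
    Integrable (fun p : ℝ × H => fderiv ℝ g (p.1, coords f p.2) (1, coords f (v p)))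
      (spaceTime μ hμ a b) ∧
    ∀ χ : ℝ → ℝ, ContDiff ℝ ∞ χ → HasCompactSupport χ → tsupport χ ⊆ Ioo a b →
      ∫ r in Ioo a b, (deriv χ r * (∫ u, g (r, coords f u) ∂(μ r : Measure H)) + χ r *
        ∫ u, fderiv ℝ g (r, coords f u) (1, coords f (v (r, u))) ∂(μ r : Measure H)) = 0 := by
  have hDm : Measurable fun p : ℝ × H =>
      fderiv ℝ g (p.1, coords f p.2) (1, coords f (v p)) := by
    have h1 : Measurable fun p : ℝ × H => (p.1, coords f p.2) :=
      measurable_fst.prodMk ((coords f).measurable.comp measurable_snd)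
    have h2 : Measurable fun p : ℝ × H => ((1 : ℝ), coords f (v p)) :=
      measurable_const.prodMk ((coords f).measurable.comp hv)
    have h3 : Continuous fun z : (ℝ × EuclideanSpace ℝ (Fin m)) × (ℝ × EuclideanSpace ℝ (Fin m)) =>
        fderiv ℝ g z.1 z.2 :=
      ((hg.continuous_fderiv (by simp)).comp continuous_fst).clm_apply continuous_snd
    exact h3.measurable.comp (h1.prodMk h2)
  have hint : Integrable (fun p : ℝ × H => fderiv ℝ g (p.1, coords f p.2) (1, coords f (v p)))
      (spaceTime μ hμ a b) := by
    refine Integrable.mono' (((integrable_const (1 : ℝ)).add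
      (integrable_spaceTime hμ hv hfin).norm).const_mul C') hDm.aestronglyMeasurable ?_
    filter_upwards [ae_spaceTime_mem hμ] with p hp
    refine (hgC' p.1 hp _ _).trans ?_
    exact mul_le_mul_of_nonneg_left (add_le_add_right (norm_coords_le hf _) 1) hC'
  refine ⟨hint, fun χ hχ hχs hχt => ?_⟩
  -- `g` need not have compact support in space-time: `χ` cuts off in time, and on the support of
  -- `χ` the function `g` vanishes outside the ball of radius `R`.
  let ψ : ℝ × EuclideanSpace ℝ (Fin m) → ℝ := fun p => χ p.1 * g p
  have hψ : ContDiff ℝ ∞ ψ := (hχ.comp contDiff_fst).mul hg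
  have hz : ∀ p, p ∉ tsupport χ ×ˢ Metric.closedBall (0 : EuclideanSpace ℝ (Fin m)) R →
      ψ p = 0 := by
    intro p hp
    by_cases h1 : p.1 ∈ tsupport χ
    · have h2 : R < ‖p.2‖ := by
        by_contra h'
        exact hp ⟨h1, by simpa using h'⟩
      simp only [ψ]
      rw [hgs p.1 (hχt h1) p.2 h2, mul_zero]
    · simp only [ψ]
      rw [image_eq_zero_of_notMem_tsupport h1, zero_mul]
  have htest : IsCylindricalTest (Ioo a b) (fun r u => ψ (r, coords f u)) := by
    refine ⟨m, f, ψ, hf, hψ, HasCompactSupport.intro (hχs.isCompact.prod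
      (isCompact_closedBall _ _)) hz, ?_, fun t _ u => rfl⟩
    refine (closure_minimal (t := tsupport χ ×ˢ univ) (fun p hp => ?_)
      ((isClosed_tsupport χ).prod isClosed_univ)).trans (prod_mono hχt subset_rfl)
    exact ⟨subset_tsupport _ (left_ne_zero_of_mul hp), mem_univ _⟩
  rw [← hL _ htest]
  have hae : ∀ᵐ r ∂volume.restrict (Ioo a b), Integrable
      (fun u => fderiv ℝ g (r, coords f u) (1, coords f (v (r, u)))) (μ r : Measure H) :=
    ((Measure.integrable_compProd_iff hDm.aestronglyMeasurable).1 hint).1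
  refine integral_congr_ae ?_
  filter_upwards [hae] with r hr
  have e1 : ∀ u, deriv (fun s => ψ (s, coords f u)) r
      + inner ℝ (v (r, u)) (gradient (fun u => ψ (r, coords f u)) u)
      = deriv χ r * g (r, coords f u)
        + χ r * fderiv ℝ g (r, coords f u) (1, coords f (v (r, u))) := fun u => by
    rw [deriv_add_inner_gradient (hψ.differentiable (by simp))]
    have h0 : HasFDerivAt (fun p : ℝ × EuclideanSpace ℝ (Fin m) => p.1)
        (ContinuousLinearMap.fst ℝ ℝ (EuclideanSpace ℝ (Fin m))) (r, coords f u) :=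
      hasFDerivAt_fst
    have h1 := (hχ.differentiable (by simp) r).hasDerivAt.comp_hasFDerivAt (r, coords f u) h0
    have h2 := (hg.differentiable (by simp) (r, coords f u)).hasFDerivAt
    rw [show fderiv ℝ ψ (r, coords f u) = _ from (h1.mul h2).fderiv]
    simp
    ring
  simp_rw [e1]
  rw [integral_add, integral_const_mul, integral_const_mul]
  · refine Integrable.const_mul (Integrable.of_bound ?_ C (ae_of_all _ fun u => hgC _)) _
    have := hg.continuous
    exact Continuous.aestronglyMeasurable (by fun_prop)
  · exact hr.const_mul _

/-- Evolution of smooth observables of finitely many coordinates along the Liouville equation,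
compared with one explicit Euler step for a field `w`. -/
lemma liouville_step_smooth (hμ : Measurable fun t => (μ t : Measure H)) (hv : Measurable v)
    (hfin : FiniteSpeed v (Ioo a b) μ) (hL : SolvesLiouville v (Ioo a b) μ)
    {f : Fin m → H} (hf : Orthonormal ℝ f)
    (hc : ∀ ψ : EuclideanSpace ℝ (Fin m) → ℝ, Continuous ψ → (∃ C, ∀ x, |ψ x| ≤ C) →
      Continuous fun t => ∫ u, ψ (coords f u) ∂(μ t : Measure H))
    {s t : ℝ} (has : a < s) (hst : s ≤ t) (htb : t < b)
    {w : EuclideanSpace ℝ (Fin m) → EuclideanSpace ℝ (Fin m)} (hw : ContDiff ℝ ∞ w) {L : ℝ≥0}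
    (hwL : LipschitzWith L w) {M : ℝ} (hwM : ∀ y, ‖w y‖ ≤ M)
    {h : EuclideanSpace ℝ (Fin m) → ℝ} (hh : ContDiff ℝ ∞ h) (hhs : HasCompactSupport h) {K : ℝ≥0}
    (hhK : LipschitzWith K h) :
    ∫ u, h (coords f u) ∂(μ t : Measure H)
        - ∫ u, h (coords f u + (t - s) • w (coords f u)) ∂(μ s : Measure H)
      ≤ K * ∫ p in {p : ℝ × H | p.1 ∈ Ioc s t}, (‖coords f (v p) - w (coords f p.2)‖
          + (t - s) * L * ‖v p‖) ∂spaceTime μ hμ a b := by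
  have hM : 0 ≤ M := (norm_nonneg _).trans (hwM 0)
  have hab : 0 ≤ b - a := by linarith
  -- The observable after an Euler step from time `r` to time `t`: it is `h` at `r = t` and `h`
  -- composed with the full step at `r = s`. Along `(1, q)` its derivative sees only `q - w y` and
  -- the small term `(t - r) • Dw q`.
  let g : ℝ × EuclideanSpace ℝ (Fin m) → ℝ := fun p => h (p.2 + (t - p.1) • w p.2)
  have hg : ContDiff ℝ ∞ g := hh.comp
    (contDiff_snd.add ((contDiff_const.sub contDiff_fst).smul (hw.comp contDiff_snd)))
  have hder : ∀ r y q, |fderiv ℝ g (r, y) (1, q)| ≤ K * (‖q - w y‖ + |t - r| * L * ‖q‖) := by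
    intro r y q
    have h1 : HasFDerivAt (fun p : ℝ × EuclideanSpace ℝ (Fin m) => p.2)
        (ContinuousLinearMap.snd ℝ ℝ (EuclideanSpace ℝ (Fin m))) (r, y) := hasFDerivAt_snd
    have h2 : HasFDerivAt (fun p : ℝ × EuclideanSpace ℝ (Fin m) => p.1)
        (ContinuousLinearMap.fst ℝ ℝ (EuclideanSpace ℝ (Fin m))) (r, y) := hasFDerivAt_fst
    have h3 := (hw.differentiable (by simp) y).hasFDerivAt.comp (r, y) h1
    have h4 := h1.add ((h2.const_sub t).smul h3)
    have h5 := (hh.differentiable (by simp) (y + (t - r) • w y)).hasFDerivAt.comp (r, y) h4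
    have h6 : fderiv ℝ g (r, y) (1, q)
        = fderiv ℝ h (y + (t - r) • w y) ((q - w y) + (t - r) • fderiv ℝ w y q) := by
      rw [show fderiv ℝ g (r, y) = _ from h5.fderiv]
      simp only [ContinuousLinearMap.comp_apply]
      congr 1
      simp
      abel
    rw [h6, ← Real.norm_eq_abs]
    refine (ContinuousLinearMap.le_opNorm _ _).trans ?_
    have h7 : ‖(q - w y) + (t - r) • fderiv ℝ w y q‖ ≤ ‖q - w y‖ + |t - r| * L * ‖q‖ := by
      refine (norm_add_le _ _).trans (add_le_add_right ?_ _)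
      rw [norm_smul, Real.norm_eq_abs, mul_assoc]
      refine mul_le_mul_of_nonneg_left ?_ (abs_nonneg _)
      exact (ContinuousLinearMap.le_opNorm _ _).trans
        (mul_le_mul_of_nonneg_right (norm_fderiv_le_of_lipschitz ℝ hwL) (norm_nonneg _))
    exact mul_le_mul (norm_fderiv_le_of_lipschitz ℝ hhK) h7 (norm_nonneg _) K.coe_nonneg
  obtain ⟨C, hC⟩ := hhs.exists_bound_of_continuous hh.continuous
  obtain ⟨R, hR⟩ := hhs.isCompact.isBounded.subset_closedBall 0
  -- An Euler step of duration at most `b - a` moves a point by at most `(b - a) * M`.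
  have hgs : ∀ r ∈ Ioo a b, ∀ y, R + (b - a) * M < ‖y‖ → g (r, y) = 0 := by
    intro r hr y hy
    refine image_eq_zero_of_notMem_tsupport (f := h) fun h' => ?_
    have h1 : ‖y + (t - r) • w y‖ ≤ R := by simpa using hR h'
    have h2 : ‖(t - r) • w y‖ ≤ (b - a) * M := by
      rw [norm_smul, Real.norm_eq_abs]
      refine mul_le_mul (abs_le.2 ⟨?_, ?_⟩) (hwM y) (norm_nonneg _) hab <;>
        linarith [hr.1, hr.2]
    have h3 : ‖y‖ ≤ ‖y + (t - r) • w y‖ + ‖(t - r) • w y‖ := by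
      simpa using norm_sub_le (y + (t - r) • w y) ((t - r) • w y)
    linarith
  obtain ⟨hint, hweak⟩ := liouville_weak hμ hv hfin hL hf hg hgs (fun p => hC _)
    (C' := K * (1 + M + (b - a) * L)) (by positivity) fun r hr y q => by
      refine (hder r y q).trans ?_
      rw [mul_assoc (K : ℝ)]
      refine mul_le_mul_of_nonneg_left ?_ K.coe_nonneg
      have h1 : ‖q - w y‖ ≤ ‖q‖ + M := (norm_sub_le _ _).trans (add_le_add_right (hwM y) _)
      have h2 : |t - r| * L * ‖q‖ ≤ (b - a) * L * ‖q‖ := by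
        gcongr
        exact abs_le.2 ⟨by linarith [hr.1, hr.2], by linarith [hr.1, hr.2]⟩
      have h3 : 0 ≤ (b - a) * L := by positivity
      have := norm_nonneg q
      nlinarith
  have hgc : ∀ r, Continuous fun y => g (r, y) := fun r => by
    have := hg.continuous
    fun_prop
  have hmc : Continuous fun r => ∫ u, g (r, coords f u) ∂(μ r : Measure H) := by
    refine continuous_integral_of_lipschitz_time hc hgc (fun r y => hC _) (K := K * M)
      fun r r' y => ?_
    rw [← Real.dist_eq]
    refine (hhK.dist_le_mul _ _).trans ?_
    rw [mul_assoc (K : ℝ)]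
    refine mul_le_mul_of_nonneg_left ?_ K.coe_nonneg
    rw [dist_add_left, dist_eq_norm, ← sub_smul, norm_smul, mul_comm, Real.norm_eq_abs,
      show t - r - (t - r') = r' - r by ring, abs_sub_comm r]
    exact mul_le_mul_of_nonneg_right (hwM _) (abs_nonneg _)
  have hmC : ∀ r, |∫ u, g (r, coords f u) ∂(μ r : Measure H)| ≤ C := fun r =>
    (norm_integral_le_of_norm_le_const (ae_of_all _ fun u => hC _)).trans_eq (by simp)
  have h1 := sub_eq_integral_of_weak_deriv hmc hmC (integrable_integral_spaceTime hμ hint) has hst htb hweak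
  have h2 : ∫ r in Ioc s t, ∫ u, fderiv ℝ g (r, coords f u) (1, coords f (v (r, u)))
      ∂(μ r : Measure H) = ∫ p in {p : ℝ × H | p.1 ∈ Ioc s t},
        fderiv ℝ g (p.1, coords f p.2) (1, coords f (v p)) ∂spaceTime μ hμ a b := by
    have e : {p : ℝ × H | p.1 ∈ Ioc s t} = Ioc s t ×ˢ univ := by ext; simp
    rw [e]
    refine Eq.trans ?_ (Measure.setIntegral_compProd measurableSet_Ioc MeasurableSet.univ
      hint.integrableOn).symm
    rw [Measure.restrict_restrict measurableSet_Ioc,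
      inter_eq_left.2 (show Ioc s t ⊆ Ioo a b from
        fun r hr => ⟨has.trans hr.1, hr.2.trans_lt htb⟩)]
    simp
    rfl
  have hms : MeasurableSet {p : ℝ × H | p.1 ∈ Ioc s t} := measurable_fst measurableSet_Ioc
  have hvi := integrable_spaceTime hμ hv hfin
  have e1 : ∫ u, g (t, coords f u) ∂(μ t : Measure H) = ∫ u, h (coords f u) ∂(μ t : Measure H) := by
    simp [g]
  rw [← e1]
  refine h1.trans_le ?_
  rw [h2, ← integral_const_mul]
  refine setIntegral_mono_on hint.integrableOn (Integrable.integrableOn ?_) hms fun p hp => ?_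
  · refine Integrable.const_mul (Integrable.add ?_ (hvi.norm.const_mul _)) _
    refine (((coords f).integrable_comp hvi).sub ?_).norm
    refine Integrable.of_bound ?_ M (ae_of_all _ fun p => hwM _)
    exact (hw.continuous.measurable.comp
      ((coords f).measurable.comp measurable_snd)).aestronglyMeasurable
  · refine (le_abs_self _).trans ((hder _ _ _).trans ?_)
    have h3 : |t - p.1| ≤ t - s := abs_le.2 ⟨by linarith [hp.1, hp.2], by linarith [hp.1, hp.2]⟩
    have h4 := norm_coords_le hf (v p)
    gcongr

/-- Evolution of bounded Lipschitz observables of finitely many coordinates along the Liouville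
equation, compared with one explicit Euler step for a field `w`. -/
theorem liouville_step (hμ : Measurable fun t => (μ t : Measure H)) (hv : Measurable v)
    (hfin : FiniteSpeed v (Ioo a b) μ) (hL : SolvesLiouville v (Ioo a b) μ)
    {f : Fin m → H} (hf : Orthonormal ℝ f)
    (hc : ∀ ψ : EuclideanSpace ℝ (Fin m) → ℝ, Continuous ψ → (∃ C, ∀ x, |ψ x| ≤ C) →
      Continuous fun t => ∫ u, ψ (coords f u) ∂(μ t : Measure H))
    {s t : ℝ} (has : a < s) (hst : s ≤ t) (htb : t < b)
    {w : EuclideanSpace ℝ (Fin m) → EuclideanSpace ℝ (Fin m)} (hw : ContDiff ℝ ∞ w) {L : ℝ≥0}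
    (hwL : LipschitzWith L w) {M : ℝ} (hwM : ∀ y, ‖w y‖ ≤ M)
    {h : EuclideanSpace ℝ (Fin m) → ℝ} {K : ℝ≥0}
    (hhK : LipschitzWith K h) {C : ℝ} (hC : ∀ x, |h x| ≤ C) :
    ∫ u, h (coords f u) ∂(μ t : Measure H)
        - ∫ u, h (coords f u + (t - s) • w (coords f u)) ∂(μ s : Measure H)
      ≤ K * ∫ p in {p : ℝ × H | p.1 ∈ Ioc s t}, (‖coords f (v p) - w (coords f p.2)‖
          + (t - s) * L * ‖v p‖) ∂spaceTime μ hμ a b := by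
  -- The smooth approximation uses tents of slope `K`, hence needs `K > 0`; for `K = 0` the
  -- observable is constant.
  rcases eq_or_ne K 0 with rfl | hK
  · have : ∀ x, h x = h 0 := fun x => by simpa using hhK.dist_le_mul x 0
    have e : ∀ u, h (coords f u + (t - s) • w (coords f u)) = h 0 := fun u => this _
    have e' : ∀ u, h (coords f u) = h 0 := fun u => this _
    simp_rw [e, e']
    simp
  obtain ⟨g, hg, hgs, hgK, hgC, hlim⟩ := exists_smooth_lipschitz_approx (pos_iff_ne_zero.2 hK) hhK hC
  have hconv : ∀ r (T : H → EuclideanSpace ℝ (Fin m)), Continuous T → Tendsto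
      (fun n => ∫ u, g n (T u) ∂(μ r : Measure H)) atTop (𝓝 (∫ u, h (T u) ∂(μ r : Measure H))) :=
    fun r T hT => tendsto_integral_of_dominated_convergence (fun _ => C)
      (fun n => ((hg n).continuous.comp hT).aestronglyMeasurable) (integrable_const _)
      (fun n => ae_of_all _ fun u => hgC n _) (ae_of_all _ fun u => hlim _)
  refine le_of_tendsto ((hconv t _ (coords f).continuous).sub (hconv s _ ?_))
    (Eventually.of_forall fun n => liouville_step_smooth hμ hv hfin hL hf hc has hst htb hw hwL hwM
      (hg n) (hgs n) (hgK n))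
  have := hw.continuous
  fun_prop

end Liouville

end GenFlow

namespace GenFlow

open MeasureTheory Set Filter Topology ProbabilityTheory
open scoped NNReal ENNReal BoundedContinuousFunction

/-! ### Projections along a Hilbert basis and the weak norm -/

section BasisProjection

variable {H : Type*} [NormedAddCommGroup H] [InnerProductSpace ℝ H] {S : Set ℕ}

/-- An enumeration of finitely many vectors of a Hilbert basis. -/
noncomputable def subfamily (e : HilbertBasis S ℝ H) (s : Finset S) : Fin s.card → H :=
  fun i => e (s.equivFin.symm i)

lemma orthonormal_subfamily (e : HilbertBasis S ℝ H) (s : Finset S) :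
    Orthonormal ℝ (subfamily e s) :=
  e.orthonormal.comp (fun i => (s.equivFin.symm i : S))
    (Subtype.val_injective.comp s.equivFin.symm.injective)

/-- The orthogonal projection onto the span of finitely many vectors of a Hilbert basis. -/
noncomputable def basisProj (e : HilbertBasis S ℝ H) (s : Finset S) : H →L[ℝ] H :=
  combine (subfamily e s) ∘L coords (subfamily e s)

lemma basisProj_eq (e : HilbertBasis S ℝ H) (s : Finset S) (x : H) :
    basisProj e s x = combine (subfamily e s) (coords (subfamily e s) x) := rfl

lemma basisProj_apply (e : HilbertBasis S ℝ H) (s : Finset S) (x : H) :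
    basisProj e s x = ∑ i ∈ s, inner ℝ (e i) x • e i := by
  rw [basisProj_eq, combine_apply]
  simp only [coords_apply_apply, subfamily]
  rw [Equiv.sum_comp s.equivFin.symm (fun i : s => inner ℝ (e i) x • e i)]
  exact Finset.sum_coe_sort s fun i => inner ℝ (e i) x • e i

lemma tendsto_basisProj (e : HilbertBasis S ℝ H) (x : H) :
    Tendsto (fun s => basisProj e s x) atTop (𝓝 x) := by
  have := e.hasSum_repr x
  simp only [HilbertBasis.repr_apply_apply] at this
  simp only [basisProj_apply]
  exact this

lemma norm_basisProj_le (e : HilbertBasis S ℝ H) (s : Finset S) (x : H) :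
    ‖basisProj e s x‖ ≤ ‖x‖ := by
  rw [basisProj_eq, norm_combine (orthonormal_subfamily e s)]
  exact norm_coords_le (orthonormal_subfamily e s) x

/-- Projections are contractions, so pointwise convergence tolerates a convergent argument. This is
needed because the approximation of `v` projects both its argument and its value. -/
lemma tendsto_basisProj_comp (e : HilbertBasis S ℝ H) {q : Finset S → H} {x : H}
    (hq : Tendsto q atTop (𝓝 x)) : Tendsto (fun s => basisProj e s (q s)) atTop (𝓝 x) := by
  have h1 : Tendsto (fun s => basisProj e s (q s - x)) atTop (𝓝 0) := by
    refine squeeze_zero_norm (fun s => norm_basisProj_le e s _) ?_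
    simpa using (hq.sub_const x).norm
  simpa using h1.add (tendsto_basisProj e x)

lemma inner_basisProj (e : HilbertBasis S ℝ H) {s : Finset S} {i : S} (hi : i ∈ s) (x : H) :
    inner ℝ (e i) (basisProj e s x) = inner ℝ (e i) x := by
  rw [basisProj_apply, e.orthonormal.inner_right_sum _ hi]

/-- This consistency lets a field in the coordinates of `s` be tested on laws projected along the
larger set `t`. -/
lemma coords_basisProj (e : HilbertBasis S ℝ H) {s t : Finset S} (hst : s ⊆ t) (x : H) :
    coords (subfamily e s) (basisProj e t x) = coords (subfamily e s) x := by
  ext i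
  exact inner_basisProj e (hst (s.equivFin.symm i).2) x

/-- If `N` is one plus the largest index in `s`, every weight `1 / (i + 1) ^ 2` occurring in `s` is
at least `1 / N ^ 2`. -/
lemma norm_coords_le_weakNorm (e : HilbertBasis S ℝ H) (s : Finset S) :
    ∃ N > 0, ∀ x, ‖coords (subfamily e s) x‖ ≤ N * weakNorm e x := by
  refine ⟨((s.sup fun i => (i : ℕ) : ℕ) : ℝ) + 1, by positivity, fun x => ?_⟩
  set N : ℝ := ((s.sup fun i => (i : ℕ) : ℕ) : ℝ) + 1
  have hN : 0 ≤ N := by positivity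
  have hsum : Summable fun i : S => (1 / ((i : ℕ) + 1 : ℝ) ^ 2) * (inner ℝ (e i) x) ^ 2 := by
    refine (e.orthonormal.inner_products_summable (x := x)).of_nonneg_of_le
      (fun i => by positivity) fun i => ?_
    rw [Real.norm_eq_abs, sq_abs]
    refine mul_le_of_le_one_left (sq_nonneg _) ?_
    rw [div_le_one (by positivity)]
    exact one_le_pow₀ (by linarith [(Nat.cast_nonneg (i : ℕ) : (0 : ℝ) ≤ (i : ℕ))])
  have h1 : ‖coords (subfamily e s) x‖ ^ 2 = ∑ i ∈ s, (inner ℝ (e i) x) ^ 2 := by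
    rw [EuclideanSpace.norm_sq_eq]
    simp only [coords_apply_apply, subfamily, Real.norm_eq_abs, sq_abs]
    rw [Equiv.sum_comp s.equivFin.symm (fun i : s => (inner ℝ (e i) x) ^ 2)]
    exact Finset.sum_coe_sort s fun i => (inner ℝ (e i) x) ^ 2
  rw [weakNorm, ← sq_le_sq₀ (norm_nonneg _) (mul_nonneg hN (Real.sqrt_nonneg _)), h1, mul_pow,
    Real.sq_sqrt (tsum_nonneg fun i => by positivity)]
  refine le_trans ?_ (mul_le_mul_of_nonneg_left
    (hsum.sum_le_tsum s fun i _ => by positivity) (sq_nonneg N))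
  rw [Finset.mul_sum]
  refine Finset.sum_le_sum fun i hi => ?_
  have h2 : ((i : ℕ) : ℝ) ≤ (s.sup fun i => (i : ℕ) : ℕ) :=
    Nat.cast_le.2 (Finset.le_sup (f := fun i : S => (i : ℕ)) hi)
  have h3 : (0 : ℝ) < (i : ℕ) + 1 := by positivity
  rw [← mul_assoc]
  refine le_mul_of_one_le_left (sq_nonneg _) ?_
  rw [mul_one_div, one_le_div (by positivity)]
  exact pow_le_pow_left₀ h3.le (by linarith) 2

lemma weakNormContinuous_coords (e : HilbertBasis S ℝ H) (s : Finset S)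
    {ψ : EuclideanSpace ℝ (Fin s.card) → ℝ} (hψ : Continuous ψ) :
    WeakNormContinuous e fun u => ψ (coords (subfamily e s) u) := by
  intro x ε hε
  obtain ⟨N, hN, hNx⟩ := norm_coords_le_weakNorm e s
  obtain ⟨δ, hδ, hδψ⟩ := Metric.continuous_iff.1 hψ (coords (subfamily e s) x) ε hε
  refine ⟨δ / N, by positivity, fun y hy => hδψ _ ?_⟩
  rw [dist_eq_norm, ← map_sub]
  refine (hNx _).trans_lt ?_
  rwa [lt_div_iff₀' hN] at hy

end BasisProjection

/-! ### Measurability of the curve of laws -/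

section Measurability

variable {H : Type*} [NormedAddCommGroup H] [InnerProductSpace ℝ H]
  [MeasurableSpace H] {S : Set ℕ} {μ : ℝ → ProbabilityMeasure H}

lemma WeaklyNarrowlyContinuous.continuous_coords {e : HilbertBasis S ℝ H}
    (hμ : WeaklyNarrowlyContinuous e μ) (s : Finset S)
    {ψ : EuclideanSpace ℝ (Fin s.card) → ℝ} (hψ : Continuous ψ) (hb : ∃ C, ∀ x, |ψ x| ≤ C) :
    Continuous fun t => ∫ u, ψ (coords (subfamily e s) u) ∂(μ t : Measure H) :=
  hμ _ (hb.imp fun _ hC _ => hC _) (weakNormContinuous_coords e s hψ)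

/-- Norm continuity of `ψ` suffices: after a finite-dimensional projection it becomes a continuous
function of finitely many coordinates, hence weak-norm continuous. -/
lemma WeaklyNarrowlyContinuous.continuous_basisProj {e : HilbertBasis S ℝ H}
    (hμ : WeaklyNarrowlyContinuous e μ) (s : Finset S) {ψ : H → ℝ} (hψ : Continuous ψ)
    (hb : ∃ C, ∀ x, |ψ x| ≤ C) :
    Continuous fun t => ∫ u, ψ (basisProj e s u) ∂(μ t : Measure H) :=
  hμ.continuous_coords s (hψ.comp (combine _).continuous) (hb.imp fun _ hC _ => hC _)

variable [BorelSpace H]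

lemma tendsto_integral_basisProj (e : HilbertBasis S ℝ H) (ν : Measure H) [IsFiniteMeasure ν]
    (ψ : H →ᵇ ℝ) : Tendsto (fun s => ∫ u, ψ (basisProj e s u) ∂ν) atTop (𝓝 (∫ u, ψ u ∂ν)) :=
  tendsto_integral_filter_of_dominated_convergence (fun _ => ‖ψ‖)
    (Eventually.of_forall fun s =>
      (ψ.continuous.comp (basisProj e s).continuous).aestronglyMeasurable)
    (Eventually.of_forall fun _ => ae_of_all _ fun _ => ψ.norm_coe_le_norm _)
    (integrable_const _) (ae_of_all _ fun u => (ψ.continuous.tendsto u).comp (tendsto_basisProj e u))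

/-- A weakly narrowly continuous curve of probability measures is measurable. -/
theorem WeaklyNarrowlyContinuous.measurable {e : HilbertBasis S ℝ H}
    (hμ : WeaklyNarrowlyContinuous e μ) : Measurable fun t => (μ t : Measure H) := by
  -- For norm-continuous `ψ` the integral need not be continuous in `t`, but it is a pointwise limit
  -- of continuous functions along finite sets of basis vectors. Closed sets are then reached
  -- through their outer approximations.
  have h1 : ∀ ψ : H →ᵇ ℝ, Measurable fun t => ∫ u, ψ u ∂(μ t : Measure H) := fun ψ =>
    measurable_of_tendsto_metrizable' atTop
      (fun s => (hμ.continuous_basisProj s ψ.continuous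
        ⟨‖ψ‖, fun x => ψ.norm_coe_le_norm x⟩).measurable)
      (tendsto_pi_nhds.2 fun t => tendsto_integral_basisProj e (μ t : Measure H) ψ)
  refine Measurable.measure_of_isPiSystem_of_isProbabilityMeasure
    (BorelSpace.measurable_eq.trans borel_eq_generateFrom_isClosed) isPiSystem_isClosed
    fun F hF => ?_
  have hF' : IsClosed F := hF
  refine measurable_of_tendsto_metrizable (f := fun n t => ∫⁻ x, hF'.apprSeq n x ∂(μ t : Measure H))
    (fun n => ?_) (tendsto_pi_nhds.2 fun t =>
      HasOuterApproxClosed.tendsto_lintegral_apprSeq hF' (μ t : Measure H))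
  have h2 : ∀ t, ∫⁻ x, hF'.apprSeq n x ∂(μ t : Measure H)
      = ENNReal.ofReal (∫ x, (hF'.apprSeq n x : ℝ) ∂(μ t : Measure H)) := fun t => by
    rw [ofReal_integral_eq_lintegral_ofReal]
    · simp
    · exact (BoundedContinuousFunction.integrable_of_nnreal _ _)
    · exact ae_of_all _ fun x => NNReal.coe_nonneg _
  simp_rw [h2]
  let ψ : H →ᵇ ℝ := BoundedContinuousFunction.ofNormedAddCommGroup
    (fun x => (hF'.apprSeq n x : ℝ)) (by fun_prop) 1 fun x => by
      simpa using HasOuterApproxClosed.apprSeq_apply_le_one hF' n x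
  exact (h1 ψ).ennreal_ofReal

end Measurability

/-! ### Mean approximation and radial truncation -/

section Approximation

variable {X F : Type*} [MeasurableSpace X] [NormedAddCommGroup F]

lemma eventually_integral_norm_sub_le {ι : Type*} {l : Filter ι} [l.IsCountablyGenerated]
    {M : Measure X} {G : ι → X → F} {g : X → F} {bound : X → ℝ}
    (hG : ∀ i, AEStronglyMeasurable (G i) M) (hg : AEStronglyMeasurable g M)
    (hb : Integrable bound M) (hGb : ∀ i x, ‖G i x‖ ≤ bound x)
    (hgb : ∀ x, ‖g x‖ ≤ bound x)
    (hlim : ∀ᵐ x ∂M, Tendsto (fun i => G i x) l (𝓝 (g x))) {ε : ℝ} (hε : 0 < ε) :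
    ∀ᶠ i in l, ∫ x, ‖G i x - g x‖ ∂M ≤ ε := by
  have h1 : Tendsto (fun i => ∫ x, ‖G i x - g x‖ ∂M) l (𝓝 (∫ _, (0 : ℝ) ∂M)) := by
    refine tendsto_integral_filter_of_dominated_convergence (fun x => 2 * bound x)
      (Eventually.of_forall fun i => ((hG i).sub hg).norm)
      (Eventually.of_forall fun i => ae_of_all _ fun x => ?_) (hb.const_mul 2) ?_
    · rw [norm_norm, two_mul]
      exact (norm_sub_le _ _).trans (add_le_add (hGb i x) (hgb x))
    · filter_upwards [hlim] with x hx
      simpa using (hx.sub_const (g x)).norm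
  rw [integral_zero] at h1
  exact h1.eventually_le_const hε

lemma integral_norm_sub_le_add {M : Measure X} {f g h : X → F} (hf : Integrable f M)
    (hg : Integrable g M) (hh : Integrable h M) {c d : ℝ} (hc : ∫ x, ‖f x - g x‖ ∂M ≤ c)
    (hd : ∫ x, ‖g x - h x‖ ∂M ≤ d) : ∫ x, ‖f x - h x‖ ∂M ≤ c + d := by
  refine le_trans ?_ (add_le_add hc hd)
  have h1 : Integrable (fun x => ‖f x - g x‖) M := (hf.sub hg).norm
  have h2 : Integrable (fun x => ‖g x - h x‖) M := (hg.sub hh).norm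
  rw [← integral_add h1 h2]
  exact integral_mono (hf.sub hh).norm (h1.add h2)
    fun x => norm_sub_le_norm_sub_add_norm_sub _ _ _

variable {H : Type*} [NormedAddCommGroup H] [NormedSpace ℝ H]

/-- The radial truncation at radius `R`. -/
noncomputable def truncate (R : ℝ) (q : H) : H := (R / max R ‖q‖) • q

lemma continuous_truncate {R : ℝ} (hR : 0 < R) : Continuous (truncate R : H → H) :=
  (continuous_const.div (by fun_prop) fun q => (lt_max_of_lt_left hR).ne').smul continuous_id

lemma truncate_of_norm_le {R : ℝ} (hR : 0 < R) {q : H} (hq : ‖q‖ ≤ R) : truncate R q = q := by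
  rw [truncate, max_eq_left hq, div_self hR.ne', one_smul]

lemma norm_truncate_le {R : ℝ} (hR : 0 < R) (q : H) : ‖truncate R q‖ ≤ R := by
  have h : 0 < max R ‖q‖ := lt_max_of_lt_left hR
  rw [truncate, norm_smul, Real.norm_of_nonneg (by positivity), div_mul_eq_mul_div, div_le_iff₀ h]
  exact mul_le_mul_of_nonneg_left (le_max_right _ _) hR.le

lemma norm_truncate_le_norm {R : ℝ} (hR : 0 < R) (q : H) : ‖truncate R q‖ ≤ ‖q‖ := by
  have h : 0 < max R ‖q‖ := lt_max_of_lt_left hR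
  rw [truncate, norm_smul, Real.norm_of_nonneg (by positivity)]
  exact mul_le_of_le_one_left (norm_nonneg _) ((div_le_one h).2 (le_max_left _ _))

end Approximation

/-! ### Cylindrical approximation of the vector field -/

section CylindricalApproximation

variable {H : Type*} [NormedAddCommGroup H] [InnerProductSpace ℝ H]
  [TopologicalSpace.SeparableSpace H] [MeasurableSpace H] [BorelSpace H] {S : Set ℕ}

/-- An integrable continuous vector field is approximated in `L¹` by smooth compactly supported
fields depending on, and with values in, finitely many coordinates. -/
theorem exists_cylindrical_approx (e : HilbertBasis S ℝ H) {M : Measure (ℝ × H)} [IsFiniteMeasure M]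
    {v : ℝ × H → H} (hv : Continuous v) (hvM : Integrable v M) {ε : ℝ} (hε : 0 < ε) :
    ∀ᶠ s : Finset S in atTop, ∃ W : ℝ × EuclideanSpace ℝ (Fin s.card) →
        EuclideanSpace ℝ (Fin s.card), ContDiff ℝ ∞ W ∧ HasCompactSupport W ∧
      ∫ p, ‖combine (subfamily e s) (W (p.1, coords (subfamily e s) p.2)) - v p‖ ∂M ≤ ε := by
  -- Four approximations cost `ε / 4` each: radial truncation of `v`, projection of argument and
  -- value, a space-time cutoff, and mollification. Truncation comes first because `v` at the
  -- projected point need not be integrable; afterwards the constant `R` dominates everything.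
  obtain ⟨n, hn⟩ := (eventually_integral_norm_sub_le (M := M) (l := atTop)
    (G := fun (n : ℕ) p => truncate ((n : ℝ) + 1) (v p)) (g := v) (bound := fun p => ‖v p‖)
    (fun n => ((continuous_truncate (by positivity)).comp hv).aestronglyMeasurable)
    hv.aestronglyMeasurable hvM.norm (fun n p => norm_truncate_le_norm (by positivity) _)
    (fun p => le_rfl) (ae_of_all _ fun p => by
      refine tendsto_const_nhds.congr' ?_
      filter_upwards [eventually_ge_atTop ⌈‖v p‖⌉₊] with n hn
      refine (truncate_of_norm_le (by positivity) ?_).symm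
      exact (Nat.le_ceil _).trans ((Nat.cast_le.2 hn).trans (by linarith)))
    (show 0 < ε / 4 by positivity)).exists
  set R : ℝ := (n : ℝ) + 1
  have hR : 0 < R := by positivity
  have hθ := continuous_truncate (H := H) hR
  have hP : ∀ s, Continuous fun p : ℝ × H => basisProj e s (truncate R (v (p.1, basisProj e s p.2))) :=
    fun s => by fun_prop
  have hθv : Continuous fun p => truncate R (v p) := hθ.comp hv
  have h2 := eventually_integral_norm_sub_le (M := M) (l := atTop)
    (G := fun (s : Finset S) (p : ℝ × H) => basisProj e s (truncate R (v (p.1, basisProj e s p.2))))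
    (g := fun p => truncate R (v p)) (bound := fun _ => R)
    (fun s => (hP s).aestronglyMeasurable)
    hθv.aestronglyMeasurable (integrable_const _)
    (fun s p => (norm_basisProj_le e s _).trans (norm_truncate_le hR _))
    (fun p => norm_truncate_le hR _) (ae_of_all _ fun p => by
      refine tendsto_basisProj_comp e ((hθv.tendsto p).comp ?_)
      exact tendsto_const_nhds.prodMk_nhds (tendsto_basisProj e p.2)) (show 0 < ε / 4 by positivity)
  filter_upwards [h2] with s hs
  set f := subfamily e s with hf
  have hfo : Orthonormal ℝ f := orthonormal_subfamily e s
  -- The truncated and projected field written in coordinates; composing with `combine f` and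
  -- `coords f` gives back definitionally the field estimated in `hs`.
  let W₀ : ℝ × EuclideanSpace ℝ (Fin s.card) → EuclideanSpace ℝ (Fin s.card) := fun z =>
    coords f (truncate R (v (z.1, combine f z.2)))
  have hW₀ : Continuous W₀ := by fun_prop
  have hW₀R : ∀ z, ‖W₀ z‖ ≤ R := fun z => (norm_coords_le hfo _).trans (norm_truncate_le hR _)
  have hJ : Continuous fun p : ℝ × H => (p.1, coords f p.2) := by fun_prop
  have hcm : ∀ {W : ℝ × EuclideanSpace ℝ (Fin s.card) → EuclideanSpace ℝ (Fin s.card)},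
      Continuous W → AEStronglyMeasurable (fun p : ℝ × H => combine f (W (p.1, coords f p.2))) M :=
    fun hW => ((combine f).continuous.comp (hW.comp hJ)).aestronglyMeasurable
  have hcR : ∀ {W : ℝ × EuclideanSpace ℝ (Fin s.card) → EuclideanSpace ℝ (Fin s.card)},
      (∀ z, ‖W z‖ ≤ R) → ∀ p : ℝ × H, ‖combine f (W (p.1, coords f p.2))‖ ≤ R := fun hW p => by
    rw [norm_combine hfo]
    exact hW _
  have hW₁R : ∀ k z, ‖ballCutoff (0 : ℝ × EuclideanSpace ℝ (Fin s.card)) k z • W₀ z‖ ≤ R := by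
    intro k z
    rw [norm_smul, Real.norm_of_nonneg (ballCutoff_nonneg _ _ _)]
    exact (mul_le_of_le_one_left (norm_nonneg _) (ballCutoff_le_one _ _ _)).trans (hW₀R z)
  have hW₁c : ∀ k, Continuous fun z =>
      ballCutoff (0 : ℝ × EuclideanSpace ℝ (Fin s.card)) k z • W₀ z := fun k =>
    (ballCutoff _ k).continuous.smul hW₀
  obtain ⟨k, hk⟩ := (eventually_integral_norm_sub_le (M := M) (l := atTop)
    (G := fun (k : ℕ) (p : ℝ × H) => combine f
      (ballCutoff (0 : ℝ × EuclideanSpace ℝ (Fin s.card)) k (p.1, coords f p.2)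
        • W₀ (p.1, coords f p.2)))
    (g := fun p => combine f (W₀ (p.1, coords f p.2))) (bound := fun _ => R)
    (fun k => hcm (hW₁c k)) (hcm hW₀) (integrable_const _) (fun k => hcR (hW₁R k)) (hcR hW₀R)
    (ae_of_all _ fun p => by
      refine tendsto_const_nhds.congr' ?_
      filter_upwards [ballCutoff_eventually_eq_one (0 : ℝ × EuclideanSpace ℝ (Fin s.card))
        (p.1, coords f p.2)] with k hk
      rw [hk, one_smul])
    (show 0 < ε / 4 by positivity)).exists
  obtain ⟨W, hWd, hWs, hWR, hWlim⟩ := exists_smooth_approx (hW₁c k)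
    (ballCutoff (0 : ℝ × EuclideanSpace ℝ (Fin s.card)) k).hasCompactSupport.smul_right (hW₁R k)
  obtain ⟨j, hj⟩ := (eventually_integral_norm_sub_le (M := M) (l := atTop)
    (G := fun (j : ℕ) (p : ℝ × H) => combine f (W j (p.1, coords f p.2)))
    (g := fun p => combine f
      (ballCutoff (0 : ℝ × EuclideanSpace ℝ (Fin s.card)) k (p.1, coords f p.2)
        • W₀ (p.1, coords f p.2))) (bound := fun _ => R)
    (fun j => hcm (hWd j).continuous) (hcm (hW₁c k)) (integrable_const _) (fun j => hcR (hWR j))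
    (hcR (hW₁R k))
    (ae_of_all _ fun p => ((combine f).continuous.tendsto _).comp (hWlim _))
    (show 0 < ε / 4 by positivity)).exists
  refine ⟨W j, hWd j, hWs j, ?_⟩
  have ib : ∀ {G : ℝ × H → H}, AEStronglyMeasurable G M → (∀ p, ‖G p‖ ≤ R) → Integrable G M :=
    fun hG hGR => Integrable.of_bound hG R (ae_of_all _ hGR)
  have i1 := ib (hcm (hWd j).continuous) (hcR (hWR j))
  have i2 := ib (hcm (hW₁c k)) (hcR (hW₁R k))
  have i3 := ib (hcm hW₀) (hcR hW₀R)
  have i4 := ib hθv.aestronglyMeasurable fun p => norm_truncate_le hR (v p)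
  refine (integral_norm_sub_le_add i1 i2 hvM hj (integral_norm_sub_le_add i2 i3 hvM hk
    (integral_norm_sub_le_add i3 i4 hvM hs hn))).trans_eq (by ring)

end CylindricalApproximation

end GenFlow

namespace GenFlow

open MeasureTheory Set Filter Topology ProbabilityTheory
open scoped NNReal ENNReal BoundedContinuousFunction

/-! ### Euler couplings and Euler chains -/

section EulerChain

variable {H : Type*} [NormedAddCommGroup H] [InnerProductSpace ℝ H] {m : ℕ}

/-- The field on `H` associated with a field acting on finitely many coordinates. -/
noncomputable def liftField (f : Fin m → H)
    (W : ℝ × EuclideanSpace ℝ (Fin m) → EuclideanSpace ℝ (Fin m)) (p : ℝ × H) : H :=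
  combine f (W (p.1, coords f p.2))

lemma continuous_liftField {f : Fin m → H}
    {W : ℝ × EuclideanSpace ℝ (Fin m) → EuclideanSpace ℝ (Fin m)} (hW : Continuous W) :
    Continuous (liftField f W) := by
  unfold liftField
  fun_prop

variable [CompleteSpace H] [TopologicalSpace.SeparableSpace H] [MeasurableSpace H] [BorelSpace H]
  {v : ℝ × H → H} {μ : ℝ → ProbabilityMeasure H} {a b : ℝ}

/-- One step of the chain: a coupling of the coordinate laws at times `s ≤ t` close to an Euler
step. -/
lemma exists_euler_coupling (hμ : Measurable fun t => (μ t : Measure H)) (hv : Measurable v)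
    (hfin : FiniteSpeed v (Ioo a b) μ) (hL : SolvesLiouville v (Ioo a b) μ)
    {f : Fin m → H} (hf : Orthonormal ℝ f)
    (hc : ∀ ψ : EuclideanSpace ℝ (Fin m) → ℝ, Continuous ψ → (∃ C, ∀ x, |ψ x| ≤ C) →
      Continuous fun t => ∫ u, ψ (coords f u) ∂(μ t : Measure H))
    {s t : ℝ} (has : a < s) (hst : s ≤ t) (htb : t < b)
    {W : ℝ × EuclideanSpace ℝ (Fin m) → EuclideanSpace ℝ (Fin m)} (hW : ContDiff ℝ ∞ W) {L : ℝ≥0}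
    (hWL : LipschitzWith L W) {B : ℝ} (hWB : ∀ y, ‖W y‖ ≤ B) :
    ∃ π : Measure (EuclideanSpace ℝ (Fin m) × EuclideanSpace ℝ (Fin m)),
      π.map Prod.fst = (μ s : Measure H).map (coords f) ∧
      π.map Prod.snd = (μ t : Measure H).map (coords f) ∧
      ∫⁻ p, ‖p.2 - p.1 - (t - s) • W (s, p.1)‖ₑ ∂π ≤ ENNReal.ofReal
        (∫ p in {p : ℝ × H | p.1 ∈ Ioc s t}, (‖liftField f W p - v p‖
          + (t - s) * L * (1 + ‖v p‖)) ∂spaceTime μ hμ a b) := by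
  have hJ : Measurable (coords f) := (coords f).measurable
  have hvi := integrable_spaceTime hμ hv hfin
  have p1 : IsProbabilityMeasure ((μ s : Measure H).map (coords f)) :=
    Measure.isProbabilityMeasure_map hJ.aemeasurable
  have p2 : IsProbabilityMeasure ((μ t : Measure H).map (coords f)) :=
    Measure.isProbabilityMeasure_map hJ.aemeasurable
  have hws : ContDiff ℝ ∞ fun y => W (s, y) := hW.comp (contDiff_prodMk_right s)
  have hwL : LipschitzWith L fun y => W (s, y) := by
    have := hWL.comp (LipschitzWith.prodMk_left (β := EuclideanSpace ℝ (Fin m)) s)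
    rw [mul_one] at this
    exact this
  have hWm : AEStronglyMeasurable (fun p : ℝ × H => W (s, coords f p.2)) (spaceTime μ hμ a b) :=
    (hws.continuous.measurable.comp (hJ.comp measurable_snd)).aestronglyMeasurable
  have hlm : Integrable (liftField f W) (spaceTime μ hμ a b) :=
    Integrable.of_bound (continuous_liftField hW.continuous).aestronglyMeasurable B
      (ae_of_all _ fun p => (norm_combine hf _).trans_le (hWB _))
  have hms : MeasurableSet {p : ℝ × H | p.1 ∈ Ioc s t} := measurable_fst measurableSet_Ioc
  -- Replacing the frozen time `s` by the running time in `W` costs at most `(t - s) * L`, which is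
  -- the source of the `1` in `1 + ‖v p‖`.
  have hle : ∫ p in {p : ℝ × H | p.1 ∈ Ioc s t}, (‖coords f (v p) - W (s, coords f p.2)‖
          + (t - s) * L * ‖v p‖) ∂spaceTime μ hμ a b
      ≤ ∫ p in {p : ℝ × H | p.1 ∈ Ioc s t}, (‖liftField f W p - v p‖
          + (t - s) * L * (1 + ‖v p‖)) ∂spaceTime μ hμ a b := by
    refine setIntegral_mono_on (Integrable.integrableOn ?_) (Integrable.integrableOn ?_) hms
      fun p hp => ?_
    · exact (((coords f).integrable_comp hvi).sub (Integrable.of_bound hWm B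
        (ae_of_all _ fun p => hWB _))).norm.add (hvi.norm.const_mul _)
    · exact (hlm.sub hvi).norm.add (((integrable_const 1).add hvi.norm).const_mul _)
    · have h1 : ‖coords f (v p) - W (p.1, coords f p.2)‖ ≤ ‖liftField f W p - v p‖ := by
        rw [norm_sub_rev (liftField f W p)]
        have := norm_coords_le hf (v p - liftField f W p)
        rwa [map_sub, liftField, coords_combine hf] at this
      have h2 : ‖W (p.1, coords f p.2) - W (s, coords f p.2)‖ ≤ (t - s) * L := by
        rw [← dist_eq_norm, mul_comm]
        refine (hWL.dist_le_mul _ _).trans (mul_le_mul_of_nonneg_left ?_ L.coe_nonneg)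
        rw [dist_prod_same_right, Real.dist_eq]
        exact abs_le.2 ⟨by linarith [hp.1], by linarith [hp.2]⟩
      have h3 := norm_sub_le_norm_sub_add_norm_sub (coords f (v p)) (W (p.1, coords f p.2))
        (W (s, coords f p.2))
      linarith
  have hT : Continuous fun y => y + (t - s) • W (s, y) := by
    have := hws.continuous
    fun_prop
  obtain ⟨π, h1, h2, h3⟩ := exists_coupling_of_lipschitz_dual ((μ s : Measure H).map (coords f))
    ((μ t : Measure H).map (coords f)) hT
    (δ := ∫ p in {p : ℝ × H | p.1 ∈ Ioc s t}, (‖liftField f W p - v p‖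
          + (t - s) * L * (1 + ‖v p‖)) ∂spaceTime μ hμ a b) fun K k hk ⟨C, hC⟩ => by
      rw [integral_map hJ.aemeasurable hk.continuous.aestronglyMeasurable,
        integral_map (f := fun x => k (x + (t - s) • W (s, x))) hJ.aemeasurable
          (hk.continuous.comp hT).aestronglyMeasurable]
      exact (liouville_step hμ hv hfin hL hf hc has hst htb hws hwL (fun y => hWB _) hk hC).trans
        (mul_le_mul_of_nonneg_left hle K.coe_nonneg)
  refine ⟨π, h1, h2, le_trans (lintegral_mono fun p => ?_) h3⟩
  rw [edist_eq_enorm_sub, sub_sub]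

/-- The `k`-th point of the uniform grid with mesh `h` starting at `c`. -/
def gridPoint (c h : ℝ) (k : ℕ) : ℝ := c + k * h

lemma gridPoint_succ (c h : ℝ) (k : ℕ) : gridPoint c h (k + 1) = gridPoint c h k + h := by
  simp [gridPoint]
  ring

lemma monotone_gridPoint (c : ℝ) {h : ℝ} (hh : 0 ≤ h) : Monotone (gridPoint c h) :=
  monotone_nat_of_le_succ fun k => by rw [gridPoint_succ]; linarith

/-- A Markov chain on a time grid whose marginals are the coordinate laws of `μ` and whose steps are
Euler steps up to a small error. -/
theorem exists_euler_chain (hμ : Measurable fun t => (μ t : Measure H)) (hv : Measurable v)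
    (hfin : FiniteSpeed v (Ioo a b) μ) (hL : SolvesLiouville v (Ioo a b) μ)
    {f : Fin m → H} (hf : Orthonormal ℝ f)
    (hc : ∀ ψ : EuclideanSpace ℝ (Fin m) → ℝ, Continuous ψ → (∃ C, ∀ x, |ψ x| ≤ C) →
      Continuous fun t => ∫ u, ψ (coords f u) ∂(μ t : Measure H))
    {c h : ℝ} (hh : 0 ≤ h) {N : ℕ} (hac : a < c) (hNb : gridPoint c h N < b) (hN : 0 < N)
    {W : ℝ × EuclideanSpace ℝ (Fin m) → EuclideanSpace ℝ (Fin m)} (hW : ContDiff ℝ ∞ W) {L : ℝ≥0}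
    (hWL : LipschitzWith L W) {B : ℝ} (hWB : ∀ y, ‖W y‖ ≤ B) :
    ∃ P : Measure (ℕ → EuclideanSpace ℝ (Fin m)), IsProbabilityMeasure P ∧
      (∀ k ≤ N, P.map (fun y => y k) = (μ (gridPoint c h k) : Measure H).map (coords f)) ∧
      ∫⁻ y, ∑ k ∈ Finset.range N, ‖y (k + 1) - y k - h • W (gridPoint c h k, y k)‖ₑ ∂P
        ≤ ENNReal.ofReal (∫ p, ‖liftField f W p - v p‖ ∂spaceTime μ hμ a b
          + h * (L * ∫ p, (1 + ‖v p‖) ∂spaceTime μ hμ a b)) := by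
  have hJ : Measurable (coords f) := (coords f).measurable
  have hpr : ∀ t, IsProbabilityMeasure ((μ t : Measure H).map (coords f)) := fun t =>
    Measure.isProbabilityMeasure_map hJ.aemeasurable
  have hmon := monotone_gridPoint c hh
  have hgc : ∀ k, c ≤ gridPoint c h k := fun k => by
    have := hmon (Nat.zero_le k)
    simpa [gridPoint] using this
  set F : ℝ × H → ℝ := fun p => ‖liftField f W p - v p‖ + h * L * (1 + ‖v p‖) with hF
  have key : ∀ k, ∃ π : Measure (EuclideanSpace ℝ (Fin m) × EuclideanSpace ℝ (Fin m)),
      IsProbabilityMeasure π ∧ (k < N →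
      π.map Prod.fst = (μ (gridPoint c h k) : Measure H).map (coords f) ∧
      π.map Prod.snd = (μ (gridPoint c h (k + 1)) : Measure H).map (coords f) ∧
      ∫⁻ p, ‖p.2 - p.1 - h • W (gridPoint c h k, p.1)‖ₑ ∂π ≤ ENNReal.ofReal
        (∫ p in {p : ℝ × H | p.1 ∈ Ioc (gridPoint c h k) (gridPoint c h (k + 1))}, F p
          ∂spaceTime μ hμ a b)) := by
    intro k
    by_cases hk : k < N
    · obtain ⟨π, h1, h2, h3⟩ := exists_euler_coupling hμ hv hfin hL hf hc
        (hac.trans_le (hgc k)) (hmon (Nat.le_succ k))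
        ((hmon (Nat.succ_le_of_lt hk)).trans_lt hNb) hW hWL hWB
      rw [Nat.succ_eq_add_one, gridPoint_succ, add_sub_cancel_left] at h3
      refine ⟨π, ?_, fun _ => ⟨h1, h2, by rwa [gridPoint_succ]⟩⟩
      have : IsProbabilityMeasure (π.map Prod.fst) := h1 ▸ hpr _
      exact (Measure.isProbabilityMeasure_map_iff measurable_fst.aemeasurable).1 this
    · exact ⟨Measure.dirac 0, inferInstance, fun h => (hk h).elim⟩
  choose π hπ hπk using key
  obtain ⟨P, hP, hPk⟩ := exists_chain π N fun k hk => by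
    rw [(hπk k (by omega)).2.1, (hπk (k + 1) hk).1]
  refine ⟨P, hP, fun k hk => ?_, ?_⟩
  · rcases hk.lt_or_eq with hk | rfl
    · rw [← (hπk k hk).1, ← hPk k hk, Measure.map_map measurable_fst (by fun_prop)]
      rfl
    -- The law at the last grid time is only available as the second marginal of the last step.
    · obtain ⟨k, rfl⟩ := Nat.exists_eq_succ_of_ne_zero hN.ne'
      rw [← (hπk k (Nat.lt_succ_self k)).2.1, ← hPk k (Nat.lt_succ_self k),
        Measure.map_map measurable_snd (by fun_prop)]
      rfl
  · have hWc := hW.continuous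
    have hvi := integrable_spaceTime hμ hv hfin
    have hlm : Integrable (liftField f W) (spaceTime μ hμ a b) :=
      Integrable.of_bound (continuous_liftField hW.continuous).aestronglyMeasurable B
        (ae_of_all _ fun p => (norm_combine hf _).trans_le (hWB _))
    have i1 : Integrable (fun p => ‖liftField f W p - v p‖) (spaceTime μ hμ a b) :=
      (hlm.sub hvi).norm
    have i2 : Integrable (fun p => 1 + ‖v p‖) (spaceTime μ hμ a b) :=
      (integrable_const 1).add hvi.norm
    have hFi : Integrable F (spaceTime μ hμ a b) := i1.add (i2.const_mul _)
    have hF0 : ∀ p, 0 ≤ F p := fun p => by positivity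
    have hm : ∀ k, Measurable fun q : EuclideanSpace ℝ (Fin m) × EuclideanSpace ℝ (Fin m) =>
        ‖q.2 - q.1 - h • W (gridPoint c h k, q.1)‖ₑ := fun k =>
      Continuous.measurable (by fun_prop)
    have hms : ∀ k, MeasurableSet
        {p : ℝ × H | p.1 ∈ Ioc (gridPoint c h k) (gridPoint c h (k + 1))} := fun k =>
      measurable_fst measurableSet_Ioc
    have hmy : ∀ k, Measurable fun y : ℕ → EuclideanSpace ℝ (Fin m) =>
        ‖y (k + 1) - y k - h • W (gridPoint c h k, y k)‖ₑ := fun k =>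
      Continuous.measurable (by fun_prop)
    rw [lintegral_finsetSum _ fun k _ => hmy k]
    calc ∑ k ∈ Finset.range N, ∫⁻ y, ‖y (k + 1) - y k - h • W (gridPoint c h k, y k)‖ₑ ∂P
        ≤ ∑ k ∈ Finset.range N, ENNReal.ofReal
          (∫ p in {p : ℝ × H | p.1 ∈ Ioc (gridPoint c h k) (gridPoint c h (k + 1))}, F p
            ∂spaceTime μ hμ a b) := by
          refine Finset.sum_le_sum fun k hk => ?_
          have hk := Finset.mem_range.1 hk
          refine le_trans (le_of_eq ?_) (hπk k hk).2.2
          rw [← hPk k hk, lintegral_map (hm k) (by fun_prop)]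
      _ = ENNReal.ofReal (∑ k ∈ Finset.range N,
          ∫ p in {p : ℝ × H | p.1 ∈ Ioc (gridPoint c h k) (gridPoint c h (k + 1))}, F p
            ∂spaceTime μ hμ a b) :=
          (ENNReal.ofReal_sum_of_nonneg fun k _ => integral_nonneg fun p => hF0 p).symm
      _ ≤ ENNReal.ofReal (∫ p, F p ∂spaceTime μ hμ a b) := by
          refine ENNReal.ofReal_le_ofReal ?_
          -- The half-open time slabs are disjoint, so the one-step errors add up to at most one
          -- space-time integral, whatever the number of steps.
          rw [← integral_biUnion_finset _ (fun k _ => hms k) (fun i _ j _ hij => ?_)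
            fun k _ => hFi.integrableOn]
          · exact setIntegral_le_integral hFi (ae_of_all _ hF0)
          · have := hmon.pairwise_disjoint_on_Ioc_succ hij
            exact this.preimage Prod.fst
      _ = _ := by
          congr 1
          rw [hF, integral_add i1 (i2.const_mul _), integral_const_mul, mul_assoc]

end EulerChain

end GenFlow

namespace GenFlow

open MeasureTheory Set Filter Topology ProbabilityTheory
open scoped NNReal ENNReal BoundedContinuousFunction

/-! ### Piecewise linear interpolation on a grid -/

section Interpolation

variable {a h : ℝ}

/-- The point of the `k`-th grid interval closest to `t`. -/
def gridClamp (a h : ℝ) (k : ℕ) (t : ℝ) : ℝ :=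
  min (max t (gridPoint a h k)) (gridPoint a h (k + 1))

lemma continuous_gridClamp (a h : ℝ) (k : ℕ) : Continuous (gridClamp a h k) := by
  unfold gridClamp
  fun_prop

lemma gridPoint_le_succ (hh : 0 ≤ h) (k : ℕ) : gridPoint a h k ≤ gridPoint a h (k + 1) :=
  monotone_gridPoint a hh (Nat.le_succ k)

lemma gridPoint_zero (a h : ℝ) : gridPoint a h 0 = a := by simp [gridPoint]

lemma le_gridPoint (hh : 0 ≤ h) (k : ℕ) : a ≤ gridPoint a h k := by
  have := monotone_gridPoint a hh (Nat.zero_le k)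
  rwa [gridPoint_zero] at this

lemma gridPoint_le_gridClamp (hh : 0 ≤ h) (k : ℕ) (t : ℝ) :
    gridPoint a h k ≤ gridClamp a h k t :=
  le_min (le_max_right _ _) (gridPoint_le_succ hh k)

lemma gridClamp_le (k : ℕ) (t : ℝ) : gridClamp a h k t ≤ gridPoint a h (k + 1) :=
  min_le_right _ _

lemma gridClamp_of_le (hh : 0 ≤ h) {k : ℕ} {t : ℝ} (ht : t ≤ gridPoint a h k) :
    gridClamp a h k t = gridPoint a h k := by
  rw [gridClamp, max_eq_right ht, min_eq_left (gridPoint_le_succ hh k)]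

lemma gridClamp_of_ge {k : ℕ} {t : ℝ} (ht : gridPoint a h (k + 1) ≤ t) :
    gridClamp a h k t = gridPoint a h (k + 1) :=
  min_eq_right (ht.trans (le_max_left _ _))

lemma gridClamp_of_mem {k : ℕ} {t : ℝ} (ht : t ∈ Icc (gridPoint a h k) (gridPoint a h (k + 1))) :
    gridClamp a h k t = t := by
  rw [gridClamp, max_eq_left ht.1, min_eq_left ht.2]

/-- Increments of a function up to time `t` telescope over the grid. -/
lemma sum_gridClamp_sub {G : Type*} [AddCommGroup G] (hh : 0 ≤ h) (F : ℝ → G) {t : ℝ} (ht : a ≤ t)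
    (n : ℕ) : ∑ k ∈ Finset.range n, (F (gridClamp a h k t) - F (gridPoint a h k))
      = F (min t (gridPoint a h n)) - F a := by
  induction n with
  | zero => simp [gridPoint_zero, ht]
  | succ n ih =>
    rw [Finset.sum_range_succ, ih]
    rcases le_or_gt t (gridPoint a h n) with h1 | h1
    · rw [gridClamp_of_le hh h1, min_eq_left h1, min_eq_left (h1.trans (gridPoint_le_succ hh n))]
      abel
    · rw [min_eq_right h1.le, gridClamp, max_eq_left h1.le]
      abel

variable {H : Type*} [NormedAddCommGroup H] [NormedSpace ℝ H]

/-- Piecewise linear interpolation of the values `z 0, …, z N` at the grid points. -/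
noncomputable def interpolate (a h : ℝ) (N : ℕ) (z : ℕ → H) (t : ℝ) : H :=
  z 0 + ∑ k ∈ Finset.range N, ((gridClamp a h k t - gridPoint a h k) / h) • (z (k + 1) - z k)

lemma continuous_interpolate_uncurry (a h : ℝ) (N : ℕ) :
    Continuous fun p : (ℕ → H) × ℝ => interpolate a h N p.1 p.2 := by
  unfold interpolate
  have := continuous_gridClamp a h
  fun_prop

lemma interpolate_left (hh : 0 ≤ h) (N : ℕ) (z : ℕ → H) : interpolate a h N z a = z 0 := by
  simp [interpolate, gridClamp_of_le hh (le_gridPoint hh _)]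

/-- In the sum of clamped increments, intervals before the `k`-th have weight one and telescope, and
later ones have weight zero. -/
lemma interpolate_of_mem (hh : 0 < h) {N k : ℕ} (hk : k < N) (z : ℕ → H) {t : ℝ}
    (ht : t ∈ Icc (gridPoint a h k) (gridPoint a h (k + 1))) :
    interpolate a h N z t = z k + ((t - gridPoint a h k) / h) • (z (k + 1) - z k) := by
  have key : ∀ n, k + 1 ≤ n → ∑ l ∈ Finset.range n,
      ((gridClamp a h l t - gridPoint a h l) / h) • (z (l + 1) - z l)
      = z k - z 0 + ((t - gridPoint a h k) / h) • (z (k + 1) - z k) := by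
    intro n hn
    induction n, hn using Nat.le_induction with
    | base =>
      rw [Finset.sum_range_succ, gridClamp_of_mem ht, ← Finset.sum_range_sub]
      congr 1
      refine Finset.sum_congr rfl fun l hl => ?_
      have hl : l + 1 ≤ k := Finset.mem_range.1 hl
      rw [gridClamp_of_ge ((monotone_gridPoint a hh.le hl).trans ht.1), gridPoint_succ,
        add_sub_cancel_left, div_self hh.ne', one_smul]
    | succ n hn ih =>
      rw [Finset.sum_range_succ, ih,
        gridClamp_of_le hh.le (ht.2.trans (monotone_gridPoint a hh.le hn))]
      simp
  rw [interpolate, key N hk]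
  abel

lemma norm_interpolate_sub_le (hh : 0 < h) {N k : ℕ} (hk : k < N) (z : ℕ → H) {t : ℝ}
    (ht : t ∈ Icc (gridPoint a h k) (gridPoint a h (k + 1))) :
    ‖interpolate a h N z t - z k‖ ≤ ‖z (k + 1) - z k‖ := by
  rw [interpolate_of_mem hh hk z ht, add_sub_cancel_left, norm_smul, Real.norm_eq_abs]
  refine mul_le_of_le_one_left (norm_nonneg _) ?_
  have h1 := ht.1
  have h2 := ht.2
  rw [gridPoint_succ] at h2
  rw [abs_of_nonneg (div_nonneg (by linarith) hh.le), div_le_one hh]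
  linarith

lemma exists_mem_grid {N : ℕ} (hN : 0 < N) {t : ℝ}
    (ht : t ∈ Icc a (gridPoint a h N)) :
    ∃ k < N, t ∈ Icc (gridPoint a h k) (gridPoint a h (k + 1)) := by
  induction N with
  | zero => omega
  | succ N ih =>
    rcases le_or_gt (gridPoint a h N) t with h1 | h1
    · exact ⟨N, Nat.lt_succ_self N, h1, ht.2⟩
    · rcases Nat.eq_zero_or_pos N with rfl | hN'
      · rw [gridPoint_zero] at h1
        exact (not_lt.2 ht.1 h1).elim
      · obtain ⟨k, hk, hkt⟩ := ih hN' ⟨ht.1, h1.le⟩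
        exact ⟨k, hk.trans (Nat.lt_succ_self N), hkt⟩

end Interpolation

/-! ### The defect in the integrated equation -/

section Residual

variable {H : Type*} [NormedAddCommGroup H] {a b : ℝ}

/-- The value at an arbitrary time of a path defined on `[a, b]`, extended by constants. -/
noncomputable def evalAt (hab : a ≤ b) (γ : C(Icc a b, H)) (r : ℝ) : H := γ (projIcc a b hab r)

lemma continuous_evalAt_uncurry (hab : a ≤ b) :
    Continuous fun p : C(Icc a b, H) × ℝ => evalAt hab p.1 p.2 := by
  unfold evalAt
  have : Continuous (projIcc a b hab) := continuous_projIcc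
  fun_prop

lemma continuous_evalAt (hab : a ≤ b) (γ : C(Icc a b, H)) : Continuous (evalAt hab γ) :=
  (continuous_evalAt_uncurry hab).comp (continuous_const.prodMk continuous_id)

lemma continuous_evalAt_left (hab : a ≤ b) (r : ℝ) :
    Continuous fun γ : C(Icc a b, H) => evalAt hab γ r :=
  (continuous_evalAt_uncurry hab).comp (continuous_id.prodMk continuous_const)

lemma evalAt_of_mem (hab : a ≤ b) (γ : C(Icc a b, H)) {r : ℝ} (hr : r ∈ Icc a b) :
    evalAt hab γ r = γ ⟨r, hr⟩ := by
  rw [evalAt, projIcc_of_mem hab hr]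

variable [NormedSpace ℝ H]

/-- The defect of a path in the integrated equation `γ t = γ a + ∫ w (r, γ r) dr`. -/
noncomputable def residual (hab : a ≤ b) {w : ℝ × H → H} (hw : Continuous w) (γ : C(Icc a b, H)) :
    C(Icc a b, H) where
  toFun t := γ t - evalAt hab γ a - ∫ r in a..t, w (r, evalAt hab γ r)
  continuous_toFun := by
    have h1 : Continuous fun r => w (r, evalAt hab γ r) :=
      hw.comp (continuous_id.prodMk (continuous_evalAt hab γ))
    have h2 := intervalIntegral.continuous_primitive (μ := volume)
      (fun c d => h1.intervalIntegrable c d) a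
    have := h2.comp (continuous_subtype_val (p := fun r => r ∈ Icc a b))
    exact (γ.continuous.sub continuous_const).sub this

lemma residual_apply (hab : a ≤ b) {w : ℝ × H → H} (hw : Continuous w) (γ : C(Icc a b, H))
    (t : Icc a b) :
    residual hab hw γ t = γ t - evalAt hab γ a - ∫ r in a..t, w (r, evalAt hab γ r) := rfl

lemma continuous_residual (hab : a ≤ b) {w : ℝ × H → H} (hw : Continuous w) :
    Continuous (residual hab hw) := by
  refine ContinuousMap.continuous_of_continuous_uncurry _ ?_
  have h1 : Continuous fun p : C(Icc a b, H) × Icc a b => p.1 p.2 := by fun_prop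
  have h2 : Continuous fun p : C(Icc a b, H) × Icc a b => evalAt hab p.1 a :=
    (continuous_evalAt_left hab a).comp continuous_fst
  have h3 : Continuous (Function.uncurry fun (p : C(Icc a b, H) × Icc a b) (r : ℝ) =>
      w (r, evalAt hab p.1 r)) :=
    hw.comp (continuous_snd.prodMk ((continuous_evalAt_uncurry hab).comp
      ((continuous_fst.comp continuous_fst).prodMk continuous_snd)))
  exact (h1.sub h2).sub (intervalIntegral.continuous_parametric_intervalIntegral_of_continuous h3
    (continuous_subtype_val.comp continuous_snd))

/-- Piecewise linear interpolation as a continuous path. -/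
noncomputable def interpolatePath (a b h : ℝ) (N : ℕ) (z : ℕ → H) : C(Icc a b, H) where
  toFun t := interpolate a h N z t
  continuous_toFun := (continuous_interpolate_uncurry a h N).comp
    (continuous_const.prodMk continuous_subtype_val)

lemma continuous_interpolatePath (a b h : ℝ) (N : ℕ) :
    Continuous (interpolatePath a b h N : (ℕ → H) → C(Icc a b, H)) :=
  ContinuousMap.continuous_of_continuous_uncurry _
    ((continuous_interpolate_uncurry a h N).comp
      (continuous_fst.prodMk (continuous_subtype_val.comp continuous_snd)))

lemma evalAt_interpolatePath (hab : a ≤ b) (h : ℝ) (N : ℕ) (z : ℕ → H) {r : ℝ} (hr : r ∈ Icc a b) :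
    evalAt hab (interpolatePath a b h N z) r = interpolate a h N z r := by
  rw [evalAt_of_mem hab _ hr]
  rfl

/-- Interpolations of approximate Euler schemes almost solve the integrated equation. -/
theorem norm_residual_interpolatePath_le [CompleteSpace H] {h : ℝ} (hh : 0 < h) {N : ℕ}
    (hN : gridPoint a h N = b) (hab : a ≤ b) {w : ℝ × H → H} {L : ℝ≥0} (hw : LipschitzWith L w)
    (z q : ℕ → H) {B : ℝ} (hq : ∀ k, ‖q k‖ ≤ B) :
    ‖residual hab hw.continuous (interpolatePath a b h N z)‖
      ≤ (1 + L * h) * ∑ k ∈ Finset.range N, ‖z (k + 1) - z k - h • q k‖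
        + ∑ k ∈ Finset.range N, h * ‖q k - w (gridPoint a h k, z k)‖
        + L * (b - a) * (h * (1 + B)) := by
  have hB : 0 ≤ B := (norm_nonneg _).trans (hq 0)
  have hba : 0 ≤ b - a := sub_nonneg.2 hab
  have hmon := monotone_gridPoint a hh.le
  set γ := interpolatePath a b h N z with hγ
  have hcont : Continuous fun r => w (r, evalAt hab γ r) :=
    hw.continuous.comp (continuous_id.prodMk (continuous_evalAt hab γ))
  have hii := fun c d => hcont.intervalIntegrable (μ := volume) c d
  refine (ContinuousMap.norm_le _ (by positivity)).2 fun t => ?_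
  -- Interpolation and primitive both telescope over the grid clamped at `t`, so the defect is
  -- estimated interval by interval. Here `q k` is the velocity that drives the scheme, while `w`
  -- may be a different field.
  have hres : residual hab hw.continuous γ t = ∑ k ∈ Finset.range N,
      (((gridClamp a h k t - gridPoint a h k) / h) • (z (k + 1) - z k)
        - ∫ r in gridPoint a h k..gridClamp a h k t, w (r, evalAt hab γ r)) := by
    have h1 := sum_gridClamp_sub hh.le (fun x => ∫ r in a..x, w (r, evalAt hab γ r)) t.2.1 N
    simp only [intervalIntegral.integral_interval_sub_left (hii _ _) (hii _ _), hN,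
      min_eq_left t.2.2, intervalIntegral.integral_same, sub_zero] at h1
    rw [Finset.sum_sub_distrib, h1, residual_apply,
      evalAt_interpolatePath hab h N z (left_mem_Icc.2 hab), interpolate_left hh.le]
    change interpolate a h N z t - z 0 - _ = _
    rw [interpolate, add_sub_cancel_left]
  have hterm : ∀ k ∈ Finset.range N,
      ‖((gridClamp a h k t - gridPoint a h k) / h) • (z (k + 1) - z k)
        - ∫ r in gridPoint a h k..gridClamp a h k t, w (r, evalAt hab γ r)‖
      ≤ (1 + L * h) * ‖z (k + 1) - z k - h • q k‖ + h * ‖q k - w (gridPoint a h k, z k)‖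
        + h * L * (h * (1 + B)) := by
    intro k hk
    have hk := Finset.mem_range.1 hk
    set s := gridClamp a h k t with hs
    have hs1 : gridPoint a h k ≤ s := gridPoint_le_gridClamp hh.le k t
    have hs2 : s ≤ gridPoint a h (k + 1) := gridClamp_le k t
    have hs3 : s - gridPoint a h k ≤ h := by
      rw [gridPoint_succ] at hs2
      linarith
    have e : ((s - gridPoint a h k) / h) • (z (k + 1) - z k)
        - ∫ r in gridPoint a h k..s, w (r, evalAt hab γ r)
        = ((s - gridPoint a h k) / h) • (z (k + 1) - z k - h • q k)
          + ∫ r in gridPoint a h k..s, (q k - w (r, evalAt hab γ r)) := by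
      rw [intervalIntegral.integral_sub (intervalIntegrable_const) (hii _ _),
        intervalIntegral.integral_const, smul_sub _ (z (k + 1) - z k), smul_smul,
        div_mul_cancel₀ _ hh.ne']
      abel
    -- The path moves by the step error plus `h * B` on one interval. Through the Lipschitz constant
    -- of `w` this produces the extra factor `L * h` and the term with `1 + B`.
    have hd : ‖z (k + 1) - z k‖ ≤ ‖z (k + 1) - z k - h • q k‖ + h * B := by
      have h1 := norm_add_le (z (k + 1) - z k - h • q k) (h • q k)
      rw [sub_add_cancel, norm_smul, Real.norm_of_nonneg hh.le] at h1
      have h2 := mul_le_mul_of_nonneg_left (hq k) hh.le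
      linarith
    have h1 : ‖((s - gridPoint a h k) / h) • (z (k + 1) - z k - h • q k)‖
        ≤ ‖z (k + 1) - z k - h • q k‖ := by
      rw [norm_smul, Real.norm_of_nonneg (div_nonneg (sub_nonneg.2 hs1) hh.le)]
      exact mul_le_of_le_one_left (norm_nonneg _) ((div_le_one hh).2 hs3)
    have h2 : ‖∫ r in gridPoint a h k..s, (q k - w (r, evalAt hab γ r))‖
        ≤ (‖q k - w (gridPoint a h k, z k)‖ + L * (h + ‖z (k + 1) - z k‖))
          * |s - gridPoint a h k| := by
      refine intervalIntegral.norm_integral_le_of_norm_le_const fun r hr => ?_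
      rw [uIoc_of_le hs1] at hr
      have hr' : r ∈ Icc (gridPoint a h k) (gridPoint a h (k + 1)) := ⟨hr.1.le, hr.2.trans hs2⟩
      have hrab : r ∈ Icc a b := ⟨(le_gridPoint hh.le k).trans hr'.1,
        hr'.2.trans ((hmon (Nat.succ_le_of_lt hk)).trans_eq hN)⟩
      refine (norm_sub_le_norm_sub_add_norm_sub _ (w (gridPoint a h k, z k)) _).trans
        (add_le_add_right ?_ _)
      rw [← dist_eq_norm]
      refine (hw.dist_le_mul _ _).trans (mul_le_mul_of_nonneg_left ?_ L.coe_nonneg)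
      rw [Prod.dist_eq]
      refine max_le ?_ ?_
      · rw [Real.dist_eq, abs_sub_comm, abs_of_nonneg (sub_nonneg.2 hr'.1)]
        have := hr'.2
        rw [gridPoint_succ] at this
        have := norm_nonneg (z (k + 1) - z k)
        linarith
      · rw [dist_comm, dist_eq_norm, evalAt_interpolatePath hab h N z hrab]
        have := norm_interpolate_sub_le hh hk z hr'
        linarith
    rw [e]
    refine (norm_add_le _ _).trans ((add_le_add h1 h2).trans ?_)
    rw [abs_of_nonneg (sub_nonneg.2 hs1)]
    have h3 : (‖q k - w (gridPoint a h k, z k)‖ + L * (h + ‖z (k + 1) - z k‖))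
          * (s - gridPoint a h k) ≤ (‖q k - w (gridPoint a h k, z k)‖
            + L * (h + (‖z (k + 1) - z k - h • q k‖ + h * B))) * h := by
      gcongr
    linarith
  rw [hres]
  refine (norm_sum_le _ _).trans ((Finset.sum_le_sum hterm).trans_eq ?_)
  rw [Finset.sum_add_distrib, Finset.sum_add_distrib, ← Finset.mul_sum, Finset.sum_const,
    Finset.card_range, nsmul_eq_mul]
  have : (N : ℝ) * h = b - a := by
    rw [← hN, gridPoint]
    ring
  rw [← this]
  ring

end Residual

end GenFlow

namespace GenFlow

open MeasureTheory Set Filter Topology ProbabilityTheory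
open scoped NNReal ENNReal BoundedContinuousFunction

/-! ### Riemann sums -/

section RiemannSum

lemma gridPoint_div {a b : ℝ} {N : ℕ} (hN : 0 < N) : gridPoint a ((b - a) / N) N = b := by
  have : (N : ℝ) ≠ 0 := by positivity
  rw [gridPoint]
  field_simp
  ring

/-- Riemann sums of a continuous function are eventually close to its integral. -/
lemma eventually_riemann_sum_le {F : ℝ → ℝ} (hF : Continuous F) {a b : ℝ} (hab : a < b) {ε : ℝ}
    (hε : 0 < ε) : ∀ᶠ N : ℕ in atTop, ∑ k ∈ Finset.range N,
      (b - a) / N * F (gridPoint a ((b - a) / N) k) ≤ (∫ t in a..b, F t) + ε := by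
  have hba : 0 < b - a := sub_pos.2 hab
  -- For mesh below `δ` the left grid value exceeds `F t` by at most `ε / (b - a)`, which integrates
  -- to `ε`.
  obtain ⟨δ, hδ, hδF⟩ := Metric.uniformContinuousOn_iff.1
    (isCompact_Icc.uniformContinuousOn_of_continuous (s := Icc a b) hF.continuousOn)
    (ε / (b - a)) (by positivity)
  have h0 : Tendsto (fun N : ℕ => (b - a) / N) atTop (𝓝 0) :=
    tendsto_const_div_atTop_nhds_zero_nat _
  filter_upwards [h0.eventually (gt_mem_nhds hδ), eventually_gt_atTop 0] with N hN hN0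
  have hNr : (0 : ℝ) < N := by positivity
  set h := (b - a) / N with hh
  have hh0 : 0 < h := by positivity
  have hgN : gridPoint a h N = b := gridPoint_div hN0
  have hint : ∀ c d, IntervalIntegrable (fun t => F t + ε / (b - a)) volume c d := fun c d =>
    (hF.add continuous_const).intervalIntegrable c d
  have h1 : ∀ k ∈ Finset.range N, h * F (gridPoint a h k)
      ≤ ∫ t in gridPoint a h k..gridPoint a h (k + 1), (F t + ε / (b - a)) := by
    intro k hk
    have hk : k + 1 ≤ N := Finset.mem_range.1 hk
    have hb : gridPoint a h (k + 1) ≤ b := (monotone_gridPoint a hh0.le hk).trans_eq hgN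
    have e : h * F (gridPoint a h k)
        = ∫ t in gridPoint a h k..gridPoint a h (k + 1), F (gridPoint a h k) := by
      rw [intervalIntegral.integral_const, gridPoint_succ, add_sub_cancel_left, smul_eq_mul]
    rw [e]
    refine intervalIntegral.integral_mono_on (gridPoint_le_succ hh0.le k)
      intervalIntegrable_const (hint _ _) fun t ht => ?_
    have hl := le_gridPoint (a := a) hh0.le k
    have hd := hδF (gridPoint a h k) ⟨hl, (gridPoint_le_succ hh0.le k).trans hb⟩ t
      ⟨hl.trans ht.1, ht.2.trans hb⟩ (by
        rw [Real.dist_eq, abs_sub_comm, abs_of_nonneg (sub_nonneg.2 ht.1)]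
        have := ht.2
        rw [gridPoint_succ] at this
        linarith)
    rw [Real.dist_eq] at hd
    linarith [(abs_lt.1 hd).2]
  refine (Finset.sum_le_sum h1).trans_eq ?_
  rw [intervalIntegral.sum_integral_adjacent_intervals fun k _ => hint _ _, gridPoint_zero, hgN,
    intervalIntegral.integral_add (hF.intervalIntegrable _ _) intervalIntegrable_const,
    intervalIntegral.integral_const, smul_eq_mul, mul_div_cancel₀ _ hba.ne']

end RiemannSum

/-! ### Laws of interpolated Euler chains -/

section PathMeasure

variable {H : Type*} [NormedAddCommGroup H] [InnerProductSpace ℝ H] [CompleteSpace H]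
  [TopologicalSpace.SeparableSpace H] [MeasurableSpace H] [BorelSpace H]
  {v : ℝ × H → H} {μ : ℝ → ProbabilityMeasure H} {a' b' a b : ℝ} {m : ℕ}
  [MeasurableSpace C(Icc a b, H)] [BorelSpace C(Icc a b, H)]

/-- Laws of interpolated Euler chains, with explicit error bounds. -/
theorem exists_euler_path_measure (hμ : Measurable fun t => (μ t : Measure H)) (hv : Measurable v)
    (hfin : FiniteSpeed v (Ioo a' b') μ) (hL : SolvesLiouville v (Ioo a' b') μ)
    {f : Fin m → H} (hf : Orthonormal ℝ f)
    (hc : ∀ ψ : EuclideanSpace ℝ (Fin m) → ℝ, Continuous ψ → (∃ C, ∀ x, |ψ x| ≤ C) →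
      Continuous fun t => ∫ u, ψ (coords f u) ∂(μ t : Measure H))
    (ha : a' < a) (hab : a < b) (hb : b < b')
    {W : ℝ × EuclideanSpace ℝ (Fin m) → EuclideanSpace ℝ (Fin m)} (hW : ContDiff ℝ ∞ W) {L : ℝ≥0}
    (hWL : LipschitzWith L W) {B : ℝ} (hWB : ∀ y, ‖W y‖ ≤ B) {N : ℕ} (hN : 0 < N) {h D : ℝ}
    (hh : h = (b - a) / N) (hD : D = ∫ p, ‖liftField f W p - v p‖ ∂spaceTime μ hμ a' b'
          + h * (L * ∫ p, (1 + ‖v p‖) ∂spaceTime μ hμ a' b')) :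
    ∃ P : ProbabilityMeasure C(Icc a b, H),
      ((P : Measure C(Icc a b, H)).map fun γ => evalAt hab.le γ a)
        = (μ a : Measure H).map (fun u => combine f (coords f u)) ∧
      (∀ (w : ℝ × H → H) (Lw : ℝ≥0) (hw : LipschitzWith Lw w) (Bw : ℝ), (∀ p, ‖w p‖ ≤ Bw) →
        (∀ t x, w (t, combine f (coords f x)) = w (t, x)) →
        ∫⁻ γ, ‖residual hab.le hw.continuous γ‖ₑ ∂(P : Measure C(Icc a b, H))
          ≤ ENNReal.ofReal ((1 + Lw * h) * D + ∑ k ∈ Finset.range N, h *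
              ∫ u, ‖liftField f W (gridPoint a h k, u) - w (gridPoint a h k, u)‖
                ∂(μ (gridPoint a h k) : Measure H) + Lw * (b - a) * (h * (1 + B)))) ∧
      ∀ t ∈ Icc a b, ∃ t' ∈ Icc a b, |t' - t| ≤ h ∧
        ∀ (K : ℝ≥0) (ψ : H → ℝ), LipschitzWith K ψ → (∃ C, ∀ x, |ψ x| ≤ C) →
          |∫ γ, ψ (evalAt hab.le γ t) ∂(P : Measure C(Icc a b, H))
            - ∫ u, ψ (combine f (coords f u)) ∂(μ t' : Measure H)| ≤ K * (D + h * B) := by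
  have hNr : (0 : ℝ) < N := by positivity
  have hba : 0 < b - a := sub_pos.2 hab
  have hh0 : 0 < h := by rw [hh]; positivity
  have hgN : gridPoint a h N = b := by rw [hh]; exact gridPoint_div hN
  have hB : 0 ≤ B := (norm_nonneg _).trans (hWB 0)
  have hD0 : 0 ≤ D := by
    rw [hD]
    have := integral_nonneg (μ := spaceTime μ hμ a' b') (f := fun p => 1 + ‖v p‖)
      fun p => by positivity
    positivity
  have : SecondCountableTopology H := UniformSpace.secondCountable_of_separable H
  obtain ⟨Q, hQ, hQm, hQi⟩ := exists_euler_chain hμ hv hfin hL hf hc hh0.le ha (hgN.trans_lt hb) hN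
    hW hWL hWB
  rw [← hD] at hQi
  set q : ℕ → (ℕ → EuclideanSpace ℝ (Fin m)) → H := fun k y => combine f (W (gridPoint a h k, y k))
    with hq
  have hqc : ∀ k, Continuous (q k) := fun k => by
    have := hW.continuous
    fun_prop
  set z : (ℕ → EuclideanSpace ℝ (Fin m)) → ℕ → H := fun y k => combine f (y k) with hz
  have hzc : Continuous z := by fun_prop
  set Γ : (ℕ → EuclideanSpace ℝ (Fin m)) → C(Icc a b, H) := fun y => interpolatePath a b h N (z y)
    with hΓ
  have hΓc : Continuous Γ := (continuous_interpolatePath a b h N).comp hzc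
  have hΓm : Measurable Γ := hΓc.measurable
  have hstep : ∀ k y, ‖z y (k + 1) - z y k - h • q k y‖
      = ‖y (k + 1) - y k - h • W (gridPoint a h k, y k)‖ := fun k y => by
    rw [← norm_combine hf, map_sub, map_sub, map_smul]
  have hmap : ∀ k ≤ N, ∀ g : H → ℝ, Continuous g → ∫ y, g (z y k) ∂Q
      = ∫ u, g (combine f (coords f u)) ∂(μ (gridPoint a h k) : Measure H) := by
    intro k hk g hg
    have hgc : Continuous fun x => g (combine f x) := hg.comp (combine f).continuous
    rw [← integral_map (f := fun x => g (combine f x)) (coords f).measurable.aemeasurable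
      hgc.aestronglyMeasurable, ← hQm k hk,
      integral_map (measurable_pi_apply k).aemeasurable hgc.aestronglyMeasurable]
  have hΓ0 : ∀ k < N, ∀ y, ∀ t ∈ Icc (gridPoint a h k) (gridPoint a h (k + 1)),
      ‖evalAt hab.le (Γ y) t - z y k‖
        ≤ ‖y (k + 1) - y k - h • W (gridPoint a h k, y k)‖ + h * B := by
    intro k hk y t ht
    rw [hΓ, evalAt_interpolatePath hab.le h N (z y) ⟨(le_gridPoint hh0.le k).trans ht.1,
      ht.2.trans ((monotone_gridPoint a hh0.le (Nat.succ_le_of_lt hk)).trans_eq hgN)⟩, ← hstep]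
    refine (norm_interpolate_sub_le hh0 hk _ ht).trans ?_
    have h1 := norm_add_le (z y (k + 1) - z y k - h • q k y) (h • q k y)
    rw [sub_add_cancel, norm_smul, Real.norm_of_nonneg hh0.le, hq, norm_combine hf] at h1
    have h2 := mul_le_mul_of_nonneg_left (hWB (gridPoint a h k, y k)) hh0.le
    exact h1.trans (add_le_add_right h2 _)
  have hPp : IsProbabilityMeasure (Q.map Γ) := Measure.isProbabilityMeasure_map hΓm.aemeasurable
  refine ⟨⟨Q.map Γ, hPp⟩, ?_, ?_, ?_⟩
  · rw [ProbabilityMeasure.coe_mk, Measure.map_map (continuous_evalAt_left hab.le a).measurable hΓm]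
    have e : (fun γ => evalAt hab.le γ a) ∘ Γ = combine f ∘ fun y => y 0 := by
      ext1 y
      simp only [Function.comp, hΓ]
      rw [evalAt_interpolatePath hab.le h N (z y) (left_mem_Icc.2 hab.le),
        interpolate_left hh0.le]
    rw [e, ← Measure.map_map (combine f).measurable (measurable_pi_apply 0), hQm 0 (Nat.zero_le N),
      gridPoint_zero, Measure.map_map (combine f).measurable (coords f).measurable]
    rfl
  · intro w Lw hw Bw hwB hwi
    have hres : Continuous fun γ : C(Icc a b, H) => residual hab.le hw.continuous γ :=
      continuous_residual hab.le hw.continuous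
    rw [ProbabilityMeasure.coe_mk, lintegral_map hres.enorm.measurable hΓm]
    have hwc := hw.continuous
    have hdm : ∀ k, Measurable fun y => ENNReal.ofReal (h * ‖q k y - w (gridPoint a h k, z y k)‖) :=
      fun k => by
        have := hqc k
        refine ENNReal.measurable_ofReal.comp (Continuous.measurable ?_)
        fun_prop
    have hsm : ∀ k, Measurable fun y : ℕ → EuclideanSpace ℝ (Fin m) =>
        ‖y (k + 1) - y k - h • W (gridPoint a h k, y k)‖ₑ := fun k => by
      have := hW.continuous
      refine (Continuous.enorm ?_).measurable
      fun_prop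
    have hpt : ∀ y, ‖residual hab.le hw.continuous (Γ y)‖ₑ
        ≤ ENNReal.ofReal (1 + Lw * h) * (∑ k ∈ Finset.range N,
            ‖y (k + 1) - y k - h • W (gridPoint a h k, y k)‖ₑ)
          + ∑ k ∈ Finset.range N, ENNReal.ofReal (h * ‖q k y - w (gridPoint a h k, z y k)‖)
          + ENNReal.ofReal (Lw * (b - a) * (h * (1 + B))) := by
      intro y
      have h1 := norm_residual_interpolatePath_le hh0 hgN hab.le hw (z y) (fun k => q k y) (B := B)
        fun k => (norm_combine hf _).trans_le (hWB _)
      rw [← ofReal_norm]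
      refine (ENNReal.ofReal_le_ofReal h1).trans ?_
      rw [ENNReal.ofReal_add (by positivity) (by positivity),
        ENNReal.ofReal_add (by positivity) (by positivity), ENNReal.ofReal_mul (by positivity),
        ENNReal.ofReal_sum_of_nonneg fun k _ => norm_nonneg _,
        ENNReal.ofReal_sum_of_nonneg fun k _ => by positivity]
      simp only [hstep, ofReal_norm]
      exact le_rfl
    refine (lintegral_mono hpt).trans ?_
    rw [lintegral_add_right _ measurable_const, lintegral_const, measure_univ, mul_one,
      lintegral_add_left ((Finset.measurable_fun_sum _ fun k _ => hsm k).const_mul _),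
      lintegral_const_mul _ (Finset.measurable_fun_sum _ fun k _ => hsm k),
      lintegral_finsetSum _ fun k _ => hdm k]
    have hFk : ∀ k ∈ Finset.range N,
        ∫⁻ y, ENNReal.ofReal (h * ‖q k y - w (gridPoint a h k, z y k)‖) ∂Q
        = ENNReal.ofReal (h * ∫ u, ‖liftField f W (gridPoint a h k, u) - w (gridPoint a h k, u)‖
                ∂(μ (gridPoint a h k) : Measure H)) := by
      intro k hk
      have hg : Continuous fun x => ‖combine f (W (gridPoint a h k, coords f x))
          - w (gridPoint a h k, x)‖ := by
        have := hW.continuous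
        fun_prop
      -- The chain has the exact projected law at grid times. Since `w` does not distinguish `u`
      -- from its projection, the expectation becomes an integral of `w` at `u` itself.
      have h1 := hmap k (Finset.mem_range.1 hk).le _ hg
      simp only [hwi, coords_combine hf, hz] at h1
      rw [← ofReal_integral_eq_lintegral_ofReal]
      · rw [integral_const_mul]
        congr 2
      · refine Integrable.of_bound (C := h * (B + Bw)) ?_ (ae_of_all _ fun y => ?_)
        · have := hqc k
          refine Continuous.aestronglyMeasurable ?_
          fun_prop
        · rw [norm_mul, norm_norm, Real.norm_of_nonneg hh0.le]
          refine mul_le_mul_of_nonneg_left ((norm_sub_le _ _).trans (add_le_add ?_ (hwB _))) hh0.le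
          exact (norm_combine hf _).trans_le (hWB _)
      · exact ae_of_all _ fun y => by positivity
    rw [Finset.sum_congr rfl hFk, ← ENNReal.ofReal_sum_of_nonneg fun k _ => by positivity]
    have hsplit : ∀ x y s c : ℝ, 0 ≤ x → 0 ≤ y → 0 ≤ s → 0 ≤ c → ENNReal.ofReal (x * y + s + c)
        = ENNReal.ofReal x * ENNReal.ofReal y + ENNReal.ofReal s + ENNReal.ofReal c :=
      fun x y s c hx hy hs hc => by
        rw [ENNReal.ofReal_add (by positivity) hc, ENNReal.ofReal_add (by positivity) hs,
          ENNReal.ofReal_mul hx]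
    rw [hsplit _ _ _ _ (by positivity) hD0
      (Finset.sum_nonneg fun k _ => mul_nonneg hh0.le (integral_nonneg fun u => norm_nonneg _))
      (by positivity)]
    exact add_le_add_left (add_le_add_left (mul_le_mul_right hQi _) _) _
  · intro t ht
    obtain ⟨k, hk, hkt⟩ := exists_mem_grid hN (hgN.symm ▸ ht)
    have hkb := (monotone_gridPoint a hh0.le hk.le).trans_eq hgN
    -- Marginals are known only on the grid, so `t` is compared with the left end of its interval,
    -- where the path differs from its value at `t` by at most the step error plus `h * B`.
    refine ⟨gridPoint a h k, ⟨le_gridPoint hh0.le k, hkb⟩, ?_, fun K ψ hψ ⟨C, hC⟩ => ?_⟩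
    · have := hkt.2
      rw [gridPoint_succ] at this
      rw [abs_sub_comm, abs_of_nonneg (sub_nonneg.2 hkt.1)]
      linarith
    · have hev := continuous_evalAt_left (H := H) hab.le t
      have hψc := hψ.continuous
      rw [ProbabilityMeasure.coe_mk, integral_map (f := fun γ => ψ (evalAt hab.le γ t))
        hΓm.aemeasurable (hψc.comp hev).aestronglyMeasurable, ← hmap k hk.le ψ hψc]
      have i1 : Integrable (fun y => ψ (evalAt hab.le (Γ y) t)) Q :=
        Integrable.of_bound (hψc.comp (hev.comp hΓc)).aestronglyMeasurable C
          (ae_of_all _ fun y => hC _)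
      have i2 : Integrable (fun y => ψ (z y k)) Q :=
        Integrable.of_bound (by
          refine Continuous.aestronglyMeasurable ?_
          fun_prop) C (ae_of_all _ fun y => hC _)
      rw [← integral_sub i1 i2]
      have hsm : Measurable fun y : ℕ → EuclideanSpace ℝ (Fin m) =>
          ‖y (k + 1) - y k - h • W (gridPoint a h k, y k)‖ₑ := by
        have := hW.continuous
        refine (Continuous.enorm ?_).measurable
        fun_prop
      have h1 : ∫⁻ y, ‖ψ (evalAt hab.le (Γ y) t) - ψ (z y k)‖ₑ ∂Q
          ≤ ENNReal.ofReal (K * (D + h * B)) := by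
        have hpt : ∀ y, ‖ψ (evalAt hab.le (Γ y) t) - ψ (z y k)‖ₑ
            ≤ K * (‖y (k + 1) - y k - h • W (gridPoint a h k, y k)‖ₑ + ENNReal.ofReal (h * B)) := by
          intro y
          rw [← ofReal_norm, ← ofReal_norm, ← ENNReal.ofReal_coe_nnreal,
            ← ENNReal.ofReal_add (norm_nonneg _) (by positivity),
            ← ENNReal.ofReal_mul K.coe_nonneg]
          refine ENNReal.ofReal_le_ofReal ?_
          have := hψ.dist_le_mul (evalAt hab.le (Γ y) t) (z y k)
          rw [dist_eq_norm, dist_eq_norm] at this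
          exact this.trans (mul_le_mul_of_nonneg_left (hΓ0 k hk y t hkt) K.coe_nonneg)
        refine (lintegral_mono hpt).trans ?_
        rw [lintegral_const_mul' _ _ ENNReal.coe_ne_top,
          lintegral_add_right _ measurable_const, lintegral_const, measure_univ, mul_one,
          ENNReal.ofReal_mul K.coe_nonneg, ENNReal.ofReal_add hD0 (by positivity),
          ENNReal.ofReal_coe_nnreal]
        gcongr
        refine le_trans (lintegral_mono fun y => ?_) hQi
        exact Finset.single_le_sum (f := fun k => ‖y (k + 1) - y k - h • W (gridPoint a h k, y k)‖ₑ)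
          (fun _ _ => zero_le) (Finset.mem_range.2 hk)
      rw [← Real.norm_eq_abs]
      have h2 := enorm_integral_le_lintegral_enorm (μ := Q)
        (fun y => ψ (evalAt hab.le (Γ y) t) - ψ (z y k))
      rw [← ofReal_norm] at h2
      exact (ENNReal.ofReal_le_ofReal_iff (by positivity)).1 (h2.trans h1)

/-- Laws of paths starting from the coordinate law of `μ a`, almost solving the equations of finitely
many test fields, and with time marginals close to the coordinate laws of `μ`. -/
theorem exists_path_measure (hμ : Measurable fun t => (μ t : Measure H)) (hv : Measurable v)
    (hfin : FiniteSpeed v (Ioo a' b') μ) (hL : SolvesLiouville v (Ioo a' b') μ)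
    {f : Fin m → H} (hf : Orthonormal ℝ f)
    (hc : ∀ ψ : EuclideanSpace ℝ (Fin m) → ℝ, Continuous ψ → (∃ C, ∀ x, |ψ x| ≤ C) →
      Continuous fun t => ∫ u, ψ (coords f u) ∂(μ t : Measure H))
    (ha : a' < a) (hab : a < b) (hb : b < b')
    {W : ℝ × EuclideanSpace ℝ (Fin m) → EuclideanSpace ℝ (Fin m)} (hW : ContDiff ℝ ∞ W) {L : ℝ≥0}
    (hWL : LipschitzWith L W) {B : ℝ} (hWB : ∀ y, ‖W y‖ ≤ B)
    {ι : Type*} (T : Finset ι) {w : ι → ℝ × H → H} {Lw : ι → ℝ≥0}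
    (hw : ∀ i, LipschitzWith (Lw i) (w i)) {Bw : ι → ℝ} (hwB : ∀ i p, ‖w i p‖ ≤ Bw i)
    (hwi : ∀ i ∈ T, ∀ t x, w i (t, combine f (coords f x)) = w i (t, x)) {ε : ℝ} (hε : 0 < ε) :
    ∃ P : ProbabilityMeasure C(Icc a b, H),
      ((P : Measure C(Icc a b, H)).map fun γ => evalAt hab.le γ a)
        = (μ a : Measure H).map (fun u => combine f (coords f u)) ∧
      (∀ i ∈ T, ∫⁻ γ, ‖residual hab.le (hw i).continuous γ‖ₑ ∂(P : Measure C(Icc a b, H))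
          ≤ ENNReal.ofReal (∫ p, ‖liftField f W p - w i p‖ ∂spaceTime μ hμ a' b'
            + ∫ p, ‖liftField f W p - v p‖ ∂spaceTime μ hμ a' b' + ε)) ∧
      ∀ t ∈ Icc a b, ∃ t' ∈ Icc a b, |t' - t| ≤ ε ∧
        ∀ (K : ℝ≥0) (ψ : H → ℝ), LipschitzWith K ψ → (∃ C, ∀ x, |ψ x| ≤ C) →
          |∫ γ, ψ (evalAt hab.le γ t) ∂(P : Measure C(Icc a b, H))
            - ∫ u, ψ (combine f (coords f u)) ∂(μ t' : Measure H)|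
            ≤ K * (∫ p, ‖liftField f W p - v p‖ ∂spaceTime μ hμ a' b' + ε) := by
  have hB : 0 ≤ B := (norm_nonneg _).trans (hWB 0)
  set M := spaceTime μ hμ a' b' with hM
  set E := ∫ p, ‖liftField f W p - v p‖ ∂M with hE
  set C₀ := L * ∫ p, (1 + ‖v p‖) ∂M with hC₀
  have h0 : Tendsto (fun N : ℕ => (b - a) / N) atTop (𝓝 0) :=
    tendsto_const_div_atTop_nhds_zero_nat _
  -- The discrepancy between driving and test field appears as a Riemann sum of a function
  -- continuous in time. Its integral over `[a, b]` is at most the space-time integral over the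
  -- larger interval.
  have hriem : ∀ i ∈ T, ∀ᶠ N : ℕ in atTop, ∑ k ∈ Finset.range N, (b - a) / N *
      ∫ u, ‖liftField f W (gridPoint a ((b - a) / N) k, u) - w i (gridPoint a ((b - a) / N) k, u)‖
        ∂(μ (gridPoint a ((b - a) / N) k) : Measure H)
      ≤ ∫ p, ‖liftField f W p - w i p‖ ∂M + ε / 2 := by
    intro i hi
    have hWc := hW.continuous
    have hwc := (hw i).continuous
    have hF : Continuous fun t => ∫ u, ‖liftField f W (t, u) - w i (t, u)‖ ∂(μ t : Measure H) := by
      have h1 := continuous_integral_of_lipschitz_time (f := f) hc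
        (G := fun r y => ‖combine f (W (r, y)) - w i (r, combine f y)‖) (C := B + Bw i)
        (K := L + Lw i) (fun r => by fun_prop) (fun r y => by
          rw [abs_norm]
          exact (norm_sub_le _ _).trans (add_le_add ((norm_combine hf _).trans_le (hWB _))
            (hwB _ _))) (fun r r' y => by
          refine (abs_norm_sub_norm_le _ _).trans ?_
          rw [sub_sub_sub_comm, add_mul, ← map_sub]
          have h2 := hWL.dist_le_mul (r, y) (r', y)
          have h3 := (hw i).dist_le_mul (r, combine f y) (r', combine f y)
          rw [dist_prod_same_right, Real.dist_eq, dist_eq_norm] at h2 h3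
          exact (norm_sub_le _ _).trans (add_le_add ((norm_combine hf _).trans_le h2) h3))
      simpa only [hwi i hi, liftField] using h1
    have hint : Integrable (fun p => ‖liftField f W p - w i p‖) M := by
      refine Integrable.of_bound (C := B + Bw i)
        ((continuous_liftField hWc).sub hwc).norm.aestronglyMeasurable (ae_of_all _ fun p => ?_)
      rw [norm_norm]
      exact (norm_sub_le _ _).trans (add_le_add ((norm_combine hf _).trans_le (hWB _)) (hwB _ _))
    filter_upwards [eventually_riemann_sum_le hF hab (half_pos hε)] with N hN
    refine hN.trans (add_le_add_left ?_ _)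
    rw [hM, spaceTime, Measure.integral_compProd hint, intervalIntegral.integral_of_le hab.le,
      integral_Ioc_eq_integral_Ioo]
    exact setIntegral_mono_set (integrable_integral_spaceTime hμ hint)
      (ae_of_all _ fun t => integral_nonneg fun u => norm_nonneg _)
      (Ioo_subset_Ioo ha.le hb.le).eventuallyLE
  -- The Lipschitz constants may be huge, but they are fixed before the mesh, and at mesh zero only
  -- `E` remains.
  have herr : ∀ i ∈ T, ∀ᶠ N : ℕ in atTop, (1 + Lw i * ((b - a) / N)) * (E + (b - a) / N * C₀)
      + Lw i * (b - a) * ((b - a) / N * (1 + B)) < E + ε / 2 := by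
    intro i _
    have hcont : Continuous fun h : ℝ => (1 + Lw i * h) * (E + h * C₀)
        + Lw i * (b - a) * (h * (1 + B)) := by fun_prop
    refine ((hcont.tendsto 0).comp h0).eventually (gt_mem_nhds ?_)
    simp only [mul_zero, add_zero, zero_mul, one_mul]
    linarith
  have herr' : ∀ᶠ N : ℕ in atTop, (E + (b - a) / N * C₀) + (b - a) / N * B < E + ε := by
    have hcont : Continuous fun h : ℝ => (E + h * C₀) + h * B := by fun_prop
    refine ((hcont.tendsto 0).comp h0).eventually (gt_mem_nhds ?_)
    simp only [add_zero, zero_mul]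
    linarith
  obtain ⟨N, hN0, hNr, hNe, hNe', hNh⟩ := ((eventually_gt_atTop 0).and
    (((eventually_all_finset T).2 hriem).and (((eventually_all_finset T).2 herr).and
      (herr'.and (h0.eventually (gt_mem_nhds hε)))))).exists
  obtain ⟨P, h1, h2, h3⟩ := exists_euler_path_measure hμ hv hfin hL hf hc ha hab hb hW hWL hWB hN0
    rfl rfl
  refine ⟨P, h1, fun i hi => (h2 (w i) (Lw i) (hw i) (Bw i) (hwB i) (hwi i hi)).trans
    (ENNReal.ofReal_le_ofReal ?_), fun t ht => ?_⟩
  · have e1 := hNr i hi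
    have e2 := hNe i hi
    linarith
  · obtain ⟨t', ht', h4, h5⟩ := h3 t ht
    refine ⟨t', ht', h4.trans hNh.le, fun K ψ hψ hψb => (h5 K ψ hψ hψb).trans ?_⟩
    exact mul_le_mul_of_nonneg_left hNe'.le K.coe_nonneg

end PathMeasure

end GenFlow

namespace GenFlow

open MeasureTheory Set Filter Topology ProbabilityTheory
open scoped NNReal ENNReal BoundedContinuousFunction

/-! ### A tightness criterion -/

section Tightness

variable {X : Type*} [MetricSpace X] [CompleteSpace X] [SecondCountableTopology X]
  [MeasurableSpace X] [BorelSpace X]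

/-- A sequence of probability measures is tight if it is eventually concentrated on small
neighbourhoods of compact sets. -/
theorem isTightMeasureSet_range_of_thickening {P : ℕ → ProbabilityMeasure X}
    (h : ∀ ε : ℝ, 0 < ε → ∃ K : Set X, IsCompact K ∧
      ∀ᶠ n in atTop, (P n : Measure X) (Metric.thickening ε K)ᶜ ≤ ENNReal.ofReal ε) :
    IsTightMeasureSet (range fun n => (P n : Measure X)) := by
  have h1 : ∀ ε : ℝ, 0 < ε → ∃ K : Set X, IsCompact K ∧
      ∀ n, (P n : Measure X) (Metric.cthickening ε K)ᶜ ≤ ENNReal.ofReal ε := by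
    intro ε hε
    obtain ⟨K, hK, hKn⟩ := h ε hε
    obtain ⟨n₀, hn₀⟩ := eventually_atTop.1 hKn
    -- The finitely many measures not covered by the eventual bound are tight one by one, and their
    -- compact sets are added to `K`.
    have h2 : ∀ n, ∃ C : Set X, IsCompact C ∧ (P n : Measure X) Cᶜ ≤ ENNReal.ofReal ε := fun n => by
      obtain ⟨C, hC, hCn⟩ := isTightMeasureSet_iff_exists_isCompact_measure_compl_le.1
        (isTightMeasureSet_singleton (μ := (P n : Measure X))) (ENNReal.ofReal ε) (by simpa)
      exact ⟨C, hC, hCn _ rfl⟩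
    choose C hC hCn using h2
    refine ⟨K ∪ ⋃ n ∈ Finset.range n₀, C n,
      hK.union ((Finset.range n₀).isCompact_biUnion fun n _ => hC n), fun n => ?_⟩
    rcases le_or_gt n₀ n with hn | hn
    · refine (measure_mono (compl_subset_compl.2 ?_)).trans (hn₀ n hn)
      exact (Metric.thickening_subset_cthickening _ _).trans
        (Metric.cthickening_subset_of_subset _ subset_union_left)
    · refine (measure_mono (compl_subset_compl.2 ?_)).trans (hCn n)
      exact (subset_biUnion_of_mem (u := C) (Finset.mem_coe.2 (Finset.mem_range.2 hn))).trans
        (subset_union_right.trans (Metric.self_subset_cthickening _))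
  refine isTightMeasureSet_iff_exists_isCompact_measure_compl_le.2 fun ε hε => ?_
  obtain ⟨δ, hδ, hδε⟩ := ENNReal.exists_pos_sum_of_countable hε.ne' ℕ
  -- The bound `δ n` makes the exceptional masses summable to less than `ε`; the bound `1 / (n + 1)`
  -- makes the intersection of the neighbourhoods totally bounded.
  choose K hK hKn using fun n => h1 (min (δ n) (1 / ((n : ℝ) + 1)))
    (lt_min (hδ n) (by positivity))
  refine ⟨⋂ n, Metric.cthickening (min (δ n) (1 / ((n : ℝ) + 1))) (K n),
    TotallyBounded.isCompact_of_isClosed ?_ (isClosed_iInter fun n => Metric.isClosed_cthickening),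
    ?_⟩
  · refine Metric.totallyBounded_iff.2 fun r hr => ?_
    obtain ⟨n, hn⟩ := exists_nat_one_div_lt (half_pos hr)
    obtain ⟨t, ht, hKt⟩ := Metric.totallyBounded_iff.1 (hK n).totallyBounded (r / 2) (half_pos hr)
    refine ⟨t, ht, fun x hx => ?_⟩
    have hx' := Metric.cthickening_subset_thickening' (half_pos hr)
      ((min_le_right _ _).trans_lt hn) (K n) (mem_iInter.1 hx n)
    obtain ⟨y, hy, hxy⟩ := Metric.mem_thickening_iff.1 hx'
    obtain ⟨z, hz, hyz⟩ := mem_iUnion₂.1 (hKt hy)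
    refine mem_iUnion₂.2 ⟨z, hz, ?_⟩
    rw [Metric.mem_ball] at hyz ⊢
    linarith [dist_triangle x y z]
  · rintro _ ⟨n, rfl⟩
    rw [compl_iInter]
    refine (measure_iUnion_le _).trans (le_trans (ENNReal.tsum_le_tsum fun k => ?_) hδε.le)
    refine (hKn k n).trans ?_
    rw [← ENNReal.ofReal_coe_nnreal]
    exact ENNReal.ofReal_le_ofReal (min_le_left _ _)

end Tightness

/-! ### Weak limits of probability measures -/

section WeakLimits

variable {X : Type*} [TopologicalSpace X] [MeasurableSpace X] [OpensMeasurableSpace X]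

/-- A tight sequence of probability measures converges along some ultrafilter. -/
lemma exists_ultrafilter_tendsto {X : Type*} [MetricSpace X] [MeasurableSpace X] [BorelSpace X]
    {P : ℕ → ProbabilityMeasure X}
    (h : IsTightMeasureSet (range fun n => (P n : Measure X))) :
    ∃ (l : Ultrafilter ℕ) (η : ProbabilityMeasure X), (l : Filter ℕ) ≤ atTop ∧ Tendsto P l (𝓝 η) := by
  have hc : IsCompact (closure (range P)) := isCompact_closure_of_isTightMeasureSet (by
    convert h using 1
    ext ν
    simp)
  obtain ⟨η, -, hη⟩ := hc.ultrafilter_le_nhds ((Ultrafilter.of (atTop : Filter ℕ)).map P)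
    (le_principal_iff.2 (mem_of_superset (range_mem_map) subset_closure))
  exact ⟨Ultrafilter.of atTop, η, Ultrafilter.of_le _, hη⟩

/-- Lower semicontinuity of the expected norm under weak convergence. -/
lemma lintegral_enorm_le_of_tendsto {ι F : Type*} [NormedAddCommGroup F] {l : Filter ι} [l.NeBot]
    {P : ι → ProbabilityMeasure X} {η : ProbabilityMeasure X} (hP : Tendsto P l (𝓝 η)) {g : X → F}
    (hg : Continuous g) {c : ℝ≥0∞} (hc : ∀ᶠ i in l, ∫⁻ x, ‖g x‖ₑ ∂(P i : Measure X) ≤ c) :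
    ∫⁻ x, ‖g x‖ₑ ∂(η : Measure X) ≤ c := by
  have h1 : ∀ k : ℕ, ∫⁻ x, ((min ‖g x‖₊ k : ℝ≥0) : ℝ≥0∞) ∂(η : Measure X) ≤ c := by
    intro k
    let G : X →ᵇ ℝ≥0 := BoundedContinuousFunction.mkOfBound
      ⟨fun x => min ‖g x‖₊ k, hg.nnnorm.min continuous_const⟩ k fun x y => by
        rw [NNReal.dist_eq, abs_le]
        have h1 : ((min ‖g x‖₊ k : ℝ≥0) : ℝ) ≤ k := by exact_mod_cast min_le_right _ _
        have h2 : ((min ‖g y‖₊ k : ℝ≥0) : ℝ) ≤ k := by exact_mod_cast min_le_right _ _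
        have h3 := (min ‖g x‖₊ (k : ℝ≥0)).coe_nonneg
        have h4 := (min ‖g y‖₊ (k : ℝ≥0)).coe_nonneg
        simp only [ContinuousMap.coe_mk]
        constructor <;> linarith
    refine le_of_tendsto (ProbabilityMeasure.tendsto_iff_forall_lintegral_tendsto.1 hP G) ?_
    filter_upwards [hc] with i hi
    refine (lintegral_mono fun x => ?_).trans hi
    exact ENNReal.coe_le_coe.2 (min_le_left _ _)
  have h2 : ∀ x, ‖g x‖ₑ = ⨆ k : ℕ, ((min ‖g x‖₊ k : ℝ≥0) : ℝ≥0∞) := by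
    intro x
    refine le_antisymm ?_ (iSup_le fun k => ENNReal.coe_le_coe.2 (min_le_left _ _))
    obtain ⟨k, hk⟩ := exists_nat_ge ‖g x‖₊
    refine le_iSup_of_le k ?_
    rw [min_eq_left hk]
    rfl
  simp only [h2]
  rw [lintegral_iSup]
  · exact iSup_le h1
  · exact fun k => ((hg.nnnorm.min continuous_const).measurable).coe_nnreal_ennreal
  · exact fun k k' hk x => ENNReal.coe_le_coe.2 (min_le_min_left _ (Nat.cast_le.2 hk))

/-- Probability measures are determined by the integrals of bounded Lipschitz functions. -/
lemma ext_of_lipschitz_integral {Y : Type*} [PseudoEMetricSpace Y] [MeasurableSpace Y] [BorelSpace Y]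
    {α β : ProbabilityMeasure Y} (h : ∀ (K : ℝ≥0) (ψ : Y → ℝ), LipschitzWith K ψ →
      (∃ C, ∀ x, |ψ x| ≤ C) → ∫ x, ψ x ∂(α : Measure Y) = ∫ x, ψ x ∂(β : Measure Y)) : α = β := by
  -- Weak convergence can be tested on bounded Lipschitz functions, so the constant sequence `α`
  -- converges to `β`; limits are unique.
  have h1 : Tendsto (fun _ : ℕ => α) atTop (𝓝 β) := by
    refine tendsto_iff_forall_lipschitz_integral_tendsto.2 fun ψ ⟨C, hC⟩ ⟨K, hK⟩ => ?_
    rcases isEmpty_or_nonempty Y with hY | ⟨⟨y⟩⟩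
    · simp [Measure.eq_zero_of_isEmpty]
    rw [h K ψ hK ⟨C + |ψ y|, fun x => ?_⟩]
    · exact tendsto_const_nhds
    · have h2 := hC x y
      rw [Real.dist_eq] at h2
      have h3 := abs_sub_abs_le_abs_sub (ψ x) (ψ y)
      linarith
  exact tendsto_nhds_unique tendsto_const_nhds h1

end WeakLimits

/-! ### Compact sets of paths -/

section PathCompactness

variable {H : Type*} [NormedAddCommGroup H] {a b : ℝ}

/-- Uniformly Lipschitz paths with values in a compact set form a compact set. -/
lemma isCompact_lipschitz_paths {C : Set H} (hC : IsCompact C) (L : ℝ≥0) :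
    IsCompact {γ : C(Icc a b, H) | LipschitzWith L γ ∧ ∀ t, γ t ∈ C} := by
  set A := {γ : C(Icc a b, H) | LipschitzWith L γ ∧ ∀ t, γ t ∈ C} with hA
  have hcl : IsClosed A := by
    have h1 : A = (⋂ s, ⋂ t, {γ : C(Icc a b, H) | dist (γ s) (γ t) ≤ L * dist s t})
        ∩ ⋂ t, {γ | γ t ∈ C} := by
      ext γ
      simp only [hA, lipschitzWith_iff_dist_le_mul, mem_inter_iff, mem_iInter, mem_ofPred_eq]
    rw [h1]
    refine (isClosed_iInter fun s => isClosed_iInter fun t => ?_).inter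
      (isClosed_iInter fun t => hC.isClosed.preimage (continuous_eval_const t))
    exact isClosed_le (by fun_prop) continuous_const
  let Θ := ContinuousMap.equivBoundedOfCompact (Icc a b) H
  have hΘ : Isometry Θ := (ContinuousMap.isometryEquivBoundedOfCompact (Icc a b) H).isometry
  have hΘi : Topology.IsInducing Θ := hΘ.isEmbedding.isInducing
  rw [hΘi.isCompact_iff]
  refine BoundedContinuousFunction.arzela_ascoli₂ C hC _ ?_ ?_ ?_
  · exact (ContinuousMap.isometryEquivBoundedOfCompact (Icc a b) H).toHomeomorph.isClosedMap _ hcl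
  · rintro _ t ⟨γ, hγ, rfl⟩
    exact hγ.2 t
  · refine LipschitzWith.uniformEquicontinuous _ L ?_ |>.equicontinuous
    rintro ⟨_, γ, hγ, rfl⟩
    exact hγ.1

end PathCompactness

end GenFlow

namespace GenFlow

open MeasureTheory Set Filter Topology ProbabilityTheory
open scoped NNReal ENNReal BoundedContinuousFunction

/-! ### Approximate solutions of cylindrical equations -/

section LiftField

variable {H : Type*} [NormedAddCommGroup H] [InnerProductSpace ℝ H] {m : ℕ} {f : Fin m → H}
  {W : ℝ × EuclideanSpace ℝ (Fin m) → EuclideanSpace ℝ (Fin m)}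

lemma norm_liftField_le (hf : Orthonormal ℝ f) {B : ℝ} (hWB : ∀ y, ‖W y‖ ≤ B) (p : ℝ × H) :
    ‖liftField f W p‖ ≤ B :=
  (norm_combine hf _).trans_le (hWB _)

lemma lipschitzWith_liftField (hf : Orthonormal ℝ f) {L : ℝ≥0} (hWL : LipschitzWith L W) :
    LipschitzWith L (liftField f W) := by
  refine LipschitzWith.of_dist_le_mul fun p p' => ?_
  rw [dist_eq_norm, liftField, liftField, ← map_sub, norm_combine hf, ← dist_eq_norm]
  refine (hWL.dist_le_mul _ _).trans (mul_le_mul_of_nonneg_left ?_ L.coe_nonneg)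
  rw [Prod.dist_eq, Prod.dist_eq]
  refine max_le_max le_rfl ?_
  rw [dist_eq_norm, dist_eq_norm, ← map_sub]
  exact norm_coords_le hf _

variable {a b : ℝ}

/-- Paths almost solving the equation of a cylindrical field, with initial points in a compact set,
stay close to a compact set of paths. -/
lemma exists_compact_paths [CompleteSpace H] (hab : a ≤ b) (hf : Orthonormal ℝ f) (hW : Continuous W) {B : ℝ}
    (hWB : ∀ y, ‖W y‖ ≤ B) {C : Set H} (hC : IsCompact C) :
    ∃ K : Set C(Icc a b, H), IsCompact K ∧ ∀ δ : ℝ, ∀ γ : C(Icc a b, H), evalAt hab γ a ∈ C →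
      ‖residual hab (continuous_liftField (f := f) hW) γ‖ < δ → γ ∈ Metric.thickening δ K := by
  have hB : 0 ≤ B := (norm_nonneg _).trans (hWB 0)
  have hball : IsCompact (combine f '' Metric.closedBall 0 (B * (b - a))) :=
    (isCompact_closedBall _ _).image (combine f).continuous
  have hcst : Continuous fun x : H => ContinuousMap.const (Icc a b) x :=
    ContinuousMap.continuous_const'
  refine ⟨_, (hC.image hcst).add (isCompact_lipschitz_paths hball B.toNNReal),
    fun δ γ hγ hδ => ?_⟩
  set R := residual hab (continuous_liftField (f := f) hW) γ with hR
  have hWγ : Continuous fun r => W (r, coords f (evalAt hab γ r)) :=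
    hW.comp (continuous_id.prodMk ((coords f).continuous.comp (continuous_evalAt hab γ)))
  -- After removing initial point and defect, only the integral of a bounded finite-dimensional
  -- field is left: a `B`-Lipschitz path in a finite-dimensional ball. The compact set therefore
  -- does not depend on `δ`.
  have hA : ∀ t : Icc a b, (γ - ContinuousMap.const (Icc a b) (evalAt hab γ a) - R : C(Icc a b, H)) t
      = combine f (∫ r in a..t, W (r, coords f (evalAt hab γ r))) := by
    intro t
    rw [← ContinuousLinearMap.intervalIntegral_comp_comm _ (hWγ.intervalIntegrable _ _)]
    simp only [ContinuousMap.sub_apply, ContinuousMap.const_apply, hR, residual_apply]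
    rw [sub_sub_cancel]
    rfl
  refine Metric.mem_thickening_iff.2 ⟨γ - R, Set.mem_add.2 ⟨_, mem_image_of_mem _ hγ,
    γ - ContinuousMap.const _ (evalAt hab γ a) - R, ⟨?_, fun t => ?_⟩, by abel⟩, ?_⟩
  · refine LipschitzWith.of_dist_le_mul fun s t => ?_
    rw [hA, hA, dist_eq_norm, ← map_sub, norm_combine hf,
      intervalIntegral.integral_interval_sub_left (hWγ.intervalIntegrable _ _)
        (hWγ.intervalIntegrable _ _), Real.coe_toNNReal _ hB]
    exact intervalIntegral.norm_integral_le_of_norm_le_const fun r _ => hWB _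
  · rw [hA]
    refine mem_image_of_mem _ (mem_closedBall_zero_iff.2 ?_)
    refine (intervalIntegral.norm_integral_le_of_norm_le_const fun r _ => hWB _).trans ?_
    rw [abs_of_nonneg (sub_nonneg.2 t.2.1)]
    exact mul_le_mul_of_nonneg_left (sub_le_sub_right t.2.2 _) hB
  · rwa [dist_eq_norm, sub_sub_cancel]

end LiftField

/-! ### Tightness of the approximating path laws -/

section Tightness

variable {H : Type*} [NormedAddCommGroup H] [InnerProductSpace ℝ H] [CompleteSpace H]
  [TopologicalSpace.SeparableSpace H] [MeasurableSpace H] [BorelSpace H] {S : Set ℕ}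
  {a b : ℝ} [MeasurableSpace C(Icc a b, H)] [BorelSpace C(Icc a b, H)]

/-- The laws of the projections onto growing finite-dimensional subspaces are uniformly
concentrated on compact sets. -/
lemma exists_compact_basisProj (e : HilbertBasis S ℝ H) (ν : ProbabilityMeasure H)
    {s : ℕ → Finset S} (hs : Tendsto s atTop atTop) {ε : ℝ≥0∞} (hε : 0 < ε) :
    ∃ C : Set H, IsCompact C ∧ ∀ n, (ν : Measure H).map (basisProj e (s n)) Cᶜ ≤ ε := by
  have : SecondCountableTopology H := UniformSpace.secondCountable_of_separable H
  have hp : ∀ n, IsProbabilityMeasure ((ν : Measure H).map (basisProj e (s n))) := fun n =>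
    Measure.isProbabilityMeasure_map (basisProj e (s n)).measurable.aemeasurable
  let Q : ℕ → ProbabilityMeasure H := fun n => ⟨(ν : Measure H).map (basisProj e (s n)), hp n⟩
  -- The projected laws converge weakly to `ν`, so together with their limit they form a compact
  -- set, and the converse half of Prokhorov's theorem gives tightness.
  have hQ : Tendsto Q atTop (𝓝 ν) := by
    refine ProbabilityMeasure.tendsto_iff_forall_integral_tendsto.2 fun ψ => ?_
    have h1 := (tendsto_integral_basisProj e (ν : Measure H) ψ).comp hs
    refine h1.congr fun n => ?_
    exact (integral_map (basisProj e (s n)).measurable.aemeasurable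
      ψ.continuous.aestronglyMeasurable).symm
  have hc : IsCompact (closure (range Q)) :=
    hQ.isCompact_insert_range.closure_of_subset (subset_insert _ _)
  obtain ⟨C, hC, hCn⟩ := isTightMeasureSet_iff_exists_isCompact_measure_compl_le.1
    (isTightMeasureSet_of_isCompact_closure hc) ε hε
  exact ⟨C, hC, fun n => hCn _ ⟨Q n, mem_range_self n, rfl⟩⟩

/-- Laws of paths that start from projections of a fixed law and almost solve the equations of
cylindrical fields are tight. -/
theorem isTightMeasureSet_paths (hab : a ≤ b) (e : HilbertBasis S ℝ H) (ν : ProbabilityMeasure H)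
    {s : ℕ → Finset S} (hs : Tendsto s atTop atTop)
    {W : ∀ j, ℝ × EuclideanSpace ℝ (Fin (s j).card) → EuclideanSpace ℝ (Fin (s j).card)}
    (hW : ∀ j, Continuous (W j)) (hWB : ∀ j, ∃ B, ∀ y, ‖W j y‖ ≤ B)
    {P : ℕ → ProbabilityMeasure C(Icc a b, H)}
    (hPa : ∀ n, ((P n : Measure C(Icc a b, H)).map fun γ => evalAt hab γ a)
      = (ν : Measure H).map (basisProj e (s n)))
    {c : ℕ → ℝ} (hc : Tendsto c atTop (𝓝 0))
    (hPr : ∀ j n, j ≤ n → ∫⁻ γ, ‖residual hab (continuous_liftField (f := subfamily e (s j)) (hW j)) γ‖ₑ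
      ∂(P n : Measure C(Icc a b, H)) ≤ ENNReal.ofReal (c j)) :
    IsTightMeasureSet (range fun n => (P n : Measure C(Icc a b, H))) := by
  have : SecondCountableTopology H := UniformSpace.secondCountable_of_separable H
  refine isTightMeasureSet_range_of_thickening fun ε hε => ?_
  obtain ⟨C, hC, hCn⟩ := exists_compact_basisProj e ν hs
    (ε := ENNReal.ofReal (ε / 2)) (by simpa using hε)
  -- By Markov's inequality a mean defect below `ε / 2 * ε` leaves probability at most `ε / 2` for a
  -- defect of size `ε`. The field index `j` is fixed while `n` grows.
  obtain ⟨j, hj⟩ := (hc.eventually (gt_mem_nhds (show 0 < ε / 2 * ε by positivity))).exists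
  obtain ⟨B, hB⟩ := hWB j
  obtain ⟨K, hK, hKγ⟩ := exists_compact_paths hab (orthonormal_subfamily e (s j)) (hW j) hB hC
  refine ⟨K, hK, eventually_atTop.2 ⟨j, fun n hn => ?_⟩⟩
  set R := residual hab (continuous_liftField (f := subfamily e (s j)) (hW j)) with hR
  have hsub : (Metric.thickening ε K)ᶜ ⊆ ((fun γ => evalAt hab γ a) ⁻¹' Cᶜ)
      ∪ {γ | ENNReal.ofReal ε ≤ ‖R γ‖ₑ} := by
    intro γ hγ
    by_contra h
    rw [mem_union, not_or, mem_preimage, mem_compl_iff, not_not, mem_ofPred_eq, not_le,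
      ← ofReal_norm, ENNReal.ofReal_lt_ofReal_iff hε] at h
    exact hγ (hKγ ε γ h.1 h.2)
  have h1 : (P n : Measure C(Icc a b, H)) ((fun γ => evalAt hab γ a) ⁻¹' Cᶜ)
      ≤ ENNReal.ofReal (ε / 2) := by
    rw [← Measure.map_apply (continuous_evalAt_left hab a).measurable hC.measurableSet.compl, hPa]
    exact hCn n
  have h2 : (P n : Measure C(Icc a b, H)) {γ | ENNReal.ofReal ε ≤ ‖R γ‖ₑ}
      ≤ ENNReal.ofReal (ε / 2) := by
    have h3 := (mul_meas_ge_le_lintegral (μ := (P n : Measure C(Icc a b, H)))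
      (continuous_residual hab (continuous_liftField (f := subfamily e (s j)) (hW j))).enorm.measurable
      (ENNReal.ofReal ε)).trans ((hPr j n hn).trans (ENNReal.ofReal_le_ofReal hj.le))
    rw [mul_comm, ENNReal.ofReal_mul (by positivity)] at h3
    exact (ENNReal.mul_le_mul_iff_left (by simpa using hε) ENNReal.ofReal_ne_top).1 h3
  refine (measure_mono hsub).trans ((measure_union_le _ _).trans ((add_le_add h1 h2).trans_eq ?_))
  rw [← ENNReal.ofReal_add (by positivity) (by positivity), add_halves]

end Tightness

end GenFlow

namespace GenFlow

open MeasureTheory Set Filter Topology ProbabilityTheory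
open scoped NNReal ENNReal BoundedContinuousFunction

/-! ### The superposition principle -/

section Superposition

variable {H : Type*} [NormedAddCommGroup H] [InnerProductSpace ℝ H] {S : Set ℕ}

lemma basisProj_basisProj (e : HilbertBasis S ℝ H) {s t : Finset S} (hst : s ⊆ t) (x : H) :
    basisProj e s (basisProj e t x) = basisProj e s x := by
  rw [basisProj_eq, coords_basisProj e hst, ← basisProj_eq]

lemma lipschitzWith_basisProj (e : HilbertBasis S ℝ H) (s : Finset S) :
    LipschitzWith 1 (basisProj e s) :=
  LipschitzWith.of_dist_le_mul fun x y => by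
    rw [NNReal.coe_one, one_mul, dist_eq_norm, dist_eq_norm, ← map_sub]
    exact norm_basisProj_le e s _

variable [MeasurableSpace H] [BorelSpace H]
  {a b : ℝ} [MeasurableSpace C(Icc a b, H)] [BorelSpace C(Icc a b, H)]

/-- Time marginals of a weak limit of path measures. -/
lemma map_evalAt_eq_of_tendsto (hab : a ≤ b) {e : HilbertBasis S ℝ H} {μ : ℝ → ProbabilityMeasure H}
    (hμ : WeaklyNarrowlyContinuous e μ) {s : ℕ → Finset S} (hs : Tendsto s atTop atTop)
    {l : Filter ℕ} [l.NeBot] (hl : l ≤ atTop) {P : ℕ → ProbabilityMeasure C(Icc a b, H)}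
    {η : ProbabilityMeasure C(Icc a b, H)} (hP : Tendsto P l (𝓝 η)) {t : ℝ}
    {c : ℕ → ℝ} (hc : Tendsto c atTop (𝓝 0))
    (hPt : ∀ n, ∃ t', |t' - t| ≤ c n ∧ ∀ (K : ℝ≥0) (ψ : H → ℝ), LipschitzWith K ψ →
      (∃ C, ∀ x, |ψ x| ≤ C) → |∫ γ, ψ (evalAt hab γ t) ∂(P n : Measure C(Icc a b, H))
        - ∫ u, ψ (basisProj e (s n) u) ∂(μ t' : Measure H)| ≤ K * c n) :
    (η : Measure C(Icc a b, H)).map (fun γ => evalAt hab γ t) = μ t := by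
  have hev := continuous_evalAt_left (H := H) hab t
  have hp : IsProbabilityMeasure ((η : Measure C(Icc a b, H)).map fun γ => evalAt hab γ t) :=
    Measure.isProbabilityMeasure_map hev.measurable.aemeasurable
  choose t' ht' hPt using hPt
  have ht'l : Tendsto t' l (𝓝 t) := by
    refine Tendsto.mono_left ?_ hl
    exact tendsto_iff_dist_tendsto_zero.2 (squeeze_zero (fun n => dist_nonneg) ht' hc)
  suffices h : (⟨_, hp⟩ : ProbabilityMeasure H) = μ t from congrArg Subtype.val h
  refine ext_of_lipschitz_integral fun K ψ hψ ⟨C, hC⟩ => ?_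
  -- The hypothesis controls time variation only for functions of finitely many coordinates. For
  -- such a fixed `σ` the projection along `s n` is invisible as soon as `σ ⊆ s n`; `σ` is removed
  -- at the end.
  have hkey : ∀ σ : Finset S, ∫ x, ψ (basisProj e σ x)
      ∂((η : Measure C(Icc a b, H)).map fun γ => evalAt hab γ t)
      = ∫ x, ψ (basisProj e σ x) ∂(μ t : Measure H) := by
    intro σ
    have hψσ : LipschitzWith K fun x => ψ (basisProj e σ x) := by
      have := hψ.comp (lipschitzWith_basisProj e σ)
      rwa [mul_one] at this
    let Ψ : C(Icc a b, H) →ᵇ ℝ := BoundedContinuousFunction.ofNormedAddCommGroup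
      (fun γ => ψ (basisProj e σ (evalAt hab γ t))) (hψσ.continuous.comp hev) C fun γ => hC _
    rw [integral_map hev.measurable.aemeasurable hψσ.continuous.aestronglyMeasurable]
    have h1 : Tendsto (fun n => ∫ γ, ψ (basisProj e σ (evalAt hab γ t))
        ∂(P n : Measure C(Icc a b, H))) l (𝓝 (∫ γ, ψ (basisProj e σ (evalAt hab γ t))
        ∂(η : Measure C(Icc a b, H)))) :=
      ProbabilityMeasure.tendsto_iff_forall_integral_tendsto.1 hP Ψ
    have h2 : Tendsto (fun n => ∫ u, ψ (basisProj e σ u) ∂(μ (t' n) : Measure H)) l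
        (𝓝 (∫ u, ψ (basisProj e σ u) ∂(μ t : Measure H))) :=
      ((hμ.continuous_basisProj σ hψ.continuous ⟨C, hC⟩).tendsto t).comp ht'l
    have h3 : Tendsto (fun n => ∫ γ, ψ (basisProj e σ (evalAt hab γ t))
        ∂(P n : Measure C(Icc a b, H)) - ∫ u, ψ (basisProj e σ u) ∂(μ (t' n) : Measure H)) l
        (𝓝 0) := by
      have hKc : Tendsto (fun n => K * c n) l (𝓝 0) := by
        simpa using (hc.mono_left hl).const_mul (K : ℝ)
      refine squeeze_zero_norm' ?_ hKc
      filter_upwards [hl (hs.eventually (eventually_ge_atTop σ))] with n hn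
      have := hPt n K _ hψσ ⟨C, fun x => hC _⟩
      simpa only [basisProj_basisProj e hn, Real.norm_eq_abs] using this
    exact sub_eq_zero.1 (tendsto_nhds_unique (h1.sub h2) h3)
  let Ψ : H →ᵇ ℝ := BoundedContinuousFunction.ofNormedAddCommGroup ψ hψ.continuous C hC
  have h1 := tendsto_integral_basisProj e
    ((η : Measure C(Icc a b, H)).map fun γ => evalAt hab γ t) Ψ
  have h2 := tendsto_integral_basisProj e (μ t : Measure H) Ψ
  exact tendsto_nhds_unique (h1.congr hkey) h2

variable [TopologicalSpace.SeparableSpace H]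

/-- A path measure with time marginals `μ` whose paths almost solve the equations of fields
approximating `v` in mean is concentrated on solutions of the equation of `v`. -/
lemma ae_residual_eq_zero (hab : a ≤ b) {μ : ℝ → ProbabilityMeasure H}
    (hμ : Measurable fun t => (μ t : Measure H)) {v : ℝ × H → H} (hv : Continuous v) {a' b' : ℝ}
    (ha : a' < a) (hb : b < b') {η : ProbabilityMeasure C(Icc a b, H)}
    (hη : ∀ t ∈ Icc a b, (η : Measure C(Icc a b, H)).map (fun γ => evalAt hab γ t) = μ t)
    {w : ℕ → ℝ × H → H} (hw : ∀ j, Continuous (w j)) {c : ℕ → ℝ} (hc : Tendsto c atTop (𝓝 0))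
    (hwv : ∀ j, ∫⁻ p, ‖w j p - v p‖ₑ ∂spaceTime μ hμ a' b' ≤ ENNReal.ofReal (c j))
    (hwr : ∀ j, ∫⁻ γ, ‖residual hab (hw j) γ‖ₑ ∂(η : Measure C(Icc a b, H))
      ≤ ENNReal.ofReal (c j)) :
    ∀ᵐ γ ∂(η : Measure C(Icc a b, H)), residual hab hv γ = 0 := by
  have : SecondCountableTopology H := UniformSpace.secondCountable_of_separable H
  have hpath : ∀ {g : ℝ × H → H}, Continuous g → ∀ γ : C(Icc a b, H),
      Continuous fun r => g (r, evalAt hab γ r) := fun hg γ =>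
    hg.comp (continuous_id.prodMk (continuous_evalAt hab γ))
  have hm : ∀ j, Measurable fun p : C(Icc a b, H) × ℝ =>
      ‖w j (p.2, evalAt hab p.1 p.2) - v (p.2, evalAt hab p.1 p.2)‖ₑ := fun j =>
    (((hw j).sub hv).comp (continuous_snd.prodMk (continuous_evalAt_uncurry hab))).enorm.measurable
  have h1 : ∀ j γ, ‖residual hab hv γ‖ₑ ≤ ‖residual hab (hw j) γ‖ₑ
      + ∫⁻ r in Icc a b, ‖w j (r, evalAt hab γ r) - v (r, evalAt hab γ r)‖ₑ := by
    intro j γ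
    have hd : Continuous fun r => w j (r, evalAt hab γ r) - v (r, evalAt hab γ r) :=
      (hpath (hw j) γ).sub (hpath hv γ)
    have hdi : IntegrableOn (fun r => w j (r, evalAt hab γ r) - v (r, evalAt hab γ r)) (Icc a b) :=
      hd.continuousOn.integrableOn_Icc
    have h2 : ‖residual hab hv γ‖ ≤ ‖residual hab (hw j) γ‖
        + ∫ r in Icc a b, ‖w j (r, evalAt hab γ r) - v (r, evalAt hab γ r)‖ := by
      refine (ContinuousMap.norm_le _ (by positivity)).2 fun t => ?_
      have e : residual hab hv γ t = residual hab (hw j) γ t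
          + ∫ r in a..t, (w j (r, evalAt hab γ r) - v (r, evalAt hab γ r)) := by
        rw [intervalIntegral.integral_sub ((hpath (hw j) γ).intervalIntegrable _ _)
          ((hpath hv γ).intervalIntegrable _ _), residual_apply, residual_apply]
        abel
      rw [e]
      refine (norm_add_le _ _).trans (add_le_add (ContinuousMap.norm_coe_le_norm _ t) ?_)
      rw [intervalIntegral.integral_of_le t.2.1]
      refine (norm_integral_le_integral_norm _).trans ?_
      exact setIntegral_mono_set hdi.norm (ae_of_all _ fun r => norm_nonneg _)
        (Ioc_subset_Icc_self.trans (Icc_subset_Icc_right t.2.2)).eventuallyLE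
    rw [← ofReal_norm, ← ofReal_norm]
    refine (ENNReal.ofReal_le_ofReal h2).trans ?_
    rw [ENNReal.ofReal_add (norm_nonneg _) (by positivity), ofReal_integral_norm_eq_lintegral_enorm hdi]
  have h2 : ∀ j, ∫⁻ γ, ∫⁻ r in Icc a b, ‖w j (r, evalAt hab γ r) - v (r, evalAt hab γ r)‖ₑ
      ∂(volume : Measure ℝ) ∂(η : Measure C(Icc a b, H)) ≤ ENNReal.ofReal (c j) := by
    intro j
    have hwvm : Measurable fun p : ℝ × H => ‖w j p - v p‖ₑ := ((hw j).sub hv).enorm.measurable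
    -- After exchanging the integrals, the prescribed time marginals turn the expected discrepancy
    -- along paths into a space-time integral.
    rw [lintegral_lintegral_swap (hm j).aemeasurable]
    refine le_trans (le_of_eq ?_) ((lintegral_mono_set' (s := Icc a b) (t := Ioo a' b')
      (f := fun r => ∫⁻ u, ‖w j (r, u) - v (r, u)‖ₑ ∂(μ r : Measure H))
      (Icc_subset_Ioo ha hb).eventuallyLE).trans
      ((lintegral_spaceTime hμ hwvm).symm.trans_le (hwv j)))
    refine setLIntegral_congr_fun measurableSet_Icc fun r hr => ?_
    rw [← hη r hr]
    exact (lintegral_map (hwvm.comp measurable_prodMk_left)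
      (continuous_evalAt_left hab r).measurable).symm
  have h3 : ∀ j, ∫⁻ γ, ‖residual hab hv γ‖ₑ ∂(η : Measure C(Icc a b, H))
      ≤ ENNReal.ofReal (c j) + ENNReal.ofReal (c j) := fun j => by
    refine (lintegral_mono (h1 j)).trans ?_
    rw [lintegral_add_left (continuous_residual hab (hw j)).enorm.measurable]
    exact add_le_add (hwr j) (h2 j)
  have h4 : ∫⁻ γ, ‖residual hab hv γ‖ₑ ∂(η : Measure C(Icc a b, H)) = 0 := by
    have hc' := ENNReal.tendsto_ofReal hc
    rw [ENNReal.ofReal_zero] at hc'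
    have := ge_of_tendsto' (hc'.add hc') h3
    rw [add_zero] at this
    exact le_antisymm this zero_le
  filter_upwards [(lintegral_eq_zero_iff (continuous_residual hab hv).enorm.measurable).1 h4]
    with γ hγ
  have h5 : ‖residual hab hv γ‖ₑ = 0 := hγ
  rw [← ofReal_norm, ENNReal.ofReal_eq_zero] at h5
  exact norm_le_zero_iff.1 h5

/-- Superposition principle: a weakly narrowly continuous solution of the Liouville equation is
carried by a probability measure on solutions of the integrated equation. -/
theorem exists_superposition [CompleteSpace H] {e : HilbertBasis S ℝ H} {v : ℝ × H → H} (hv : Continuous v)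
    {μ : ℝ → ProbabilityMeasure H} (hμ : WeaklyNarrowlyContinuous e μ) {a' b' : ℝ}
    (hfin : FiniteSpeed v (Ioo a' b') μ) (hL : SolvesLiouville v (Ioo a' b') μ)
    (ha : a' < a) (hab : a < b) (hb : b < b') :
    ∃ η : ProbabilityMeasure C(Icc a b, H),
      (∀ t ∈ Icc a b, (η : Measure C(Icc a b, H)).map (fun γ => evalAt hab.le γ t) = μ t) ∧
      ∀ᵐ γ ∂(η : Measure C(Icc a b, H)), residual hab.le hv γ = 0 := by
  have : SecondCountableTopology H := UniformSpace.secondCountable_of_separable H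
  have hμm := hμ.measurable
  set M := spaceTime μ hμm a' b' with hM
  have hvi : Integrable v M := integrable_spaceTime hμm hv.measurable hfin
  set ε : ℕ → ℝ := fun n => 1 / ((n : ℝ) + 1) with hε
  have hε0 : ∀ n, 0 < ε n := fun n => by positivity
  have hεm : Antitone ε := fun i j hij => by
    have : (i : ℝ) ≤ j := Nat.cast_le.2 hij
    exact one_div_le_one_div_of_le (by positivity) (by linarith)
  have hεl : Tendsto ε atTop (𝓝 0) := tendsto_one_div_add_atTop_nhds_zero_nat
  obtain ⟨s₀, hs₀, hs₀l⟩ := exists_seq_monotone_tendsto_atTop_atTop (Finset S)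
  -- A precision `ε n` is only reached for large finite sets; passing to a subsequence makes it
  -- available at step `n`.
  obtain ⟨φ, hφ, hφW⟩ := extraction_forall_of_eventually fun n =>
    hs₀l.eventually (exists_cylindrical_approx e hv hvi (hε0 n))
  choose W hWs hWc hWe using hφW
  set s : ℕ → Finset S := fun n => s₀ (φ n) with hs
  have hsm : Monotone s := hs₀.comp hφ.monotone
  have hsl : Tendsto s atTop atTop := hs₀l.comp hφ.tendsto_atTop
  have hf := fun n => orthonormal_subfamily e (s n)
  have hWL : ∀ n, ∃ L, LipschitzWith L (W n) := fun n =>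
    (hWs n).lipschitzWith_of_hasCompactSupport (hWc n) (by simp)
  have hWB : ∀ n, ∃ B, ∀ y, ‖W n y‖ ≤ B := fun n =>
    (hWc n).exists_bound_of_continuous (hWs n).continuous
  choose L hL' using hWL
  choose B hB using hWB
  set w : ℕ → ℝ × H → H := fun n => liftField (subfamily e (s n)) (W n) with hw
  have hwc : ∀ n, Continuous (w n) := fun n => continuous_liftField (hWs n).continuous
  have hwi : ∀ n, Integrable (w n) M := fun n =>
    Integrable.of_bound (hwc n).aestronglyMeasurable (B n)
      (ae_of_all _ fun p => norm_liftField_le (hf n) (hB n) p)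
  have hwv : ∀ n, ∫ p, ‖w n p - v p‖ ∂M ≤ ε n := hWe
  -- The `n`-th chain is driven by `w n` but tested against all earlier fields `w j`, `j ≤ n`, which
  -- only see coordinates in `s j ⊆ s n`.
  have hex := fun n => exists_path_measure (a := a) (b := b) hμm hv.measurable hfin hL (hf n)
    (fun ψ hψ hψb => hμ.continuous_coords (s n) hψ hψb) ha hab hb (hWs n) (hL' n) (hB n)
    (Finset.range (n + 1)) (w := w) (fun i => lipschitzWith_liftField (hf i) (hL' i)) (Bw := B)
    (fun i p => norm_liftField_le (hf i) (hB i) p)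
    (fun i hi t x => by
      have hin : s i ⊆ s n := hsm (Nat.lt_succ_iff.1 (Finset.mem_range.1 hi))
      change liftField _ _ (t, basisProj e (s n) x) = liftField _ _ (t, x)
      rw [liftField, liftField, coords_basisProj e hin]) (hε0 n)
  choose P hPa hPr hPt using hex
  have hPr' : ∀ j n, j ≤ n → ∫⁻ γ, ‖residual hab.le (hwc j) γ‖ₑ ∂(P n : Measure C(Icc a b, H))
      ≤ ENNReal.ofReal (4 * ε j) := by
    intro j n hjn
    refine (hPr n j (Finset.mem_range.2 (Nat.lt_succ_of_le hjn))).trans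
      (ENNReal.ofReal_le_ofReal ?_)
    -- The constant four: `ε n + ε j` for the distance from `w n` to `w j`, `ε n` for that from `w
    -- n` to `v`, and `ε n` for the discretisation, with `ε n ≤ ε j`.
    have h1 := integral_norm_sub_le_add (hwi n) hvi (hwi j) (hwv n) (d := ε j) (by
      simpa only [norm_sub_rev] using hwv j)
    have h2 := hwv n
    have h3 := hεm hjn
    linarith
  have hc4 : Tendsto (fun n => 4 * ε n) atTop (𝓝 0) := by simpa using hεl.const_mul 4
  have htight := isTightMeasureSet_paths hab.le e (μ a) hsl (fun j => (hWs j).continuous)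
    (fun j => ⟨B j, hB j⟩) (P := P) hPa hc4 hPr'
  obtain ⟨l, η, hl, hη⟩ := exists_ultrafilter_tendsto htight
  have hηt : ∀ t ∈ Icc a b, (η : Measure C(Icc a b, H)).map (fun γ => evalAt hab.le γ t) = μ t := by
    intro t ht
    have hc2 : Tendsto (fun n => 2 * ε n) atTop (𝓝 0) := by simpa using hεl.const_mul 2
    refine map_evalAt_eq_of_tendsto hab.le hμ hsl hl hη hc2 fun n => ?_
    obtain ⟨t', -, h1, h2⟩ := hPt n t ht
    refine ⟨t', by linarith [hε0 n], fun K ψ hψ hψb => (h2 K ψ hψ hψb).trans ?_⟩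
    refine mul_le_mul_of_nonneg_left ?_ K.coe_nonneg
    linarith [hwv n]
  refine ⟨η, hηt, ae_residual_eq_zero hab.le hμm hv ha hb hηt hwc hc4 (fun j => ?_) fun j => ?_⟩
  · refine (ofReal_integral_norm_eq_lintegral_enorm ((hwi j).sub hvi)).symm.trans_le ?_
    exact ENNReal.ofReal_le_ofReal ((hwv j).trans (by linarith [hε0 j]))
  · refine lintegral_enorm_le_of_tendsto hη (continuous_residual hab.le (hwc j)) ?_
    filter_upwards [hl (eventually_ge_atTop j)] with n hn
    exact hPr' j n hn

end Superposition

end GenFlow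

namespace GenFlow

open MeasureTheory Set Filter Topology ProbabilityTheory
open scoped NNReal ENNReal BoundedContinuousFunction

/-! ### Strong solutions and sets of initial data -/

section StrongSolutions

variable {H : Type*} [NormedAddCommGroup H] [InnerProductSpace ℝ H] {v : ℝ × H → H}

/-- Continuity of the derivative is automatic, since it equals `v (t, u t)` and `u` is continuous.
-/
lemma isStrongSolution_of_hasDerivAt (hv : Continuous v) {I : Set ℝ} (hI : IsOpen I) {u₀ : H}
    {u : ℝ → H} (hu : ∀ t ∈ I, HasDerivAt u (v (t, u t)) t) (h0 : u 0 = u₀) :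
    IsStrongSolution v I u₀ u := by
  refine ⟨?_, hu, h0⟩
  rw [show (1 : ℕ∞ω) = 0 + 1 from rfl, contDiffOn_succ_iff_deriv_of_isOpen hI]
  refine ⟨fun t ht => (hu t ht).differentiableAt.differentiableWithinAt, by simp,
    contDiffOn_zero.2 ?_⟩
  have huc : ContinuousOn u I := fun t ht => (hu t ht).continuousAt.continuousWithinAt
  exact (hv.comp_continuousOn (continuousOn_id.prodMk huc)).congr fun t ht => (hu t ht).deriv

lemma IsStrongSolution.mono {I J : Set ℝ} {u₀ : H} {u : ℝ → H} (hu : IsStrongSolution v I u₀ u)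
    (hJ : J ⊆ I) : IsStrongSolution v J u₀ u :=
  ⟨hu.1.mono hJ, fun t ht => hu.2.1 t (hJ ht), hu.2.2⟩

lemma UniqueSolutions.eq_of_univ (huniq : UniqueSolutions v) {u₀ : H} {u w : ℝ → H}
    (hu : IsStrongSolution v univ u₀ u) (hw : IsStrongSolution v univ u₀ w) : u = w := by
  funext t
  have h1 := neg_abs_le t
  have h2 := le_abs_self t
  exact huniq (-(|t| + 1)) (|t| + 1) (by linarith [abs_nonneg t]) (by positivity) u₀ u w
    (hu.mono (subset_univ _)) (hw.mono (subset_univ _)) ⟨by linarith, by linarith⟩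

lemma isStrongSolution_flowMap (u₀ : globalData v) :
    IsStrongSolution v univ (u₀ : H) fun t => flowMap v t u₀ :=
  Classical.choose_spec u₀.2

variable {a b : ℝ}

lemma evalAt_eq_of_residual_eq_zero (hab : a ≤ b) (hv : Continuous v) {γ : C(Icc a b, H)}
    (hγ : residual hab hv γ = 0) {t : ℝ} (ht : t ∈ Icc a b) :
    evalAt hab γ t = evalAt hab γ a + ∫ r in a..t, v (r, evalAt hab γ r) := by
  have h1 := residual_apply hab hv γ ⟨t, ht⟩
  rw [hγ, ContinuousMap.zero_apply, sub_sub, eq_comm, sub_eq_zero] at h1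
  rw [evalAt_of_mem hab γ ht, h1]

/-- The integrated equation is differentiated. Only the open interval is available, because `evalAt`
extends the path by constants beyond the endpoints. -/
lemma isStrongSolution_evalAt [CompleteSpace H] (hab : a ≤ b) (hv : Continuous v)
    {γ : C(Icc a b, H)} (hγ : residual hab hv γ = 0) :
    IsStrongSolution v (Ioo a b) (evalAt hab γ 0) (evalAt hab γ) := by
  refine isStrongSolution_of_hasDerivAt hv isOpen_Ioo (fun t ht => ?_) rfl
  have hc : Continuous fun r => v (r, evalAt hab γ r) :=
    hv.comp (continuous_id.prodMk (continuous_evalAt hab γ))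
  have h1 : HasDerivAt (fun t => evalAt hab γ a + ∫ r in a..t, v (r, evalAt hab γ r))
      (v (t, evalAt hab γ t)) t :=
    (intervalIntegral.integral_hasDerivAt_right (hc.intervalIntegrable _ _)
      hc.aestronglyMeasurable.stronglyMeasurableAtFilter hc.continuousAt).const_add _
  refine h1.congr_of_eventuallyEq ?_
  filter_upwards [isOpen_Ioo.mem_nhds ht] with r hr
  exact evalAt_eq_of_residual_eq_zero hab hv hγ (Ioo_subset_Icc_self hr)

/-- The restriction of a global strong solution to a compact interval. -/
lemma IsStrongSolution.exists_path [CompleteSpace H] (hab : a ≤ b) (hv : Continuous v) {u₀ : H}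
    {u : ℝ → H} (hu : IsStrongSolution v univ u₀ u) :
    ∃ γ : C(Icc a b, H), residual hab hv γ = 0 ∧ ∀ t ∈ Icc a b, evalAt hab γ t = u t := by
  have huc : Continuous u := continuous_iff_continuousAt.2 fun t => (hu.2.1 t trivial).continuousAt
  have hcu : Continuous fun r => v (r, u r) := hv.comp (continuous_id.prodMk huc)
  set γ : C(Icc a b, H) := ⟨fun t => u t, huc.comp continuous_subtype_val⟩ with hγ
  have he : ∀ t ∈ Icc a b, evalAt hab γ t = u t := fun t ht => by
    rw [evalAt_of_mem hab γ ht]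
    rfl
  refine ⟨γ, ?_, he⟩
  ext t
  have h1 : ∫ r in a..t, v (r, evalAt hab γ r) = ∫ r in a..t, v (r, u r) := by
    refine intervalIntegral.integral_congr fun r hr => ?_
    rw [uIcc_of_le t.2.1] at hr
    rw [he r ⟨hr.1, hr.2.trans t.2.2⟩]
  rw [residual_apply, he a (left_mem_Icc.2 hab), h1,
    intervalIntegral.integral_eq_sub_of_hasDerivAt (fun r _ => hu.2.1 r trivial)
      (hcu.intervalIntegrable _ _)]
  exact sub_self _

/-- Solutions of the integrated equation are determined by their value at the origin. -/
lemma injOn_evalAt_zero [CompleteSpace H] (ha : a < 0) (hb : 0 < b) (hv : Continuous v)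
    (huniq : UniqueSolutions v) :
    InjOn (fun γ => evalAt (ha.trans hb).le γ 0)
      {γ : C(Icc a b, H) | residual (ha.trans hb).le hv γ = 0} := by
  intro γ hγ γ' hγ' h
  have hab := (ha.trans hb).le
  have h1 := isStrongSolution_evalAt hab hv hγ
  have h2 := isStrongSolution_evalAt hab hv hγ'
  simp only at h
  rw [← h] at h2
  -- Uniqueness is assumed on open intervals; continuity carries the equality to the endpoints.
  have h3 := (huniq a b ha hb _ _ _ h1 h2).closure (continuous_evalAt hab γ)
    (continuous_evalAt hab γ')
  rw [closure_Ioo (ha.trans hb).ne] at h3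
  ext t
  have h4 := h3 t.2
  rwa [evalAt_of_mem hab γ t.2, evalAt_of_mem hab γ' t.2] at h4

/-- The initial data whose solution exists on `[a, b]` and lies in `A` at time `t`. -/
def dataReaching (v : ℝ × H → H) (hab : a ≤ b) (hv : Continuous v) (t : ℝ) (A : Set H) : Set H :=
  {u₀ | ∃ γ : C(Icc a b, H), residual hab hv γ = 0 ∧ evalAt hab γ 0 = u₀ ∧ evalAt hab γ t ∈ A}

variable [CompleteSpace H] [TopologicalSpace.SeparableSpace H] [MeasurableSpace H] [BorelSpace H]

/-- A continuous image of a Borel set is in general only analytic. Injectivity of evaluation at `0`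
on solution paths makes it Borel, by the Lusin-Souslin theorem in the Polish space of paths. -/
theorem measurableSet_dataReaching (ha : a < 0) (hb : 0 < b) (hv : Continuous v)
    (huniq : UniqueSolutions v) (t : ℝ) {A : Set H} (hA : MeasurableSet A) :
    MeasurableSet (dataReaching v (ha.trans hb).le hv t A) := by
  have : SecondCountableTopology H := UniformSpace.secondCountable_of_separable H
  have hab := (ha.trans hb).le
  let : MeasurableSpace C(Icc a b, H) := borel _
  have : BorelSpace C(Icc a b, H) := ⟨rfl⟩
  have h1 : MeasurableSet ({γ : C(Icc a b, H) | residual hab hv γ = 0}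
      ∩ (fun γ => evalAt hab γ t) ⁻¹' A) :=
    (isClosed_eq (continuous_residual hab hv) continuous_const).measurableSet.inter
      ((continuous_evalAt_left hab t).measurable hA)
  convert h1.image_of_continuousOn_injOn (continuous_evalAt_left hab 0).continuousOn
    ((injOn_evalAt_zero ha hb hv huniq).mono inter_subset_left) using 1
  ext u₀
  constructor
  · rintro ⟨γ, h1, h2, h3⟩
    exact ⟨γ, ⟨h1, h3⟩, h2⟩
  · rintro ⟨γ, ⟨h1, h3⟩, h2⟩
    exact ⟨γ, h1, h2, h3⟩

theorem ae_mem_dataReaching_univ {S : Set ℕ} {e : HilbertBasis S ℝ H} (ha : a < 0) (hb : 0 < b)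
    (hv : Continuous v) {μ : ℝ → ProbabilityMeasure H} (hμ : WeaklyNarrowlyContinuous e μ)
    (hfin : ∀ a b : ℝ, a < 0 → 0 < b → FiniteSpeed v (Ioo a b) μ)
    (hL : ∀ a b : ℝ, a < 0 → 0 < b → SolvesLiouville v (Ioo a b) μ) (huniq : UniqueSolutions v) :
    ∀ᵐ u₀ ∂(μ 0 : Measure H), u₀ ∈ dataReaching v (ha.trans hb).le hv 0 univ := by
  have : SecondCountableTopology H := UniformSpace.secondCountable_of_separable H
  let : MeasurableSpace C(Icc a b, H) := borel _
  have : BorelSpace C(Icc a b, H) := ⟨rfl⟩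
  -- Superposition on `[a, b]` needs the Liouville equation on a strictly larger open interval.
  have ha' : a - 1 < 0 := by linarith
  have hb' : 0 < b + 1 := by linarith
  obtain ⟨η, h1, h2⟩ := exists_superposition hv hμ (hfin _ _ ha' hb') (hL _ _ ha' hb')
    (sub_one_lt a) (ha.trans hb) (lt_add_one b)
  rw [← h1 0 ⟨ha.le, hb.le⟩]
  refine (ae_map_iff (continuous_evalAt_left _ 0).measurable.aemeasurable
    (measurableSet_dataReaching ha hb hv huniq 0 MeasurableSet.univ)).2 ?_
  filter_upwards [h2] with γ hγ
  exact ⟨γ, hγ, rfl, mem_univ _⟩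

end StrongSolutions

/-! ### Global solutions and the flow map -/

section GlobalData

variable {H : Type*} [NormedAddCommGroup H] [InnerProductSpace ℝ H] [CompleteSpace H]
  {v : ℝ × H → H}

lemma neg_natCast_succ_lt_zero (n : ℕ) : -((n : ℝ) + 1) < 0 := by
  have : (0 : ℝ) ≤ n := n.cast_nonneg
  linarith

lemma natCast_succ_pos (n : ℕ) : (0 : ℝ) < (n : ℝ) + 1 := by positivity

lemma neg_natCast_succ_le (n : ℕ) : -((n : ℝ) + 1) ≤ (n : ℝ) + 1 :=
  ((neg_natCast_succ_lt_zero n).trans (natCast_succ_pos n)).le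

/-- Global solutions are obtained by gluing solutions on growing compact intervals. -/
theorem globalData_eq_iInter (hv : Continuous v) (huniq : UniqueSolutions v) :
    globalData v = ⋂ n : ℕ, dataReaching v (neg_natCast_succ_le n) hv 0 univ := by
  refine Subset.antisymm ?_ fun u₀ hu₀ => ?_
  · rintro u₀ ⟨u, hu⟩
    refine mem_iInter.2 fun n => ?_
    obtain ⟨γ, hγ, hγu⟩ := hu.exists_path (neg_natCast_succ_le n) hv
    exact ⟨γ, hγ, (hγu 0 ⟨(neg_natCast_succ_lt_zero n).le, (natCast_succ_pos n).le⟩).trans hu.2.2,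
      mem_univ _⟩
  · choose γ hγ hγ0 _ using mem_iInter.1 hu₀
    set w : ℕ → ℝ → H := fun n => evalAt (neg_natCast_succ_le n) (γ n) with hw
    have hws : ∀ n : ℕ, IsStrongSolution v (Ioo (-((n : ℝ) + 1)) ((n : ℝ) + 1)) u₀ (w n) := fun n => by
      have := isStrongSolution_evalAt (neg_natCast_succ_le n) hv (hγ n)
      rwa [hγ0] at this
    have hle : ∀ m n : ℕ, m ≤ n → EqOn (w m) (w n) (Ioo (-((m : ℝ) + 1)) ((m : ℝ) + 1)) := by
      intro m n hmn
      have : (m : ℝ) ≤ n := Nat.cast_le.2 hmn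
      exact huniq _ _ (neg_natCast_succ_lt_zero m) (natCast_succ_pos m) u₀ _ _ (hws m)
        ((hws n).mono (Ioo_subset_Ioo (by linarith) (by linarith)))
    -- The extra `1` puts `t` strictly inside the interval assigned to it, so near `t` the glued
    -- curve agrees with one single solution.
    have hmem : ∀ t : ℝ, t ∈ Ioo (-((⌈|t|⌉₊ : ℝ) + 1)) ((⌈|t|⌉₊ : ℝ) + 1) := fun t => by
      have := abs_le.1 (Nat.le_ceil |t|)
      exact ⟨by linarith, by linarith⟩
    have hglue : ∀ (n : ℕ) (t : ℝ), t ∈ Ioo (-((n : ℝ) + 1)) ((n : ℝ) + 1) →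
        w ⌈|t|⌉₊ t = w n t := by
      intro n t ht
      rcases le_total ⌈|t|⌉₊ n with h | h
      · exact hle _ _ h (hmem t)
      · exact (hle _ _ h ht).symm
    refine ⟨fun t => w ⌈|t|⌉₊ t, isStrongSolution_of_hasDerivAt hv isOpen_univ (fun t _ => ?_) ?_⟩
    · refine ((hws ⌈|t|⌉₊).2.1 t (hmem t)).congr_of_eventuallyEq ?_
      filter_upwards [isOpen_Ioo.mem_nhds (hmem t)] with r hr
      exact hglue _ r hr
    · exact hγ0 _

/-- The flow map is defined through a choice; by uniqueness any solution path on an interval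
containing `0` and `t` in its interior computes it, so its preimages inherit Borel measurability
from `dataReaching`. -/
lemma preimage_flowMap (hv : Continuous v) (huniq : UniqueSolutions v) {t : ℝ} {n : ℕ}
    (hn : |t| ≤ n) (A : Set H) : flowMap v t ⁻¹' A
      = Subtype.val ⁻¹' dataReaching v (neg_natCast_succ_le n) hv t A := by
  have h0 : (0 : ℝ) ∈ Icc (-((n : ℝ) + 1)) ((n : ℝ) + 1) :=
    ⟨(neg_natCast_succ_lt_zero n).le, (natCast_succ_pos n).le⟩
  have htn := abs_le.1 hn
  have ht : t ∈ Ioo (-((n : ℝ) + 1)) ((n : ℝ) + 1) := ⟨by linarith, by linarith⟩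
  ext u₀
  have hu := isStrongSolution_flowMap u₀
  constructor
  · intro h
    obtain ⟨γ, hγ, hγu⟩ := hu.exists_path (neg_natCast_succ_le n) hv
    refine ⟨γ, hγ, (hγu 0 h0).trans hu.2.2, ?_⟩
    rw [hγu t (Ioo_subset_Icc_self ht)]
    exact h
  · rintro ⟨γ, hγ, hγ0, hγt⟩
    have h1 := isStrongSolution_evalAt (neg_natCast_succ_le n) hv hγ
    rw [hγ0] at h1
    have h2 := huniq _ _ (neg_natCast_succ_lt_zero n) (natCast_succ_pos n) _ _ _ h1
      (hu.mono (subset_univ _)) ht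
    rw [mem_preimage, ← h2]
    exact hγt

variable [TopologicalSpace.SeparableSpace H] [MeasurableSpace H] [BorelSpace H]

theorem measurableSet_globalData (hv : Continuous v) (huniq : UniqueSolutions v) :
    MeasurableSet (globalData v) := by
  rw [globalData_eq_iInter hv huniq]
  exact MeasurableSet.iInter fun n => measurableSet_dataReaching (neg_natCast_succ_lt_zero n)
    (natCast_succ_pos n) hv huniq 0 MeasurableSet.univ

theorem measurable_flowMap (hv : Continuous v) (huniq : UniqueSolutions v) (t : ℝ) :
    Measurable (flowMap v t) := by
  intro A hA
  rw [preimage_flowMap hv huniq (Nat.le_ceil |t|) A]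
  exact measurable_subtype_coe (measurableSet_dataReaching (neg_natCast_succ_lt_zero _)
    (natCast_succ_pos _) hv huniq t hA)

theorem ae_mem_globalData {S : Set ℕ} {e : HilbertBasis S ℝ H} (hv : Continuous v)
    {μ : ℝ → ProbabilityMeasure H} (hμ : WeaklyNarrowlyContinuous e μ)
    (hfin : ∀ a b : ℝ, a < 0 → 0 < b → FiniteSpeed v (Ioo a b) μ)
    (hL : ∀ a b : ℝ, a < 0 → 0 < b → SolvesLiouville v (Ioo a b) μ) (huniq : UniqueSolutions v) :
    ∀ᵐ u₀ ∂(μ 0 : Measure H), u₀ ∈ globalData v := by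
  rw [globalData_eq_iInter hv huniq]
  simp only [mem_iInter]
  exact ae_all_iff.2 fun n => ae_mem_dataReaching_univ (neg_natCast_succ_lt_zero n)
    (natCast_succ_pos n) hv hμ hfin hL huniq

end GlobalData

end GenFlow

theorem theoremA6 {H : Type*} [NormedAddCommGroup H] [InnerProductSpace ℝ H] [CompleteSpace H]
    [TopologicalSpace.SeparableSpace H] [MeasurableSpace H] [BorelSpace H]
    {S : Set ℕ} (e : HilbertBasis S ℝ H)
    (v : ℝ × H → H) (hv : Continuous v) (hvb : GenFlow.BoundedOnBounded v)
    (μ : ℝ → MeasureTheory.ProbabilityMeasure H)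
    (hμ : GenFlow.WeaklyNarrowlyContinuous e μ)
    (hbound : ∀ a b : ℝ, a < 0 → 0 < b → GenFlow.FiniteSpeed v (Set.Ioo a b) μ)
    (hliouville : ∀ a b : ℝ, a < 0 → 0 < b → GenFlow.SolvesLiouville v (Set.Ioo a b) μ)
    (huniq : GenFlow.UniqueSolutions v) :
    (∀ᵐ u₀ ∂(μ 0 : MeasureTheory.Measure H),
      ∃! u : ℝ → H, GenFlow.IsStrongSolution v Set.univ u₀ u) ∧
    (∀ u₀ ∈ GenFlow.globalData v, ∃! u : ℝ → H, GenFlow.IsStrongSolution v Set.univ u₀ u) ∧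
    MeasurableSet (GenFlow.globalData v) ∧
    (μ 0 : MeasureTheory.Measure H) (GenFlow.globalData v) = 1 ∧
    ∀ t : ℝ, Measurable (GenFlow.flowMap v t) := by
  have hae := GenFlow.ae_mem_globalData hv hμ hbound hliouville huniq
  have hunique : ∀ u₀ ∈ GenFlow.globalData v,
      ∃! u : ℝ → H, GenFlow.IsStrongSolution v Set.univ u₀ u := by
    rintro u₀ ⟨u, hu⟩
    exact ⟨u, hu, fun w hw => huniq.eq_of_univ hw hu⟩
  have hmeas := GenFlow.measurableSet_globalData hv huniq
  exact ⟨hae.mono hunique, hunique, hmeas,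
    (MeasureTheory.mem_ae_iff_prob_eq_one hmeas).1 hae,
    GenFlow.measurable_flowMap hv huniq⟩
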